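/- **Theorem (Convergence for Kepler control systems).** Let $M$ be a smooth connected manifold of dimension $n$, endowed with the distance $d$ of a smooth Riemannian metric, and let $S^1=\mathbb R/2\pi\mathbb Z$. Let $\omega:S^1\times M\to\mathbb R$ and $g_1,\dots,g_m:S^1\times M\to\mathbb R$ be smooth functions and $G_1,\dots,G_m$ smooth vector fields on $M$ depending smoothly on $\theta\in S^1$. Write $g(\theta,x)v=\sum_i v_i g_i(\theta,x)$ and $G(\theta,x)v=\sum_i v_iG_i(\theta,x)$ for $v\in\mathbb R^m$, and assume that $\omega\ge k$ on $S^1\times M$ for some constant $k>0$. For $\varepsilon>0$ consider the control system $$(\mathcal K_\varepsilon)\qquad \dot\theta=\omega(\theta,x)+g(\theta,x)\,v,\qquad \dot x=G(\theta,x)\,v,\qquad v=\varepsilon u,\ \ \|u\|\le1 ,$$ on $S^1\times M$, with the Euclidean norm on $\mathbb R^m$ and absolutely continuous solutions satisfying the equations almost everywhere. Let $\overline\omega(x)$ be defined by $\dfrac1{\overline\omega(x)}=\dfrac1{2\pi}\displaystyle\int_0^{2\pi}\frac{d\theta}{\omega(\theta,x)}$ and let $$\mathcal E(x)=\Bigl\{\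 \overline\omega(x)\,\frac1{2\pi}\int_0^{2\pi}\frac{G(\theta,x)}{\omega(\theta,x)}\,U(\theta)\,d\theta\ :\ U\in L^\infty([0,2\pi],\mathbb R^m),\ \|U\|_\infty\le1\Bigr\}\subset T_xM .$$ A solution on $[0,T]$ of the average system is an absolutely continuous $x:[0,T]\to M$ with $\dot x(t)\in\mathcal E(x(t))$ for almost all $t$. Let $T>0$. 1. Let $x_0:[0,T]\to M$ be a solution of the average system and $\theta^0\in S^1$. There exist measurable controls $u_\varepsilon:[0,T/\varepsilon]\to\mathbb R^m$, $\|u_\varepsilon\|\le 1$, indexed by $\varepsilon>0$, and constants $c>0$, $\varepsilon_0>0$ such that, for $0<\varepsilon<\varepsilon_0$, the (unique) solution $(\theta_\varepsilon,x_\varepsilon)$ of $(\mathcal K_\varepsilon)$ with control $u=u_\varepsilon(t)$ and initial condition $(\theta^0,x_0(0))$ is defined on $[0,T/\varepsilon]$ and $$d\bigl(x_\varepsilon(t),x_0(\varepsilon t)\bigr)<c\,\varepsilon\qquad\text{for all }t\in[0,T/\varepsilon].$$ Consequently $\tau\mapsto x_\varepsilon(\tau/\varepsilon)$ converges uniformly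 on $[0,T]$ to $x_0$ as $\varepsilon\to0$. 2. Let $K\subset M$ be compact, $(\varepsilon_k)_{k\in\mathbb N}$ a decreasing sequence of positive real numbers converging to $0$ and, for each $k$, $(\theta_k,x_k):[0,T/\varepsilon_k]\to S^1\times K$ a solution of $(\mathcal K_{\varepsilon_k})$ for some control $u_k\in L^\infty([0,T/\varepsilon_k],\mathbb R^m)$ with $\|u_k\|_\infty\le1$. Then the sequence of maps $\tau\mapsto x_k(\tau/\varepsilon_k)$ is relatively compact for the topology of uniform convergence on $[0,T]$ (every subsequence has a uniformly convergent subsequence), and the limit of any uniformly convergent subsequence is a solution on $[0,T]$ of the average system. -/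

import Mathlib

open Set Filter Topology MeasureTheory Bundle
open scoped Real Manifold ContDiff

noncomputable section

/-- The Euclidean space `ℝᵈ`. -/
abbrev EucR (d : ℕ) : Type := EuclideanSpace ℝ (Fin d)

/-- The data of a Kepler control system on `S¹ × M`, where `S¹ = ℝ / 2πℤ` is `Real.Angle` and `M` is
a manifold of dimension `n`, with `m` scalar controls:
`θ' = ω(θ, x) + ∑ vᵢ gᵢ(θ, x)`, `x' = ∑ vᵢ Gᵢ(θ, x)`.
All the maps are smooth on `S¹ × M`. Since `ℝ → S¹` is a covering map and a local diffeomorphism,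
this is expressed as the smoothness on `ℝ × M` of the corresponding `2π`-periodic maps. -/
structure KeplerSystem (n m : ℕ) (M : Type*) [TopologicalSpace M] [ChartedSpace (EucR n) M]
    [IsManifold (𝓡 n) ∞ M] where
  /-- the frequency `ω` -/
  freq : Real.Angle → M → ℝ
  /-- the row `g` of the control coefficients in the equation of the angle -/
  angleCoeff : Fin m → Real.Angle → M → ℝ
  /-- the columns of `G`: vector fields on `M` depending on the angle -/
  field : Fin m → Real.Angle → (x : M) → TangentSpace (𝓡 n) x
  smooth_freq : ContMDiff (𝓘(ℝ, ℝ).prod (𝓡 n)) 𝓘(ℝ, ℝ) ∞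
    (fun p : ℝ × M => freq (p.1 : Real.Angle) p.2)
  smooth_angleCoeff : ∀ i, ContMDiff (𝓘(ℝ, ℝ).prod (𝓡 n)) 𝓘(ℝ, ℝ) ∞
    (fun p : ℝ × M => angleCoeff i (p.1 : Real.Angle) p.2)
  smooth_field : ∀ i, ContMDiff (𝓘(ℝ, ℝ).prod (𝓡 n)) (𝓡 n).tangent ∞
    (fun p : ℝ × M =>
      (⟨p.2, field i (p.1 : Real.Angle) p.2⟩ : TangentBundle (𝓡 n) M))
  /-- the frequency is bounded from below by a positive constant -/
  exists_lower_bound : ∃ k : ℝ, 0 < k ∧ ∀ θ x, k ≤ freq θ x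

/-- `u` represents an element of the closed unit ball of `L^∞(s, ℝᵐ)`. -/
def IsUnitControlOn {m : ℕ} (u : ℝ → EucR m) (s : Set ℝ) : Prop :=
  AEStronglyMeasurable u (volume.restrict s) ∧ ∀ᵐ t ∂(volume.restrict s), ‖u t‖ ≤ 1

/-- A tangent vector seen in the model space: the tangent space of Mathlib at `x` is by definition a
copy of the model space, with the same linear structure and topology. -/
def tangentToModel {n : ℕ} {M : Type*} [TopologicalSpace M] [ChartedSpace (EucR n) M]
    {x : M} (v : TangentSpace (𝓡 n) x) : EucR n := v

/-- The inverse of `tangentToModel`. -/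
def modelToTangent {n : ℕ} {M : Type*} [TopologicalSpace M] [ChartedSpace (EucR n) M]
    (x : M) (v : EucR n) : TangentSpace (𝓡 n) x := v

namespace KeplerSystem

variable {n m : ℕ} {M : Type*}

section Average

variable [TopologicalSpace M] [ChartedSpace (EucR n) M] [IsManifold (𝓡 n) ∞ M]

/-- The number `g(θ, x) v`. -/
def angleControl (S : KeplerSystem n m M) (θ : Real.Angle) (x : M) (v : EucR m) : ℝ :=
  ∑ i, v i * S.angleCoeff i θ x

/-- The tangent vector `G(θ, x) v`. -/
def fieldControl (S : KeplerSystem n m M) (θ : Real.Angle) (x : M) (v : EucR m) :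
    TangentSpace (𝓡 n) x :=
  ∑ i, v i • S.field i θ x

/-- The averaged frequency: the harmonic mean of `ω(·, x)` over the circle. -/
def averageFreq (S : KeplerSystem n m M) (x : M) : ℝ :=
  ((2 * π)⁻¹ * ∫ θ in (0 : ℝ)..(2 * π), (S.freq (θ : Real.Angle) x)⁻¹)⁻¹

/-- The averaged velocity `ω̄(x) (1/2π) ∫₀^{2π} (G(θ, x) / ω(θ, x)) U(θ) dθ` in `T_x M`. -/
def averageVelocity (S : KeplerSystem n m M) (x : M) (U : ℝ → EucR m) :
    TangentSpace (𝓡 n) x :=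
  S.averageFreq x • (2 * π)⁻¹ • modelToTangent x (∫ θ in (0 : ℝ)..(2 * π),
    tangentToModel ((S.freq (θ : Real.Angle) x)⁻¹ • S.fieldControl (θ : Real.Angle) x (U θ)))

/-- The velocity set of the average system at `x`. -/
def averageSet (S : KeplerSystem n m M) (x : M) : Set (TangentSpace (𝓡 n) x) :=
  {w | ∃ U : ℝ → EucR m, IsUnitControlOn U (Ioc 0 (2 * π)) ∧ w = S.averageVelocity x U}

end Average

section Solutions

variable [MetricSpace M] [ChartedSpace (EucR n) M] [IsManifold (𝓡 n) ∞ M]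

/-- `x` is a solution on `[0, T]` of the average differential inclusion: an absolutely continuous
curve whose velocity belongs to the velocity set almost everywhere. Absolute continuity is
meant for the distance of `M`; for a Riemannian distance, it is absolute continuity in charts. -/
def IsAverageSolution (S : KeplerSystem n m M) (T : ℝ) (x : ℝ → M) : Prop :=
  AbsolutelyContinuousOnInterval x 0 T ∧
  ∀ᵐ t ∂(volume.restrict (Icc 0 T)), ∃ w ∈ S.averageSet (x t),
    HasMFDerivAt 𝓘(ℝ, ℝ) (𝓡 n) x t ((1 : ℝ →L[ℝ] ℝ).smulRight w)

/-- `(θ, x)` is a solution on `[0, T]` of the Kepler control system with control `v = ε u`: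
it is absolutely continuous and satisfies the equations almost everywhere. The absolute
continuity and the velocity of the angle are those of its lift `Θ` to the real line. -/
def IsSolution (S : KeplerSystem n m M) (ε T : ℝ) (u : ℝ → EucR m)
    (θ : ℝ → Real.Angle) (x : ℝ → M) : Prop :=
  AbsolutelyContinuousOnInterval x 0 T ∧
  (∀ᵐ t ∂(volume.restrict (Icc 0 T)), HasMFDerivAt 𝓘(ℝ, ℝ) (𝓡 n) x t
    ((1 : ℝ →L[ℝ] ℝ).smulRight (S.fieldControl (θ t) (x t) (ε • u t)))) ∧
  ∃ Θ : ℝ → ℝ, (∀ t ∈ Icc 0 T, (Θ t : Real.Angle) = θ t) ∧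
    AbsolutelyContinuousOnInterval Θ 0 T ∧
    ∀ᵐ t ∂(volume.restrict (Icc 0 T)),
      HasDerivAt Θ (S.freq (θ t) (x t) + S.angleControl (θ t) (x t) (ε • u t)) t

end Solutions

end KeplerSystem

end

/-!
Both parts take place in a vector space. A compact part `K` of `M` is embedded in a vector space
`V` by finitely many charts multiplied by bump functions (`SmoothBumpCovering.chartEmbedding`). On
`K`, the embedding and its inverse are Lipschitz for the Riemannian distance, so that the distance
of `M` can be measured in `V`, and a solution becomes a curve `F ∘ x` in `V` driven by bounded
Lipschitz coefficients that are `2π`-periodic in the lifted angle (`OscillatingCoeffs`). The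
velocity set of the average system becomes the set of the integrals `∫₀^{2π} Q(θ) U(θ) dθ`, where
`Q` is the kernel `OscillatingCoeffs.kernel` and `U` runs over the controls bounded by `1`
(`attainableSet`). This set is convex and closed, since the unit ball of `L^∞` is convex, closed and
bounded in `L²`; the smooth controls vanishing at the ends of the turn give a dense part of it; and
its support function is `ℓ ↦ ∫₀^{2π} ‖ℓ ∘ Q(θ)‖ dθ`, the best control being the gradient of the
integrand.

*Limits of solutions.* The rescaled solutions have a common Lipschitz constant, and the
Arzelà–Ascoli theorem provides convergent subsequences. Let `ℓ` be a linear form. Along a solution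
that stays near `p`, the derivative of `ℓ ∘ F ∘ x` is at most `ε ‖ℓ ∘ field(θ, p)‖`, up to small
terms. The difference between `‖ℓ ∘ field(θ, p)‖` and its mean for the measure `dθ / ω(θ, p)` has,
once divided by `ω`, a bounded primitive in `θ`, hence contributes only `O(ε)`
(`OscillatingCoeffs.exists_clm_sub_le`). In the limit, `ℓ w` is at most the support function in the
direction `ℓ` for every velocity `w` of the limit curve, and the Hahn–Banach theorem puts `w` in the
attainable set.

*Approximation of a solution of the average system.* The slow time is cut into the turns of the
systems frozen at successive points of `x₀`. The mean velocity of `x₀` over a turn is, up to `O(ε)`,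
the effect of a smooth control `U` that vanishes at the ends of the turn, because the velocity sets
are convex and depend in a Lipschitz way on the point. The control is the succession of these `U`,
as a function of the angle. The pair formed by the state and the slow time, which is followed
because the turns of the actual solution and those of the frozen systems do not have the same
duration, is compared over each turn with a reference curve that joins the successive points of
`x₀`; an estimate of Grönwall type gives an error of order `ε` after `O(1 / ε)` turns
(`OscillatingCoeffs.IsEmbeddedAverageSolution.exists_tracking_control`). As the control is a smooth
function of the angle, the solution is an integral curve of a smooth vector field on `ℝ × M`. This
field is made complete by a cutoff, and the error estimate shows that its integral curve does not
leave the region where the cutoff is `1` before the time `T / ε`. Uniqueness is Grönwall's lemma in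
`V`.
-/

noncomputable section

/-! ### Smooth maps on a Riemannian manifold are locally Lipschitz -/

section Riemannian

open Manifold
open scoped NNReal ENNReal

variable {E : Type*} [NormedAddCommGroup E] [NormedSpace ℝ E]
  {H : Type*} [TopologicalSpace H] {I : ModelWithCorners ℝ E H}
  {M : Type*} [PseudoEMetricSpace M] [ChartedSpace H M]
  [RiemannianBundle (fun x : M => TangentSpace I x)]
  [IsManifold I 1 M] [IsContinuousRiemannianBundle E (fun x : M => TangentSpace I x)]

-- the tangent spaces of a vector space carry its own norm
attribute [local instance] normedAddCommGroupTangentSpaceVectorSpace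
attribute [local instance] normedSpaceTangentSpaceVectorSpace

lemma eventually_enorm_mfderivWithin_symm_extChartAt_le (x : M) :
    ∃ C : ℝ≥0, ∀ᶠ y in 𝓝[range I] (extChartAt I x x), ∀ v : TangentSpace 𝓘(ℝ, E) y,
      ‖mfderiv[range I] (extChartAt I x).symm y v‖ₑ ≤ C * ‖v‖ₑ := by
  rcases eventually_enorm_mfderivWithin_symm_extChartAt_lt I x with ⟨C, -, hC⟩
  refine ⟨C, hC.mono fun y hy v => ?_⟩
  refine (ContinuousLinearMap.le_opENorm (σ₁₂ := RingHom.id ℝ)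
    (mfderiv[range I] (extChartAt I x).symm y) v).trans ?_
  exact mul_le_mul' hy.le le_rfl

lemma eventually_enorm_mfderiv_extChartAt_le (x : M) :
    ∃ C : ℝ≥0, ∀ᶠ y in 𝓝 x, ∀ v : TangentSpace I y,
      ‖mfderiv% (extChartAt I x) y v‖ₑ ≤ C * ‖v‖ₑ := by
  rcases eventually_enorm_mfderiv_extChartAt_lt I x with ⟨C, -, hC⟩
  refine ⟨C, hC.mono fun y hy v => ?_⟩
  refine (ContinuousLinearMap.le_opENorm (σ₁₂ := RingHom.id ℝ)
    (mfderiv% (extChartAt I x) y) v).trans ?_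
  exact mul_le_mul' hy.le le_rfl

/-- Near `x`, the distance of two points is controlled by the distance of their images in the chart
at `x`: the segment between the images lifts to a path of controlled length. -/
lemma exists_edist_le_edist_extChartAt [IsRiemannianManifold I M] (x : M) :
    ∃ C : ℝ≥0, ∃ s ∈ 𝓝 x, ∀ y ∈ s, ∀ z ∈ s,
      edist y z ≤ C * edist (extChartAt I x y) (extChartAt I x z) := by
  rcases eventually_enorm_mfderivWithin_symm_extChartAt_le (I := I) x with ⟨C, hC⟩
  obtain ⟨r, r_pos, hr⟩ : ∃ r > 0,
      Metric.ball (extChartAt I x x) r ∩ range I ⊆ (extChartAt I x).target ∩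
        {y | ∀ v : TangentSpace 𝓘(ℝ, E) y,
          ‖mfderiv[range I] (extChartAt I x).symm y v‖ₑ ≤ C * ‖v‖ₑ} :=
    Metric.mem_nhdsWithin_iff.1 (inter_mem (extChartAt_target_mem_nhdsWithin x) hC)
  have A : (extChartAt I x) ⁻¹' (Metric.ball (extChartAt I x x) r ∩ range I) ∈ 𝓝 x := by
    apply extChartAt_preimage_mem_nhds_of_mem_nhdsWithin (by simp)
    rw [inter_comm]
    exact inter_mem_nhdsWithin _ (Metric.ball_mem_nhds _ r_pos)
  refine ⟨C, _, inter_mem A (chart_source_mem_nhds H x), ?_⟩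
  rintro y ⟨hy, h'y⟩ z ⟨hz, h'z⟩
  rw [IsRiemannianManifold.out (I := I) y z]
  let η := ContinuousAffineMap.lineMap (R := ℝ) (extChartAt I x y) (extChartAt I x z)
  set γ := (extChartAt I x).symm ∘ η
  have hη : Icc 0 1 ⊆ ⇑η ⁻¹' ((extChartAt I x).target ∩
        {y | ∀ v : TangentSpace 𝓘(ℝ, E) y,
          ‖mfderiv[range I] (extChartAt I x).symm y v‖ₑ ≤ C * ‖v‖ₑ}) := by
    simp only [← image_subset_iff, ContinuousAffineMap.coe_lineMap_eq,
     ← segment_eq_image_lineMap, η]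
    apply Subset.trans _ hr
    exact ((convex_ball _ _).inter I.convex_range).segment_subset hy hz
  simp only [preimage_inter, subset_inter_iff] at hη
  have η_smooth : ContMDiffOn 𝓘(ℝ, ℝ) 𝓘(ℝ, E) 1 η (Icc 0 1) := by
    apply ContMDiff.contMDiffOn
    rw [contMDiff_iff_contDiff]
    exact ContinuousAffineMap.contDiff _
  have : riemannianEDist I y z ≤ pathELength I γ 0 1 := by
    apply riemannianEDist_le_pathELength _ _ _ zero_le_one
    · exact (contMDiffOn_extChartAt_symm x).comp η_smooth hη.1
    · simp [γ, η, ContinuousAffineMap.coe_lineMap_eq, h'y]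
    · simp [γ, η, ContinuousAffineMap.coe_lineMap_eq, h'z]
  apply this.trans
  rw [← lintegral_fderiv_lineMap_eq_edist, pathELength_eq_lintegral_mfderivWithin_Icc,
    ← lintegral_const_mul' _ _ ENNReal.coe_ne_top]
  apply setLIntegral_mono' measurableSet_Icc (fun t ht ↦ ?_)
  have : mfderiv[Icc 0 1] γ t =
      (mfderiv[range I] (extChartAt I x).symm (η t)) ∘L (mfderiv[Icc 0 1] η t) := by
    apply mfderivWithin_comp
    · exact mdifferentiableWithinAt_extChartAt_symm (hη.1 ht)
    · exact η_smooth.mdifferentiableOn one_ne_zero t ht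
    · exact hη.1.trans (preimage_mono (extChartAt_target_subset_range x))
    · rw [uniqueMDiffWithinAt_iff_uniqueDiffWithinAt]
      exact uniqueDiffOn_Icc zero_lt_one t ht
  have : mfderiv[Icc 0 1] γ t 1 =
      (mfderiv[range I] (extChartAt I x).symm (η t)) (mfderiv[Icc 0 1] η t 1) := congr($this 1)
  rw [this]
  refine (hη.2 ht _).trans ?_
  simp only [mfderivWithin_eq_fderivWithin]
  exact le_of_eq rfl

variable {V : Type*} [NormedAddCommGroup V] [NormedSpace ℝ V]

/-- The derivative of a `C¹` map is locally bounded for the Riemannian norms. -/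
lemma eventually_enorm_mfderiv_le [BoundarylessManifold I M] {F : M → V}
    (hF : ContMDiff I 𝓘(ℝ, V) 1 F) (x : M) :
    ∃ C : ℝ≥0, ∀ᶠ y in 𝓝 x, ∀ v : TangentSpace I y,
      ‖(mfderiv I 𝓘(ℝ, V) F y v : V)‖ₑ ≤ C * ‖v‖ₑ := by
  rcases eventually_enorm_mfderiv_extChartAt_le (I := I) x with ⟨C, hC⟩
  have hG : ContDiffAt ℝ 1 (F ∘ (extChartAt I x).symm) (extChartAt I x x) := by
    have h := (contMDiffAt_iff.1 (hF x)).2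
    have h2 := h.contDiffAt (range_mem_nhds_isInteriorPoint
      (BoundarylessManifold.isInteriorPoint (I := I) (x := x)))
    simpa using! h2
  have hcont : ContinuousAt (fderiv ℝ (F ∘ (extChartAt I x).symm)) (extChartAt I x x) :=
    hG.continuousAt_fderiv one_ne_zero
  have hb : ∀ᶠ e in 𝓝 (extChartAt I x x), DifferentiableAt ℝ (F ∘ (extChartAt I x).symm) e ∧
      ‖fderiv ℝ (F ∘ (extChartAt I x).symm) e‖₊ <
        ‖fderiv ℝ (F ∘ (extChartAt I x).symm) (extChartAt I x x)‖₊ + 1 := by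
    refine ((hG.eventually (by simp)).mono fun e he => he.differentiableAt one_ne_zero).and ?_
    exact (hcont.nnnorm).eventually_lt continuousAt_const (by simp)
  set D := ‖fderiv ℝ (F ∘ (extChartAt I x).symm) (extChartAt I x x)‖₊ + 1
  refine ⟨D * C, ?_⟩
  filter_upwards [hC, (continuousAt_extChartAt (I := I) x).eventually hb,
    eventually_mem_nhds_iff.2 (extChartAt_source_mem_nhds (I := I) x)] with y hy hy2 hsrc v
  have hys : y ∈ (extChartAt I x).source := mem_of_mem_nhds hsrc
  have heq : F =ᶠ[𝓝 y] (F ∘ (extChartAt I x).symm) ∘ extChartAt I x := by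
    filter_upwards [hsrc] with z hz
    simp only [Function.comp_apply, (extChartAt I x).left_inv hz]
  rw [heq.mfderiv_eq, mfderiv_comp (I' := 𝓘(ℝ, E)) y hy2.1.mdifferentiableAt
    (mdifferentiableAt_extChartAt (by simpa using hys))]
  rw [mfderiv_eq_fderiv, ENNReal.coe_mul, mul_assoc]
  change ‖fderiv ℝ (F ∘ (extChartAt I x).symm) (extChartAt I x y)
    (mfderiv I 𝓘(ℝ, E) (extChartAt I x) y v)‖ₑ ≤ _
  refine (ContinuousLinearMap.le_opENorm _ _).trans ?_
  refine mul_le_mul' ?_ ?_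
  · exact ENNReal.coe_le_coe.2 hy2.2.le
  · exact hy v

/-- A `C¹` map with compact support is Lipschitz for the Riemannian distance: its derivative is
bounded, and the distance is an infimum of lengths of curves. -/
lemma exists_lipschitzWith_of_contMDiff_of_hasCompactSupport [BoundarylessManifold I M]
    [IsRiemannianManifold I M] {F : M → V} (hF : ContMDiff I 𝓘(ℝ, V) 1 F)
    (hc : HasCompactSupport F) : ∃ C : ℝ≥0, LipschitzWith C F := by
  obtain ⟨C, hC⟩ : ∃ C : ℝ≥0, ∀ y, ∀ v : TangentSpace I y,
      ‖(mfderiv I 𝓘(ℝ, V) F y v : V)‖ₑ ≤ C * ‖v‖ₑ := by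
    suffices ∃ C : ℝ≥0, ∀ y ∈ tsupport F, ∀ v : TangentSpace I y,
      ‖(mfderiv I 𝓘(ℝ, V) F y v : V)‖ₑ ≤ C * ‖v‖ₑ by
      obtain ⟨C, hC⟩ := this
      refine ⟨C, fun y v => ?_⟩
      by_cases hy : y ∈ tsupport F
      · exact hC y hy v
      · have : F =ᶠ[𝓝 y] fun _ => (0 : V) := notMem_tsupport_iff_eventuallyEq.1 hy
        rw [this.mfderiv_eq, mfderiv_const]
        exact (enorm_zero (E := V)).trans_le zero_le
    refine IsCompact.induction_on (p := fun s => ∃ C : ℝ≥0, ∀ y ∈ s, ∀ v : TangentSpace I y,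
      ‖(mfderiv I 𝓘(ℝ, V) F y v : V)‖ₑ ≤ C * ‖v‖ₑ) hc ⟨0, by simp⟩ ?_ ?_ ?_
    · rintro s t hst ⟨C, hC⟩
      exact ⟨C, fun y hy => hC y (hst hy)⟩
    · rintro s t ⟨C, hC⟩ ⟨D, hD⟩
      refine ⟨max C D, fun y hy v => ?_⟩
      rcases hy with hy | hy
      · exact (hC y hy v).trans (by gcongr; exact le_max_left _ _)
      · exact (hD y hy v).trans (by gcongr; exact le_max_right _ _)
    · intro x _
      obtain ⟨C, hC⟩ := eventually_enorm_mfderiv_le hF x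
      exact ⟨_, mem_nhdsWithin_of_mem_nhds hC, C, fun y hy => hy⟩
  refine ⟨C + 1, fun y z => ?_⟩
  have hC0 : ((C + 1 : ℝ≥0) : ℝ≥0∞) ≠ 0 := by simp
  by_contra! hlt
  rw [IsRiemannianManifold.out (I := I) y z, mul_comm,
    ← ENNReal.lt_div_iff_mul_lt (Or.inl hC0) (Or.inl ENNReal.coe_ne_top)] at hlt
  obtain ⟨γ, hγ0, hγ1, hγ, hlen⟩ := exists_lt_of_riemannianEDist_lt hlt
  rw [ENNReal.lt_div_iff_mul_lt (Or.inl hC0) (Or.inl ENNReal.coe_ne_top), mul_comm] at hlen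
  refine absurd hlen (not_lt.2 ?_)
  have hFγ : ContMDiffOn 𝓘(ℝ, ℝ) 𝓘(ℝ, V) 1 (F ∘ γ) (Icc 0 1) := hF.comp_contMDiffOn hγ
  rw [edist_comm, edist_eq_enorm_sub, ← hγ0, ← hγ1]
  calc ‖F (γ 1) - F (γ 0)‖ₑ
      ≤ ∫⁻ t in Icc 0 1, ‖derivWithin (F ∘ γ) (Icc 0 1) t‖ₑ :=
        enorm_sub_le_lintegral_derivWithin_Icc_of_contDiffOn_Icc
          (contMDiffOn_iff_contDiffOn.1 hFγ) zero_le_one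
    _ ≤ ∫⁻ t in Icc 0 1, (C + 1 : ℝ≥0) * ‖mfderiv[Icc 0 1] γ t 1‖ₑ := by
        apply setLIntegral_mono' measurableSet_Icc (fun t ht ↦ ?_)
        have h1 : mfderivWithin 𝓘(ℝ, ℝ) 𝓘(ℝ, V) (F ∘ γ) (Icc 0 1) t =
            (mfderiv I 𝓘(ℝ, V) F (γ t)) ∘L (mfderiv[Icc 0 1] γ t) := by
          apply mfderiv_comp_mfderivWithin
          · exact hF.mdifferentiable one_ne_zero _
          · exact hγ.mdifferentiableOn one_ne_zero _ ht
          · rw [uniqueMDiffWithinAt_iff_uniqueDiffWithinAt]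
            exact uniqueDiffOn_Icc zero_lt_one _ ht
        have h2 : derivWithin (F ∘ γ) (Icc 0 1) t =
            mfderiv I 𝓘(ℝ, V) F (γ t) (mfderiv[Icc 0 1] γ t 1) := by
          rw [← fderivWithin_derivWithin, ← mfderivWithin_eq_fderivWithin]
          exact congr($h1 1)
        rw [h2]
        refine (hC _ _).trans ?_
        gcongr
        simp
    _ = (C + 1 : ℝ≥0) * pathELength I γ 0 1 := by
        rw [lintegral_const_mul' _ _ ENNReal.coe_ne_top, pathELength_eq_lintegral_mfderivWithin_Icc]

end Riemannian

/-! ### Embedding a compact part of a manifold in a vector space -/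

section Embedding

open Manifold

variable {E : Type*} [NormedAddCommGroup E] [NormedSpace ℝ E] [FiniteDimensional ℝ E]
  {H : Type*} [TopologicalSpace H] {I : ModelWithCorners ℝ E H}
  {M : Type*} [TopologicalSpace M] [ChartedSpace H M]

variable (I) in
/-- A compact set is covered by finitely many bump functions. -/
lemma exists_finite_smoothBumpCovering {K : Set M} (hK : IsCompact K) :
    ∃ t : Finset M, Nonempty (SmoothBumpCovering t I M K) := by
  have hU : ∀ x ∈ K,
      {y | ∀ᶠ z in 𝓝 y, (Classical.arbitrary (SmoothBumpFunction I x)) z = 1} ∈ 𝓝 x := fun x _ =>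
    eventually_eventually_nhds.2 (SmoothBumpFunction.eventuallyEq_one _)
  obtain ⟨t, htK, ht⟩ := hK.elim_nhds_subcover _ hU
  refine ⟨t, ⟨⟨fun i => i, fun i => Classical.arbitrary _, fun i => htK _ i.2,
    locallyFinite_of_finite _, ?_⟩⟩⟩
  intro x hx
  obtain ⟨i, hi, hxi⟩ := mem_iUnion₂.1 (ht hx)
  exact ⟨⟨i, hi⟩, hxi⟩

variable {K : Set M} {ι : Type*}

/-- The map to a vector space given by the localized charts and the bump functions of a finite bump
covering of `K`. It is injective on `K`, and an immersion at the points of `K`. -/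
def SmoothBumpCovering.chartEmbedding (f : SmoothBumpCovering ι I M K) (x : M) : ι → E × ℝ :=
  fun i => (f i x • extChartAt I (f.c i) x, f i x)

lemma SmoothBumpCovering.chartEmbedding_injOn (f : SmoothBumpCovering ι I M K) :
    InjOn f.chartEmbedding K := by
  intro x hx y _ h
  obtain ⟨h₁, h₂⟩ := Prod.mk_inj.1 (congrFun h (f.ind x hx))
  rw [f.apply_ind x hx] at h₂
  rw [← h₂, f.apply_ind x hx, one_smul, one_smul] at h₁
  have := f.mem_extChartAt_source_of_eq_one h₂.symm
  exact (extChartAt I (f.c _)).injOn (f.mem_extChartAt_ind_source x hx) this h₁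

/-- Near a point of `K`, one of the components of the embedding is a chart. -/
lemma SmoothBumpCovering.eventually_chartEmbedding_eq (f : SmoothBumpCovering ι I M K) {x : M}
    (hx : x ∈ K) :
    ∀ᶠ y in 𝓝 x, (f.chartEmbedding y (f.ind x hx)).1 = extChartAt I (f.c (f.ind x hx)) y := by
  filter_upwards [f.eventuallyEq_one x hx] with y hy
  simp [chartEmbedding, hy]

variable [I.Boundaryless] [IsManifold I ∞ M] in
/-- A curve whose image by the embedding is differentiable is differentiable. -/
lemma SmoothBumpCovering.mdifferentiableAt_of_chartEmbedding (f : SmoothBumpCovering ι I M K)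
    {y : ℝ → M} {t : ℝ} (hyt : y t ∈ K) (hc : ContinuousAt y t)
    (hd : DifferentiableAt ℝ (f.chartEmbedding ∘ y) t) : MDifferentiableAt 𝓘(ℝ, ℝ) I y t := by
  set i := f.ind (y t) hyt with hi
  have h1 : DifferentiableAt ℝ (fun s => (f.chartEmbedding (y s) i).1) t :=
    (differentiableAt_pi.1 hd i).fst
  have h2 : ∀ᶠ s in 𝓝 t, (f.chartEmbedding (y s) i).1 = extChartAt I (f.c i) (y s) :=
    hc.eventually (f.eventually_chartEmbedding_eq hyt)
  have hsrc : y t ∈ (extChartAt I (f.c i)).source := f.mem_extChartAt_ind_source _ hyt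
  have h3 : ∀ᶠ s in 𝓝 t, y s ∈ (extChartAt I (f.c i)).source :=
    hc.eventually (extChartAt_source_mem_nhds' hsrc)
  have h4 : y =ᶠ[𝓝 t] (extChartAt I (f.c i)).symm ∘ fun s => (f.chartEmbedding (y s) i).1 := by
    filter_upwards [h2, h3] with s hs hs'
    rw [Function.comp_apply, hs, PartialEquiv.left_inv _ hs']
  refine MDifferentiableAt.congr_of_eventuallyEq ?_ h4
  have h5 := mdifferentiableWithinAt_extChartAt_symm (I := I)
    ((extChartAt I (f.c i)).map_source hsrc)
  rw [← h2.self_of_nhds] at h5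
  refine MDifferentiableAt.comp t (h5.mdifferentiableAt ?_) h1.mdifferentiableAt
  rw [h2.self_of_nhds]
  exact mem_of_superset (extChartAt_target_mem_nhds' ((extChartAt I (f.c i)).map_source hsrc))
    (extChartAt_target_subset_range _)

variable [T2Space M]

lemma SmoothBumpCovering.hasCompactSupport_chartEmbedding [Fintype ι]
    (f : SmoothBumpCovering ι I M K) : HasCompactSupport f.chartEmbedding := by
  refine HasCompactSupport.intro
    (isCompact_iUnion fun i => (f i).hasCompactSupport.isCompact) fun x hx => ?_
  ext i
  all_goals
    have : f i x = 0 := image_eq_zero_of_notMem_tsupport fun h => hx (mem_iUnion.2 ⟨i, h⟩)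
    simp [chartEmbedding, this]

variable [IsManifold I ∞ M] [Fintype ι]

lemma SmoothBumpCovering.contMDiff_chartEmbedding (f : SmoothBumpCovering ι I M K) :
    ContMDiff I 𝓘(ℝ, ι → E × ℝ) ∞ f.chartEmbedding :=
  contMDiff_pi_space.2 fun i =>
    ((f i).contMDiff_smul contMDiffOn_extChartAt).prodMk_space (f i).contMDiff

lemma SmoothBumpCovering.mfderiv_chartEmbedding_injective (f : SmoothBumpCovering ι I M K) {x : M}
    (hx : x ∈ K) : Function.Injective (mfderiv I 𝓘(ℝ, ι → E × ℝ) f.chartEmbedding x) := by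
  let L : (ι → E × ℝ) →L[ℝ] E := (ContinuousLinearMap.fst ℝ E ℝ).comp
    (ContinuousLinearMap.proj (R := ℝ) (φ := fun _ : ι => E × ℝ) (f.ind x hx))
  have h1 := mfderiv_comp (I'' := 𝓘(ℝ, E)) x (L.differentiableAt.mdifferentiableAt)
    (f.contMDiff_chartEmbedding.mdifferentiableAt (x := x) (by simp))
  have h2 : L ∘ f.chartEmbedding =ᶠ[𝓝 x] extChartAt I (f.c (f.ind x hx)) :=
    f.eventually_chartEmbedding_eq hx
  rw [h2.mfderiv_eq] at h1
  have h3 := (isInvertible_mfderiv_extChartAt (I := I)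
    (f.mem_extChartAt_ind_source x hx)).injective
  rw [h1] at h3
  exact Function.Injective.of_comp (f := mfderiv 𝓘(ℝ, ι → E × ℝ) 𝓘(ℝ, E) L _) h3

end Embedding

section RiemannianSmooth

open Manifold
open scoped NNReal

variable {E : Type*} [NormedAddCommGroup E] [NormedSpace ℝ E] [FiniteDimensional ℝ E]
  {H : Type*} [TopologicalSpace H] {I : ModelWithCorners ℝ E H}
  [I.Boundaryless]
  {M : Type*} [MetricSpace M] [ChartedSpace H M]
  [RiemannianBundle (fun x : M => TangentSpace I x)]
  [IsManifold I ∞ M] [IsContinuousRiemannianBundle E (fun x : M => TangentSpace I x)]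
  [IsRiemannianManifold I M]
  {V : Type*} [NormedAddCommGroup V] [NormedSpace ℝ V]

variable (I) in
lemma exists_lipschitzOnWith_extChartAt (p : M) :
    ∃ C : ℝ≥0, ∃ s ∈ 𝓝 p, LipschitzOnWith C (extChartAt I p) s := by
  let f : SmoothBumpFunction I p := Classical.arbitrary _
  have hF : ContMDiff I 𝓘(ℝ, E) ∞ (fun x => f x • extChartAt I p x) :=
    f.contMDiff_smul contMDiffOn_extChartAt
  obtain ⟨C, hC⟩ := exists_lipschitzWith_of_contMDiff_of_hasCompactSupport
    (hF.of_le (by simp)) f.hasCompactSupport.smul_right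
  refine ⟨C, {x | f x = 1}, f.eventuallyEq_one, fun x hx y hy => ?_⟩
  have := hC x y
  simp only [mem_ofPred_eq] at hx hy
  simpa [hx, hy] using this

/-- A smooth function of a real parameter and of a point of a Riemannian manifold is locally
Lipschitz. -/
lemma ContMDiff.locallyLipschitz_real_prod {h : ℝ × M → V}
    (hh : ContMDiff (𝓘(ℝ, ℝ).prod I) 𝓘(ℝ, V) ∞ h) : LocallyLipschitz h := by
  rintro ⟨θ, p⟩
  have h1 := (contMDiffAt_iff.1 ((hh (θ, p)).of_le (m := 1) (by simp))).2
  have h2 := h1.contDiffAt (range_mem_nhds_isInteriorPoint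
      (BoundarylessManifold.isInteriorPoint (I := 𝓘(ℝ, ℝ).prod I) (x := (θ, p))))
  obtain ⟨K, t, ht, hK⟩ := h2.exists_lipschitzOnWith
  obtain ⟨C, s, hs, hC⟩ := exists_lipschitzOnWith_extChartAt I p
  refine ⟨K * max 1 C, _, inter_mem (inter_mem (prod_mem_nhds univ_mem hs)
    ((continuousAt_extChartAt (I := 𝓘(ℝ, ℝ).prod I) (θ, p)).preimage_mem_nhds ht))
    (extChartAt_source_mem_nhds (I := 𝓘(ℝ, ℝ).prod I) (θ, p)), ?_⟩
  rintro ⟨θ₁, x⟩ ⟨⟨⟨-, hx⟩, hx1⟩, hx2⟩ ⟨θ₂, y⟩ ⟨⟨⟨-, hy⟩, hy1⟩, hy2⟩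
  have h3 := hK hx1 hy1
  simp only [Function.comp_apply, PartialEquiv.left_inv _ hx2, PartialEquiv.left_inv _ hy2,
    extChartAt_model_space_eq_id, PartialEquiv.refl_coe, id] at h3
  refine h3.trans ?_
  rw [ENNReal.coe_mul, mul_assoc]
  gcongr
  simp only [extChartAt_prod, PartialEquiv.prod_coe, Prod.edist_eq]
  refine max_le ?_ ?_
  · simp only [extChartAt_model_space_eq_id, PartialEquiv.refl_coe, id]
    calc edist θ₁ θ₂ = 1 * edist θ₁ θ₂ := (one_mul _).symm
      _ ≤ _ := mul_le_mul' (by simp) (le_max_left _ _)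
  · exact (hC hx hy).trans (mul_le_mul' (by simp) (le_max_right _ _))

variable {K : Set M} {ι : Type*} [Fintype ι]

/-- The embedding attached to a finite bump covering is Lipschitz for the Riemannian distance. -/
lemma SmoothBumpCovering.exists_lipschitzWith_chartEmbedding
    (f : SmoothBumpCovering ι I M K) : ∃ C : ℝ≥0, LipschitzWith C f.chartEmbedding :=
  exists_lipschitzWith_of_contMDiff_of_hasCompactSupport
    (f.contMDiff_chartEmbedding.of_le (by simp)) f.hasCompactSupport_chartEmbedding

/-- The inverse of the embedding attached to a finite bump covering of a compact set is Lipschitz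
on this set. -/
lemma SmoothBumpCovering.exists_dist_le_chartEmbedding (f : SmoothBumpCovering ι I M K)
    (hK : IsCompact K) : ∃ C : ℝ, 0 < C ∧ ∀ x ∈ K, ∀ y ∈ K,
      dist x y ≤ C * dist (f.chartEmbedding x) (f.chartEmbedding y) := by
  set F := f.chartEmbedding with hFdef
  suffices ∃ C : ℝ, ∀ q ∈ K ×ˢ K, dist q.1 q.2 ≤ C * dist (F q.1) (F q.2) by
    obtain ⟨C, hC⟩ := this
    refine ⟨max C 1, by positivity, fun x hx y hy => (hC (x, y) ⟨hx, hy⟩).trans ?_⟩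
    gcongr
    exact le_max_left _ _
  refine (hK.prod hK).induction_on (p := fun s => ∃ C : ℝ, ∀ q ∈ s,
    dist q.1 q.2 ≤ C * dist (F q.1) (F q.2)) ⟨0, by simp⟩ ?_ ?_ ?_
  · rintro s t hst ⟨C, hC⟩
    exact ⟨C, fun q hq => hC q (hst hq)⟩
  · rintro s t ⟨C, hC⟩ ⟨D, hD⟩
    refine ⟨max C D, fun q hq => ?_⟩
    rcases hq with hq | hq
    · exact (hC q hq).trans (by gcongr; exact le_max_left _ _)
    · exact (hD q hq).trans (by gcongr; exact le_max_right _ _)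
  rintro ⟨x, y⟩ ⟨hx : x ∈ K, hy : y ∈ K⟩
  by_cases hxy : x = y
  · -- near the diagonal, the embedding is a chart
    subst hxy
    set i := f.ind x hx
    obtain ⟨C, s, hs, hC⟩ := exists_edist_le_edist_extChartAt (I := I) x
    have hxs : x ∈ (extChartAt I (f.c i)).source := f.mem_extChartAt_ind_source x hx
    have htr : ContDiffAt ℝ 1 (extChartAt I x ∘ (extChartAt I (f.c i)).symm)
        (extChartAt I (f.c i) x) := by
      refine (contDiffWithinAt_ext_coord_change (I := I) (n := 1) x (f.c i) ?_).contDiffAt ?_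
      · rw [PartialEquiv.trans_source, PartialEquiv.symm_source]
        exact ⟨(extChartAt I (f.c i)).map_source hxs, by
          rw [mem_preimage, PartialEquiv.left_inv _ hxs]; exact mem_extChartAt_source x⟩
      · exact mem_of_superset
          (extChartAt_target_mem_nhds' ((extChartAt I (f.c i)).map_source hxs))
          (extChartAt_target_subset_range _)
    obtain ⟨D, t, ht, hD⟩ := htr.exists_lipschitzOnWith
    have hnear : {y | y ∈ s ∧ extChartAt I (f.c i) y ∈ t ∧ y ∈ (extChartAt I (f.c i)).source ∧
        (F y i).1 = extChartAt I (f.c i) y} ∈ 𝓝 x :=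
      (eventually_mem_set.2 hs).and (((continuousAt_extChartAt' hxs).eventually ht).and
        ((eventually_mem_set.2 (extChartAt_source_mem_nhds' hxs)).and
          (f.eventually_chartEmbedding_eq hx)))
    refine ⟨_, mem_nhdsWithin_of_mem_nhds (prod_mem_nhds hnear hnear), C * D, ?_⟩
    rintro ⟨y, z⟩ ⟨⟨hys, hyt, hyc, hyF⟩, hzs, hzt, hzc, hzF⟩
    have h1 := hC y hys z hzs
    rw [edist_nndist, edist_nndist, ← ENNReal.coe_mul, ENNReal.coe_le_coe] at h1
    have h2 := hD.dist_le_mul _ hyt _ hzt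
    simp only [Function.comp_apply, PartialEquiv.left_inv _ hyc, PartialEquiv.left_inv _ hzc] at h2
    have h3 : dist (extChartAt I (f.c i) y) (extChartAt I (f.c i) z) ≤ dist (F y) (F z) := by
      rw [← hyF, ← hzF]
      exact (le_max_left _ _).trans (dist_le_pi_dist (F y) (F z) i)
    calc dist y z ≤ C * dist (extChartAt I x y) (extChartAt I x z) := by exact_mod_cast h1
      _ ≤ C * (D * dist (F y) (F z)) := by
        gcongr
        exact h2.trans (by gcongr)
      _ = C * D * dist (F y) (F z) := by ring
  · have hne : F x ≠ F y := fun h => hxy (f.chartEmbedding_injOn hx hy h)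
    have hcont : ContinuousAt (fun q : M × M => dist q.1 q.2 - (dist x y + 1) /
      (dist (F x) (F y) / 2) * dist (F q.1) (F q.2)) (x, y) := by
      have := f.contMDiff_chartEmbedding.continuous
      fun_prop
    have hpos : 0 < dist (F x) (F y) := dist_pos.2 hne
    have hlt : dist x y - (dist x y + 1) / (dist (F x) (F y) / 2) * dist (F x) (F y) < 0 := by
      have : (dist x y + 1) / (dist (F x) (F y) / 2) * dist (F x) (F y) = 2 * (dist x y + 1) := by
        field_simp
      rw [this]
      linarith [dist_nonneg (x := x) (y := y)]
    refine ⟨_, mem_nhdsWithin_of_mem_nhds (hcont.eventually_lt continuousAt_const hlt), _,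
      fun q (hq : _ < _) => (sub_neg.1 hq).le⟩

end RiemannianSmooth

/-! ### Integral curves of vector fields with compact support -/

section IntegralCurves

open Manifold
open scoped NNReal

variable {E : Type*} [NormedAddCommGroup E] [NormedSpace ℝ E]
  {H : Type*} [TopologicalSpace H] {I : ModelWithCorners ℝ E H}
  {M : Type*} [TopologicalSpace M] [ChartedSpace H M]

/-- The integral curves of a `C¹` vector field are defined on an interval of uniform length for the
initial conditions near an interior point: a local flow in the chart is transported to the manifold.
-/
theorem eventually_exists_isMIntegralCurveOn_Ioo [CompleteSpace E] [IsManifold I 1 M]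
    {v : (x : M) → TangentSpace I x} {x₀ : M}
    (hv : ContMDiffAt I I.tangent 1 (fun x => (⟨x, v x⟩ : TangentBundle I M)) x₀)
    (hx : I.IsInteriorPoint x₀) :
    ∃ a > 0, ∀ᶠ x in 𝓝 x₀, ∃ γ : ℝ → M, γ 0 = x ∧ IsMIntegralCurveOn γ v (Ioo (-a) a) := by
  rw [contMDiffAt_iff] at hv
  obtain ⟨_, hv⟩ := hv
  obtain ⟨ε, hε, A, r, L, K, hr, hpl⟩ := IsPicardLindelof.of_contDiffAt_one
    (hv.contDiffAt (range_mem_nhds_isInteriorPoint hx)).snd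
  obtain ⟨α, hα, hcont⟩ := (hpl 0).exists_forall_mem_closedBall_eq_hasDerivWithinAt_continuousOn
  have hr' : (0 : ℝ) < r := hr
  have h0 : α (extChartAt I x₀ x₀, 0) = extChartAt I x₀ x₀ :=
    (hα _ (Metric.mem_closedBall_self hr'.le)).1
  have hca : ContinuousAt α (extChartAt I x₀ x₀, 0) :=
    hcont.continuousAt (prod_mem_nhds (Metric.closedBall_mem_nhds _ hr')
      (Icc_mem_nhds (by simpa using hε) (by simpa using hε)))
  have hpre : α ⁻¹' interior (extChartAt I x₀).target ∈ 𝓝 (extChartAt I x₀ x₀, (0 : ℝ)) := by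
    refine hca.preimage_mem_nhds ?_
    rw [h0]
    exact isOpen_interior.mem_nhds (I.isInteriorPoint_iff.mp hx)
  obtain ⟨s, hs, t, ht, hst⟩ := mem_nhds_prod_iff.1 hpre
  obtain ⟨b, hb, hbt⟩ := Metric.mem_nhds_iff.1 ht
  refine ⟨min b ε, lt_min hb hε, ?_⟩
  filter_upwards [(continuousAt_extChartAt (I := I) x₀).preimage_mem_nhds
    (inter_mem hs (Metric.closedBall_mem_nhds _ hr')), extChartAt_source_mem_nhds (I := I) x₀]
    with x hx1 hx2
  set f : ℝ → E := fun t => α (extChartAt I x₀ x, t) with hf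
  refine ⟨(extChartAt I x₀).symm ∘ f, ?_, ?_⟩
  · have : f 0 = extChartAt I x₀ x := (hα _ hx1.2).1
    rw [Function.comp_apply, this, PartialEquiv.left_inv _ hx2]
  intro t ht'
  have htb : t ∈ Metric.ball (0 : ℝ) b := by
    rw [Metric.mem_ball, dist_zero_right, Real.norm_eq_abs, abs_lt]
    exact ⟨by linarith [ht'.1, min_le_left b ε], by linarith [ht'.2, min_le_left b ε]⟩
  let xₜ : M := (extChartAt I x₀).symm (f t)
  have hder := (hα _ hx1.2).2 t ⟨by linarith [ht'.1, min_le_right b ε],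
    by linarith [ht'.2, min_le_right b ε]⟩
  have h : HasDerivAt f (x := t) <| fderivWithin ℝ (extChartAt I x₀ ∘ (extChartAt I xₜ).symm)
    (range I) (extChartAt I xₜ xₜ) (v xₜ) :=
    hder.hasDerivAt (Icc_mem_nhds (by linarith [ht'.1, min_le_right b ε])
      (by linarith [ht'.2, min_le_right b ε]))
  rw [← tangentCoordChange_def] at h
  have hf3 : f t ∈ interior (extChartAt I x₀).target := hst (mk_mem_prod hx1.1 (hbt htb))
  have hf3' := mem_of_mem_of_subset hf3 interior_subset
  have hft1 := mem_preimage.mp <|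
    mem_of_mem_of_subset hf3' (extChartAt I x₀).target_subset_preimage_source
  have hft2 := mem_extChartAt_source (I := I) xₜ
  have hvel : tangentCoordChange I x₀ xₜ xₜ (tangentCoordChange I xₜ x₀ xₜ (v xₜ)) = v xₜ :=
    (tangentCoordChange_comp (I := I) (x := x₀) ⟨⟨hft2, hft1⟩, hft2⟩).trans
      (tangentCoordChange_self (I := I) (x := xₜ) (z := xₜ) (v := v xₜ) hft2)
  have hcoord : HasFDerivAt (extChartAt I xₜ ∘ (extChartAt I x₀).symm)
      (tangentCoordChange I x₀ xₜ xₜ) (f t) := by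
    apply HasFDerivWithinAt.hasFDerivAt (s := range I) _ <|
      mem_nhds_iff.mpr ⟨interior (extChartAt I x₀).target,
        subset_trans interior_subset (extChartAt_target_subset_range ..),
        isOpen_interior, hf3⟩
    rw [← (extChartAt I x₀).right_inv hf3']
    exact hasFDerivWithinAt_tangentCoordChange ⟨hft1, hft2⟩
  have hcomp := hcoord.comp_hasDerivAt t h
  rw [hvel] at hcomp
  exact HasMFDerivAt.hasMFDerivWithinAt ⟨(continuousAt_extChartAt_symm'' hf3').comp h.continuousAt,
    hcomp.hasFDerivAt.hasFDerivWithinAt⟩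

/-- A `C¹` vector field with compact support is complete. -/
theorem exists_isMIntegralCurve_of_eqOn_zero_compl [CompleteSpace E] [IsManifold I 1 M]
    [BoundarylessManifold I M] [T2Space M] {v : (x : M) → TangentSpace I x}
    (hv : ContMDiff I I.tangent 1 (fun x => (⟨x, v x⟩ : TangentBundle I M)))
    {K : Set M} (hK : IsCompact K) (h0 : ∀ x ∉ K, v x = 0) (x : M) :
    ∃ γ : ℝ → M, γ 0 = x ∧ IsMIntegralCurve γ v := by
  obtain ⟨a, ha, hKa⟩ : ∃ a > 0, ∀ x ∈ K, ∃ γ : ℝ → M, γ 0 = x ∧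
      IsMIntegralCurveOn γ v (Ioo (-a) a) := by
    refine hK.induction_on (p := fun s => ∃ a > 0, ∀ x ∈ s, ∃ γ : ℝ → M, γ 0 = x ∧
      IsMIntegralCurveOn γ v (Ioo (-a) a)) ⟨1, one_pos, by simp⟩ ?_ ?_ ?_
    · rintro s t hst ⟨a, ha, h⟩
      exact ⟨a, ha, fun x hx => h x (hst hx)⟩
    · rintro s t ⟨a, ha, h⟩ ⟨b, hb, h'⟩
      refine ⟨min a b, lt_min ha hb, fun x hx => ?_⟩
      rcases hx with hx | hx
      · obtain ⟨γ, hγ, hγ'⟩ := h x hx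
        exact ⟨γ, hγ, hγ'.mono (Ioo_subset_Ioo (neg_le_neg (min_le_left _ _)) (min_le_left _ _))⟩
      · obtain ⟨γ, hγ, hγ'⟩ := h' x hx
        exact ⟨γ, hγ, hγ'.mono (Ioo_subset_Ioo (neg_le_neg (min_le_right _ _)) (min_le_right _ _))⟩
    · intro x _
      obtain ⟨a, ha, h⟩ := eventually_exists_isMIntegralCurveOn_Ioo (hv x)
        (BoundarylessManifold.isInteriorPoint (I := I))
      exact ⟨_, mem_nhdsWithin_of_mem_nhds h, a, ha, fun x hx => hx⟩
  refine exists_isMIntegralCurve_of_isMIntegralCurveOn hv ha (fun y => ?_) x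
  by_cases hy : y ∈ K
  · exact hKa y hy
  · exact ⟨fun _ => y, rfl, (isMIntegralCurve_const (h0 y hy)).isMIntegralCurveOn _⟩

lemma exists_contMDiff_eq_one_of_isCompact [FiniteDimensional ℝ E] [IsManifold I ∞ M]
    [T2Space M] {K : Set M} (hK : IsCompact K) :
    ∃ χ : M → ℝ, ContMDiff I 𝓘(ℝ, ℝ) ∞ χ ∧ HasCompactSupport χ ∧ ∀ x ∈ K, χ x = 1 := by
  obtain ⟨t, ⟨f⟩⟩ := exists_finite_smoothBumpCovering I hK
  refine ⟨fun x => 1 - ∏ i, (1 - f i x), ?_, ?_, ?_⟩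
  · exact contMDiff_const.sub (contMDiff_finsetProd fun i _ =>
      contMDiff_const.sub (f i).contMDiff)
  · refine HasCompactSupport.intro
      (isCompact_iUnion fun i => (f i).hasCompactSupport.isCompact) fun x hx => ?_
    have : ∀ i, f i x = 0 := fun i =>
      image_eq_zero_of_notMem_tsupport fun h => hx (mem_iUnion.2 ⟨i, h⟩)
    simp [this]
  · intro x hx
    change 1 - ∏ i, (1 - f i x) = 1
    rw [Finset.prod_eq_zero (Finset.mem_univ (f.ind x hx)) (sub_eq_zero.2 (f.apply_ind x hx).symm),
      sub_zero]

/-- For a compact set `K`, a smooth vector field can be modified outside of `K` into a complete one.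
-/
theorem exists_isMIntegralCurve_smul_of_isCompact [FiniteDimensional ℝ E] [IsManifold I ∞ M]
    [BoundarylessManifold I M] [T2Space M] {v : (x : M) → TangentSpace I x}
    (hv : ContMDiff I I.tangent ∞ (fun x => (⟨x, v x⟩ : TangentBundle I M)))
    {K : Set M} (hK : IsCompact K) (x : M) :
    ∃ (χ : M → ℝ) (γ : ℝ → M), (∀ y ∈ K, χ y = 1) ∧ γ 0 = x ∧
      IsMIntegralCurve γ (fun y => χ y • v y) := by
  have : CompleteSpace E := FiniteDimensional.complete ℝ E
  obtain ⟨χ, hχ, hχc, hχ1⟩ := exists_contMDiff_eq_one_of_isCompact (I := I) hK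
  obtain ⟨γ, hγ0, hγ⟩ := exists_isMIntegralCurve_of_eqOn_zero_compl (v := fun y => χ y • v y)
    ((ContMDiff.smul_section hχ hv).of_le (by simp)) hχc.isCompact
    (fun y hy => by rw [image_eq_zero_of_notMem_tsupport hy, zero_smul]) x
  exact ⟨χ, γ, hχ1, hγ0, hγ⟩

end IntegralCurves

/-! ### Absolutely continuous curves -/

section AbsolutelyContinuous

variable {V : Type*} [NormedAddCommGroup V] [NormedSpace ℝ V] {a b : ℝ}

lemma AbsolutelyContinuousOnInterval.of_dist_le {X Y : Type*} [PseudoMetricSpace X]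
    [PseudoMetricSpace Y] {f : ℝ → X} {g : ℝ → Y} (hg : AbsolutelyContinuousOnInterval g a b)
    {C : ℝ} (h : ∀ s ∈ uIcc a b, ∀ t ∈ uIcc a b, dist (f s) (f t) ≤ C * dist (g s) (g t)) :
    AbsolutelyContinuousOnInterval f a b := by
  have h0 := Tendsto.const_mul C hg
  rw [mul_zero] at h0
  refine squeeze_zero' (Eventually.of_forall fun E =>
    Finset.sum_nonneg fun i _ => dist_nonneg) ?_ h0
  refine eventually_inf_principal.2 (Eventually.of_forall fun E hE => ?_)
  rw [Finset.mul_sum]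
  exact Finset.sum_le_sum fun i hi => h _ (hE.1 i hi).1 _ (hE.1 i hi).2

lemma AbsolutelyContinuousOnInterval.sub_le_integral {f f' φ : ℝ → ℝ}
    (hf : AbsolutelyContinuousOnInterval f a b) (hab : a ≤ b)
    (hφ : IntervalIntegrable φ volume a b)
    (h : ∀ᵐ t ∂(volume.restrict (Icc a b)), HasDerivAt f (f' t) t ∧ f' t ≤ φ t) :
    f b - f a ≤ ∫ t in a..b, φ t := by
  rw [← hf.integral_deriv_eq_sub]
  refine intervalIntegral.integral_mono_ae_restrict hab hf.intervalIntegrable_deriv hφ ?_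
  filter_upwards [h] with t ht
  rw [ht.1.deriv]
  exact ht.2

lemma AbsolutelyContinuousOnInterval.clm_comp {X : ℝ → V}
    (hX : AbsolutelyContinuousOnInterval X a b) (ℓ : V →L[ℝ] ℝ) :
    AbsolutelyContinuousOnInterval (fun t => ℓ (X t)) a b :=
  hX.of_dist_le (C := ‖ℓ‖) fun _ _ _ _ => ℓ.dist_le_opNorm _ _

lemma AbsolutelyContinuousOnInterval.norm_sub_le_integral {X X' : ℝ → V} {φ : ℝ → ℝ}
    (hX : AbsolutelyContinuousOnInterval X a b) (hab : a ≤ b)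
    (hφ : IntervalIntegrable φ volume a b)
    (h : ∀ᵐ t ∂(volume.restrict (Icc a b)), HasDerivAt X (X' t) t ∧ ‖X' t‖ ≤ φ t) :
    ‖X b - X a‖ ≤ ∫ t in a..b, φ t := by
  obtain ⟨ℓ, hℓ, hℓX⟩ := exists_dual_vector'' ℝ (X b - X a)
  have h1 := (hX.clm_comp ℓ).sub_le_integral (f' := fun t => ℓ (X' t)) hab hφ ?_
  · rw [← map_sub, hℓX] at h1
    exact h1
  · filter_upwards [h] with t ht
    refine ⟨ℓ.hasFDerivAt.comp_hasDerivAt t ht.1, ?_⟩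
    calc ℓ (X' t) ≤ ‖ℓ (X' t)‖ := Real.le_norm_self _
      _ ≤ ‖ℓ‖ * ‖X' t‖ := ℓ.le_opNorm _
      _ ≤ 1 * φ t := by gcongr; exact ht.2
      _ = φ t := one_mul _

/-- A mean velocity belongs to any closed convex set that contains almost all the velocities. -/
lemma AbsolutelyContinuousOnInterval.smul_sub_mem_of_convex {X X' : ℝ → V} {C : Set V}
    (hX : AbsolutelyContinuousOnInterval X a b) (hab : a < b) (hC : Convex ℝ C)
    (hC' : IsClosed C)
    (h : ∀ᵐ t ∂(volume.restrict (Icc a b)), HasDerivAt X (X' t) t ∧ X' t ∈ C) :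
    (b - a)⁻¹ • (X b - X a) ∈ C := by
  by_contra hn
  obtain ⟨ℓ, u, hu, hu'⟩ := geometric_hahn_banach_closed_point hC hC' hn
  have h1 := (hX.clm_comp ℓ).sub_le_integral (f' := fun t => ℓ (X' t)) (φ := fun _ => u) hab.le
    intervalIntegrable_const ?_
  · rw [intervalIntegral.integral_const, ← map_sub, smul_eq_mul] at h1
    rw [map_smul, smul_eq_mul, inv_mul_eq_div, lt_div_iff₀ (sub_pos.2 hab)] at hu'
    linarith
  · filter_upwards [h] with t ht
    exact ⟨ℓ.hasFDerivAt.comp_hasDerivAt t ht.1, (hu _ ht.2).le⟩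

lemma AbsolutelyContinuousOnInterval.dist_le_of_norm_deriv_le {X X' : ℝ → V} {C : ℝ}
    (hX : AbsolutelyContinuousOnInterval X a b)
    (h : ∀ᵐ t ∂(volume.restrict (Icc a b)), HasDerivAt X (X' t) t ∧ ‖X' t‖ ≤ C)
    {s t : ℝ} (hs : s ∈ Icc a b) (ht : t ∈ Icc a b) : dist (X s) (X t) ≤ C * dist s t := by
  wlog hst : s ≤ t generalizing s t
  · rw [dist_comm, dist_comm s]
    exact this ht hs (le_of_not_ge hst)
  have hsub : Icc s t ⊆ Icc a b := Icc_subset_Icc hs.1 ht.2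
  have h1 := (hX.mono (c := s) (d := t) (by
      rw [uIcc_of_le hst, uIcc_of_le (hs.1.trans hs.2)]; exact hsub)).norm_sub_le_integral hst
    (φ := fun _ => C) intervalIntegrable_const (ae_restrict_of_ae_restrict_of_subset hsub h)
  rw [intervalIntegral.integral_const, smul_eq_mul] at h1
  rw [dist_comm, dist_eq_norm, dist_comm, Real.dist_eq, abs_of_nonneg (sub_nonneg.2 hst)]
  linarith

/-- A uniqueness criterion of Grönwall type. -/
lemma AbsolutelyContinuousOnInterval.eq_zero_of_norm_deriv_le {X X' : ℝ → V} {C : ℝ}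
    (hX : AbsolutelyContinuousOnInterval X a b) (hab : a ≤ b) (h0 : X a = 0)
    (h : ∀ᵐ t ∂(volume.restrict (Icc a b)), HasDerivAt X (X' t) t ∧ ‖X' t‖ ≤ C * ‖X t‖) :
    ∀ t ∈ Icc a b, X t = 0 := by
  have hc : ContinuousOn (fun t => C * ‖X t‖) (Icc a b) := by
    have := hX.continuousOn
    rw [uIcc_of_le hab] at this
    exact continuousOn_const.mul this.norm
  have hle : ∀ t ∈ Icc a b, ‖X t‖ ≤ ∫ s in a..t, C * ‖X s‖ := by
    intro t ht
    have hsub : Icc a t ⊆ Icc a b := Icc_subset_Icc_right ht.2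
    have h1 := (hX.mono (c := a) (d := t) (by
      rw [uIcc_of_le ht.1, uIcc_of_le hab]; exact hsub)).norm_sub_le_integral ht.1
      (φ := fun s => C * ‖X s‖) ((hc.mono hsub).intervalIntegrable_of_Icc ht.1)
      (ae_restrict_of_ae_restrict_of_subset hsub h)
    rwa [h0, sub_zero] at h1
  have hint : ∀ t ∈ Icc a b, IntervalIntegrable (fun t => C * ‖X t‖) volume a t := fun t ht =>
    (hc.mono (Icc_subset_Icc_right ht.2)).intervalIntegrable_of_Icc ht.1
  have hw := norm_le_gronwallBound_of_norm_deriv_right_le (a := a) (b := b)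
    (f := fun t => ∫ s in a..t, C * ‖X s‖) (f' := fun t => C * ‖X t‖) (δ := 0) (K := |C|) (ε := 0)
    ?_ ?_ (by simp) ?_
  · intro t ht
    have := (hle t ht).trans ((Real.le_norm_self _).trans (hw t ht))
    rw [gronwallBound_ε0_δ0] at this
    exact norm_le_zero_iff.1 this
  · have := intervalIntegral.continuousOn_primitive_interval (a := a) (b := b) (μ := volume)
      (f := fun t => C * ‖X t‖) (by
        rw [uIcc_of_le hab]; exact hc.integrableOn_Icc)
    rwa [uIcc_of_le hab] at this
  · intro t ht
    have hmem : Icc a b ∈ 𝓝[>] t := Icc_mem_nhdsGT_of_mem ht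
    refine intervalIntegral.integral_hasDerivWithinAt_right (hint t (Ico_subset_Icc_self ht))
      (s := Ici t) (t := Ioi t) ?_ ?_
    · exact (hc.stronglyMeasurableAtFilter_nhdsWithin measurableSet_Icc t).filter_mono
        (nhdsWithin_le_of_mem hmem)
    · exact (hc t (Ico_subset_Icc_self ht)).mono_of_mem_nhdsWithin hmem
  · intro t ht
    rw [norm_mul, norm_norm, add_zero, Real.norm_eq_abs]
    gcongr
    exact (hle t (Ico_subset_Icc_self ht)).trans (Real.le_norm_self _)

end AbsolutelyContinuous

/-! ### Integrals of bounded controls -/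

section HilbertConvex

variable {H : Type*} [NormedAddCommGroup H] [InnerProductSpace ℝ H] [CompleteSpace H]

/-- A decreasing sequence of nonempty closed convex bounded subsets of a Hilbert space has nonempty
intersection: the elements of minimal norm form a Cauchy sequence. -/
lemma nonempty_iInter_of_antitone_of_convex {D : ℕ → Set H} (hD : Antitone D)
    (hne : ∀ k, (D k).Nonempty) (hcl : ∀ k, IsClosed (D k)) (hcv : ∀ k, Convex ℝ (D k))
    {R : ℝ} (hR : ∀ x ∈ D 0, ‖x‖ ≤ R) : (⋂ k, D k).Nonempty := by
  have hmin : ∀ k, ∃ v ∈ D k, ∀ w ∈ D k, ‖w - v‖ ^ 2 ≤ ‖w‖ ^ 2 - ‖v‖ ^ 2 := by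
    intro k
    obtain ⟨v, hv, hv'⟩ := exists_norm_eq_iInf_of_complete_convex (hne k) (hcl k).isComplete
      (hcv k) 0
    refine ⟨v, hv, fun w hw => ?_⟩
    have h1 := (norm_eq_iInf_iff_real_inner_le_zero (hcv k) hv).1 hv' w hw
    rw [zero_sub, inner_neg_left] at h1
    have h2 : ‖w‖ ^ 2 = ‖w - v‖ ^ 2 + 2 * inner ℝ v (w - v) + ‖v‖ ^ 2 := by
      have := norm_add_sq_real v (w - v)
      rw [add_sub_cancel] at this
      linarith
    linarith
  choose v hv hv' using hmin
  have hsub : ∀ k j, k ≤ j → ‖v j - v k‖ ^ 2 ≤ ‖v j‖ ^ 2 - ‖v k‖ ^ 2 := fun k j hkj =>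
    hv' k _ (hD hkj (hv j))
  have hmono : Monotone fun k => ‖v k‖ ^ 2 := fun k j hkj => by
    have := hsub k j hkj
    have h2 := sq_nonneg ‖v j - v k‖
    simp only
    linarith
  have hbdd : BddAbove (range fun k => ‖v k‖ ^ 2) := by
    refine ⟨R ^ 2, ?_⟩
    rintro _ ⟨k, rfl⟩
    exact pow_le_pow_left₀ (norm_nonneg _) (hR _ (hD (Nat.zero_le k) (hv k))) 2
  have hc : CauchySeq v := by
    have h1 := (tendsto_atTop_ciSup hmono hbdd).cauchySeq
    rw [Metric.cauchySeq_iff'] at h1 ⊢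
    intro ε hε
    obtain ⟨N, hN⟩ := h1 (ε ^ 2) (by positivity)
    refine ⟨N, fun n hn => ?_⟩
    have h2 := hN n hn
    rw [Real.dist_eq, abs_of_nonneg (sub_nonneg.2 (hmono hn))] at h2
    rw [dist_eq_norm]
    exact lt_of_pow_lt_pow_left₀ 2 hε.le ((hsub N n hn).trans_lt h2)
  obtain ⟨x, hx⟩ := cauchySeq_tendsto_of_complete hc
  refine ⟨x, mem_iInter.2 fun k => (hcl k).mem_of_tendsto hx ?_⟩
  filter_upwards [eventually_ge_atTop k] with j hj using hD hj (hv j)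

/-- The image of a bounded closed convex subset of a Hilbert space by a continuous linear map is
closed. -/
lemma IsClosed.image_clm_of_convex {V : Type*} [NormedAddCommGroup V] [NormedSpace ℝ V]
    (T : H →L[ℝ] V) {B : Set H} (hB : IsClosed B) (hcv : Convex ℝ B) {R : ℝ}
    (hR : ∀ x ∈ B, ‖x‖ ≤ R) : IsClosed (T '' B) := by
  refine isClosed_of_closure_subset fun w hw => ?_
  have hne : (⋂ k : ℕ, B ∩ T ⁻¹' Metric.closedBall w (1 / (k + 1))).Nonempty := by
    refine nonempty_iInter_of_antitone_of_convex (R := R) ?_ ?_ ?_ ?_ (fun x hx => hR x hx.1)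
    · intro j k hjk x hx
      exact ⟨hx.1, Metric.closedBall_subset_closedBall (Nat.one_div_le_one_div hjk) hx.2⟩
    · intro k
      obtain ⟨_, ⟨x, hx, rfl⟩, hxw⟩ :=
        Metric.mem_closure_iff.1 hw (1 / (k + 1)) Nat.one_div_pos_of_nat
      exact ⟨x, hx, by rw [mem_preimage, Metric.mem_closedBall, dist_comm]; exact hxw.le⟩
    · exact fun k => hB.inter (Metric.isClosed_closedBall.preimage T.continuous)
    · exact fun k => hcv.inter ((convex_closedBall w _).linear_preimage T.toLinearMap)
  obtain ⟨x, hx⟩ := hne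
  rw [mem_iInter] at hx
  refine ⟨x, (hx 0).1, ?_⟩
  rw [← dist_le_zero]
  exact ge_of_tendsto' (tendsto_one_div_add_atTop_nhds_zero_nat (𝕜 := ℝ)) fun k => (hx k).2

end HilbertConvex

section ControlIntegral

variable {m : ℕ} {V : Type*} [NormedAddCommGroup V] [NormedSpace ℝ V]

/-- The effect `∫₀^{2π} Q(θ) U(θ) dθ` of a control `U` over one turn. -/
def controlIntegral (Q : ℝ → EucR m →L[ℝ] V) (U : ℝ → EucR m) : V :=
  ∫ θ in (0 : ℝ)..(2 * π), Q θ (U θ)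

/-- The set of the effects over one turn of the controls bounded by `1`. -/
def attainableSet (Q : ℝ → EucR m →L[ℝ] V) : Set V :=
  {w | ∃ U : ℝ → EucR m, IsUnitControlOn U (Ioc 0 (2 * π)) ∧ w = controlIntegral Q U}

variable {Q Q' : ℝ → EucR m →L[ℝ] V} {U U' : ℝ → EucR m}

lemma aestronglyMeasurable_clm_control (hQ : Continuous Q) {μ : Measure ℝ}
    (hU : AEStronglyMeasurable U μ) : AEStronglyMeasurable (fun θ => Q θ (U θ)) μ :=
  (ContinuousLinearMap.id ℝ (EucR m →L[ℝ] V)).aestronglyMeasurable_comp₂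
    hQ.aestronglyMeasurable hU

lemma IsUnitControlOn.intervalIntegrable (hQ : Continuous Q)
    (hU : IsUnitControlOn U (Ioc 0 (2 * π))) :
    IntervalIntegrable (fun θ => Q θ (U θ)) volume 0 (2 * π) := by
  rw [intervalIntegrable_iff_integrableOn_Ioc_of_le Real.two_pi_pos.le]
  obtain ⟨C, hC⟩ := isCompact_Icc.exists_bound_of_continuousOn (s := Icc (0 : ℝ) (2 * π))
    hQ.continuousOn
  refine Integrable.of_bound (C := C) (aestronglyMeasurable_clm_control hQ hU.1) ?_
  filter_upwards [hU.2, ae_restrict_mem measurableSet_Ioc] with θ h1 h2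
  calc ‖Q θ (U θ)‖ ≤ ‖Q θ‖ * ‖U θ‖ := (Q θ).le_opNorm _
    _ ≤ C * 1 := mul_le_mul (hC θ (Ioc_subset_Icc_self h2)) h1 (norm_nonneg _)
        ((norm_nonneg _).trans (hC θ (Ioc_subset_Icc_self h2)))
    _ = C := mul_one C

lemma norm_controlIntegral_le {C : ℝ} (hC : ∀ θ, ‖Q θ‖ ≤ C)
    (hU : IsUnitControlOn U (Ioc 0 (2 * π))) : ‖controlIntegral Q U‖ ≤ 2 * π * C := by
  have h0 : 0 ≤ C := (norm_nonneg _).trans (hC 0)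
  have := intervalIntegral.norm_integral_le_of_norm_le_const_ae (a := 0) (b := 2 * π) (C := C)
    (f := fun θ => Q θ (U θ)) ?_
  · rw [sub_zero, abs_of_pos Real.two_pi_pos] at this
    rw [controlIntegral]
    linarith
  · have h2 := hU.2
    rw [ae_restrict_iff' measurableSet_Ioc] at h2
    filter_upwards [h2] with θ h1 h2
    rw [uIoc_of_le Real.two_pi_pos.le] at h2
    calc ‖Q θ (U θ)‖ ≤ ‖Q θ‖ * ‖U θ‖ := (Q θ).le_opNorm _
      _ ≤ C * 1 := mul_le_mul (hC θ) (h1 h2) (norm_nonneg _) h0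
      _ = C := mul_one C

lemma norm_controlIntegral_sub_le {C : ℝ} (hQ : Continuous Q) (hQ' : Continuous Q')
    (hC : ∀ θ, ‖Q θ - Q' θ‖ ≤ C) (hU : IsUnitControlOn U (Ioc 0 (2 * π))) :
    ‖controlIntegral Q U - controlIntegral Q' U‖ ≤ 2 * π * C := by
  have h := norm_controlIntegral_le (Q := fun θ => Q θ - Q' θ) hC hU
  have h1 : controlIntegral (fun θ => Q θ - Q' θ) U = controlIntegral Q U - controlIntegral Q' U :=
    intervalIntegral.integral_sub (hU.intervalIntegrable hQ) (hU.intervalIntegrable hQ')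
  rwa [h1] at h

lemma controlIntegral_mem_attainableSet (hU : IsUnitControlOn U (Ioc 0 (2 * π))) :
    controlIntegral Q U ∈ attainableSet Q := ⟨U, hU, rfl⟩

lemma isUnitControlOn_zero (s : Set ℝ) : IsUnitControlOn (fun _ => (0 : EucR m)) s :=
  ⟨aestronglyMeasurable_const, by simp⟩

lemma zero_mem_attainableSet : (0 : V) ∈ attainableSet Q :=
  ⟨fun _ => 0, isUnitControlOn_zero _, by simp [controlIntegral]⟩

lemma convex_attainableSet (hQ : Continuous Q) : Convex ℝ (attainableSet Q) := by
  rintro _ ⟨U, hU, rfl⟩ _ ⟨U', hU', rfl⟩ a b ha hb hab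
  refine ⟨fun θ => a • U θ + b • U' θ, ⟨(hU.1.const_smul a).add (hU'.1.const_smul b), ?_⟩, ?_⟩
  · filter_upwards [hU.2, hU'.2] with θ h1 h2
    calc ‖a • U θ + b • U' θ‖ ≤ ‖a • U θ‖ + ‖b • U' θ‖ := norm_add_le _ _
      _ = a * ‖U θ‖ + b * ‖U' θ‖ := by
        rw [norm_smul, norm_smul, Real.norm_of_nonneg ha, Real.norm_of_nonneg hb]
      _ ≤ a * 1 + b * 1 := by gcongr
      _ = 1 := by linarith
  · simp only [controlIntegral, map_add, map_smul]
    rw [← intervalIntegral.integral_smul, ← intervalIntegral.integral_smul]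
    exact (intervalIntegral.integral_add ((hU.intervalIntegrable hQ).smul a)
      ((hU'.intervalIntegrable hQ).smul b)).symm

/-- The effect over one turn is a continuous function of a control in `L²`. -/
lemma exists_clm_eq_controlIntegral (hQ : Continuous Q) :
    ∃ T : Lp (EucR m) 2 (volume.restrict (Ioc 0 (2 * π))) →L[ℝ] V,
      ∀ U, T U = controlIntegral Q U := by
  set μ := volume.restrict (Ioc (0 : ℝ) (2 * π)) with hμ
  obtain ⟨C, hC⟩ := isCompact_Icc.exists_bound_of_continuousOn (s := Icc (0 : ℝ) (2 * π))
    hQ.continuousOn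
  have hC0 : 0 ≤ C := (norm_nonneg _).trans (hC 0 ⟨le_rfl, Real.two_pi_pos.le⟩)
  have hCμ : ∀ᵐ θ ∂μ, ‖Q θ‖ ≤ C := by
    filter_upwards [ae_restrict_mem measurableSet_Ioc] with θ h2 using hC θ (Ioc_subset_Icc_self h2)
  have h12 : ∀ U : Lp (EucR m) 2 μ, Integrable U μ := fun U =>
    (Lp.memLp U).integrable (by norm_num)
  have hle : ∀ U : Lp (EucR m) 2 μ, ∀ᵐ θ ∂μ, ‖Q θ (U θ)‖ ≤ C * ‖U θ‖ := fun U => by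
    filter_upwards [hCμ] with θ hθ
    exact ((Q θ).le_opNorm _).trans (by gcongr)
  have hint : ∀ U : Lp (EucR m) 2 μ, Integrable (fun θ => Q θ (U θ)) μ := fun U =>
    ((h12 U).norm.const_mul C).mono'
      (aestronglyMeasurable_clm_control hQ (Lp.aestronglyMeasurable U)) (hle U)
  have hctl : ∀ U : ℝ → EucR m, controlIntegral Q U = ∫ θ, Q θ (U θ) ∂μ := fun U =>
    intervalIntegral.integral_of_le Real.two_pi_pos.le
  let T : Lp (EucR m) 2 μ →ₗ[ℝ] V :=
    { toFun := fun U => controlIntegral Q U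
      map_add' := fun U U' => by
        simp only [hctl]
        rw [← integral_add (hint U) (hint U')]
        refine integral_congr_ae ?_
        filter_upwards [Lp.coeFn_add U U'] with θ hθ
        rw [hθ, Pi.add_apply, map_add]
      map_smul' := fun c U => by
        simp only [hctl, RingHom.id_apply]
        rw [← integral_smul]
        refine integral_congr_ae ?_
        filter_upwards [Lp.coeFn_smul c U] with θ hθ
        rw [hθ, Pi.smul_apply, map_smul] }
  set D := (μ univ ^ (1 / (1 : ENNReal).toReal - 1 / (2 : ENNReal).toReal)).toReal
  refine ⟨T.mkContinuous (C * D) fun U => ?_, fun U => rfl⟩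
  change ‖controlIntegral Q U‖ ≤ _
  rw [hctl]
  have h1 : ∫ θ, ‖U θ‖ ∂μ ≤ ‖U‖ * D := by
    rw [integral_norm_eq_lintegral_enorm (Lp.aestronglyMeasurable U), Lp.norm_def,
      ← ENNReal.toReal_mul, ← eLpNorm_one_eq_lintegral_enorm]
    refine ENNReal.toReal_mono ?_ (eLpNorm_le_eLpNorm_mul_rpow_measure_univ (by norm_num)
      (Lp.aestronglyMeasurable U))
    refine ENNReal.mul_ne_top (Lp.eLpNorm_ne_top U) ?_
    exact ENNReal.rpow_ne_top_of_nonneg (by norm_num) (measure_ne_top μ univ)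
  calc ‖∫ θ, Q θ (U θ) ∂μ‖ ≤ ∫ θ, C * ‖U θ‖ ∂μ :=
        norm_integral_le_of_norm_le ((h12 U).norm.const_mul C) (hle U)
    _ = C * ∫ θ, ‖U θ‖ ∂μ := integral_const_mul _ _
    _ ≤ C * (‖U‖ * D) := by gcongr
    _ = C * D * ‖U‖ := by ring

/-- The unit ball of `L^∞` is closed in `L²`. -/
lemma isClosed_setOf_ae_norm_le_one {μ : Measure ℝ} :
    IsClosed {U : Lp (EucR m) 2 μ | ∀ᵐ θ ∂μ, ‖U θ‖ ≤ 1} := by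
  refine IsSeqClosed.isClosed fun U U₀ hU hlim => ?_
  obtain ⟨ns, -, hns⟩ := (tendstoInMeasure_of_tendsto_Lp hlim).exists_seq_tendsto_ae
  have h1 : ∀ᵐ θ ∂μ, ∀ i, ‖U (ns i) θ‖ ≤ 1 := ae_all_iff.2 fun i => hU (ns i)
  filter_upwards [hns, h1] with θ h2 h3
  exact le_of_tendsto' h2.norm h3

lemma isClosed_attainableSet (hQ : Continuous Q) : IsClosed (attainableSet Q) := by
  set μ := volume.restrict (Ioc (0 : ℝ) (2 * π)) with hμ
  obtain ⟨T, hT⟩ := exists_clm_eq_controlIntegral hQ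
  have hcongr : ∀ U U' : ℝ → EucR m, U =ᵐ[μ] U' → controlIntegral Q U = controlIntegral Q U' := by
    intro U U' h
    rw [controlIntegral, controlIntegral, intervalIntegral.integral_of_le Real.two_pi_pos.le,
      intervalIntegral.integral_of_le Real.two_pi_pos.le]
    refine integral_congr_ae ?_
    filter_upwards [h] with θ hθ
    rw [hθ]
  have himg : attainableSet Q = T '' {U : Lp (EucR m) 2 μ | ∀ᵐ θ ∂μ, ‖U θ‖ ≤ 1} := by
    ext w
    constructor
    · rintro ⟨U, hU, rfl⟩
      have hmem : MemLp U 2 μ := MemLp.of_bound hU.1 1 hU.2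
      refine ⟨hmem.toLp U, ?_, ?_⟩
      · filter_upwards [hmem.coeFn_toLp, hU.2] with θ h1 h2
        rwa [h1]
      · rw [hT]
        exact hcongr _ _ hmem.coeFn_toLp
    · rintro ⟨U, hU, rfl⟩
      exact ⟨U, ⟨Lp.aestronglyMeasurable U, hU⟩, hT U⟩
  rw [himg]
  refine isClosed_setOf_ae_norm_le_one.image_clm_of_convex T ?_
    (R := (μ univ).toReal ^ (2 : ENNReal).toReal⁻¹ * 1) fun U hU => ?_
  · intro U hU U' hU' a b ha hb hab
    filter_upwards [hU, hU', Lp.coeFn_add (a • U) (b • U'), Lp.coeFn_smul a U,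
      Lp.coeFn_smul b U'] with θ h1 h2 h3 h4 h5
    rw [h3, Pi.add_apply, h4, h5, Pi.smul_apply, Pi.smul_apply]
    calc ‖a • U θ + b • U' θ‖ ≤ ‖a • U θ‖ + ‖b • U' θ‖ := norm_add_le _ _
      _ = a * ‖U θ‖ + b * ‖U' θ‖ := by
        rw [norm_smul, norm_smul, Real.norm_of_nonneg ha, Real.norm_of_nonneg hb]
      _ ≤ a * 1 + b * 1 := by gcongr
      _ = 1 := by linarith
  · exact Lp.norm_le_of_ae_bound zero_le_one hU


/-- The support function of the attainable set: the best control is the gradient of the integrand,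
normalized. -/
lemma exists_control_eq_integral_norm [CompleteSpace V] (hQ : Continuous Q) (ℓ : V →L[ℝ] ℝ) :
    ∃ w ∈ attainableSet Q, ℓ w = ∫ θ in (0 : ℝ)..(2 * π), ‖ℓ.comp (Q θ)‖ := by
  let w : ℝ → EucR m := fun θ => (InnerProductSpace.toDual ℝ (EucR m)).symm (ℓ.comp (Q θ))
  have hw : Continuous w :=
    (InnerProductSpace.toDual ℝ (EucR m)).symm.continuous.comp
      ((ContinuousLinearMap.compL ℝ (EucR m) V ℝ ℓ).continuous.comp hQ)
  let U : ℝ → EucR m := fun θ => ‖w θ‖⁻¹ • w θ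
  have hU : IsUnitControlOn U (Ioc 0 (2 * π)) := by
    refine ⟨(hw.measurable.norm.inv.smul hw.measurable).aestronglyMeasurable,
      Eventually.of_forall fun θ => ?_⟩
    rw [norm_smul, norm_inv, norm_norm]
    exact inv_mul_le_one
  refine ⟨_, controlIntegral_mem_attainableSet hU, ?_⟩
  rw [controlIntegral, ← ℓ.intervalIntegral_comp_comm (hU.intervalIntegrable hQ)]
  refine intervalIntegral.integral_congr fun θ _ => ?_
  have h1 : ∀ v, ℓ (Q θ v) = inner ℝ (w θ) v := fun v => by
    rw [InnerProductSpace.toDual_symm_apply]; rfl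
  have h2 : ‖ℓ.comp (Q θ)‖ = ‖w θ‖ := ((InnerProductSpace.toDual ℝ (EucR m)).symm.norm_map _).symm
  simp only [h1, h2, U, inner_smul_right, real_inner_self_eq_norm_sq]
  rcases eq_or_ne ‖w θ‖ 0 with h | h
  · simp [h]
  · field_simp

lemma tendsto_controlIntegral (hQ : Continuous Q) {W : ℕ → ℝ → EucR m}
    (hW : ∀ n, IsUnitControlOn (W n) (Ioc 0 (2 * π)))
    (hlim : ∀ᵐ θ, θ ∈ Ioc 0 (2 * π) → Tendsto (fun n => W n θ) atTop (𝓝 (U θ))) :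
    Tendsto (fun n => controlIntegral Q (W n)) atTop (𝓝 (controlIntegral Q U)) := by
  obtain ⟨C, hC⟩ := isCompact_Icc.exists_bound_of_continuousOn (s := Icc (0 : ℝ) (2 * π))
    hQ.continuousOn
  have hI : uIoc 0 (2 * π) = Ioc 0 (2 * π) := uIoc_of_le Real.two_pi_pos.le
  refine intervalIntegral.tendsto_integral_filter_of_dominated_convergence (fun _ => C) ?_ ?_
    intervalIntegrable_const ?_
  · rw [hI]
    exact Eventually.of_forall fun n => aestronglyMeasurable_clm_control hQ (hW n).1
  · refine Eventually.of_forall fun n => ?_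
    have h2 := (hW n).2
    rw [ae_restrict_iff' measurableSet_Ioc] at h2
    filter_upwards [h2] with θ h1 h2
    rw [hI] at h2
    have hCθ := hC θ (Ioc_subset_Icc_self h2)
    calc ‖Q θ (W n θ)‖ ≤ ‖Q θ‖ * ‖W n θ‖ := (Q θ).le_opNorm _
      _ ≤ C * 1 := mul_le_mul hCθ (h1 h2) (norm_nonneg _) ((norm_nonneg _).trans hCθ)
      _ = C := mul_one C
  · filter_upwards [hlim] with θ h1 h2
    exact (Q θ).continuous.continuousAt.tendsto.comp (h1 (hI ▸ h2))

/-- The effects of the smooth controls supported in the interior of the turn are dense in the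
attainable set. -/
lemma exists_contDiff_dist_controlIntegral_lt (hQ : Continuous Q) {w : V}
    (hw : w ∈ attainableSet Q) {δ : ℝ} (hδ : 0 < δ) :
    ∃ W : ℝ → EucR m, ContDiff ℝ ∞ W ∧ (∀ θ, ‖W θ‖ ≤ 1) ∧ (∀ θ ∉ Ioo 0 (2 * π), W θ = 0) ∧
      dist (controlIntegral Q W) w < δ := by
  obtain ⟨U, hU, rfl⟩ := hw
  -- a measurable representative, bounded by `1` everywhere
  obtain ⟨U₁, hU₁m, hU₁, hU₁U⟩ : ∃ U₁ : ℝ → EucR m, StronglyMeasurable U₁ ∧ (∀ θ, ‖U₁ θ‖ ≤ 1) ∧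
      ∀ᵐ θ, θ ∈ Ioc 0 (2 * π) → U₁ θ = U θ := by
    refine ⟨{θ | ‖hU.1.mk U θ‖ ≤ 1}.indicator (hU.1.mk U), hU.1.stronglyMeasurable_mk.indicator
      (measurableSet_le hU.1.stronglyMeasurable_mk.norm.measurable measurable_const), fun θ => ?_,
      ?_⟩
    · by_cases h : ‖hU.1.mk U θ‖ ≤ 1
      · rwa [indicator_of_mem (by exact h)]
      · rw [indicator_of_notMem (by exact h), norm_zero]
        exact zero_le_one
    · have h1 := hU.1.ae_eq_mk
      have h2 := hU.2
      rw [EventuallyEq, ae_restrict_iff' measurableSet_Ioc] at h1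
      rw [ae_restrict_iff' measurableSet_Ioc] at h2
      filter_upwards [h1, h2] with θ h1 h2 hθ
      rw [indicator_of_mem (by rw [mem_ofPred_eq, ← h1 hθ]; exact h2 hθ), h1 hθ]
  -- the control is switched off near the ends of the turn
  let W₁ : ℕ → ℝ → EucR m := fun n =>
    (Icc (1 / (n + 1 : ℝ)) (2 * π - 1 / (n + 1))).indicator U₁
  have hW₁m : ∀ n, StronglyMeasurable (W₁ n) := fun n => hU₁m.indicator measurableSet_Icc
  have hW₁ : ∀ n θ, ‖W₁ n θ‖ ≤ 1 := fun n θ => (norm_indicator_le_norm_self _ _).trans (hU₁ θ)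
  have hlim₁ : Tendsto (fun n => controlIntegral Q (W₁ n)) atTop (𝓝 (controlIntegral Q U)) := by
    refine tendsto_controlIntegral hQ
      (fun n => ⟨(hW₁m n).aestronglyMeasurable, Eventually.of_forall (hW₁ n)⟩) ?_
    filter_upwards [hU₁U, compl_mem_ae_iff.2 (measure_singleton (2 * π))] with θ h1 h2 hθ
    refine tendsto_const_nhds.congr' ?_
    have hθ2 : θ < 2 * π := lt_of_le_of_ne hθ.2 h2
    have := tendsto_one_div_add_atTop_nhds_zero_nat (𝕜 := ℝ)
    filter_upwards [this.eventually_lt_const hθ.1, this.eventually_lt_const (sub_pos.2 hθ2)]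
      with n hn hn'
    rw [← h1 hθ]
    have hmem : θ ∈ Icc (1 / (n + 1 : ℝ)) (2 * π - 1 / (n + 1)) := ⟨hn.le, by linarith⟩
    exact (indicator_of_mem hmem _).symm
  obtain ⟨n, hn⟩ := (hlim₁.eventually (Metric.ball_mem_nhds _ (half_pos hδ))).exists
  -- then it is mollified
  have hη : (0 : ℝ) < 1 / (n + 1) := Nat.one_div_pos_of_nat
  set η : ℝ := 1 / (n + 1) with hηdef
  let φ : ℕ → ContDiffBump (0 : ℝ) := fun k =>
    { rIn := η / (k + 1) / 2
      rOut := η / (k + 1)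
      rIn_pos := by positivity
      rIn_lt_rOut := half_lt_self (by positivity) }
  let W₂ : ℕ → ℝ → EucR m := fun k =>
    convolution ((φ k).normed volume) (W₁ n) (ContinuousLinearMap.lsmul ℝ ℝ) volume
  have hloc : LocallyIntegrable (W₁ n) volume := by
    refine (locallyIntegrable_const (1 : ℝ)).mono (hW₁m n).aestronglyMeasurable
      (Eventually.of_forall fun θ => ?_)
    rw [norm_one]
    exact hW₁ n θ
  have hW₂ : ∀ k θ, ‖W₂ k θ‖ ≤ 1 := by
    intro k θ
    have h1 := dist_convolution_le' (ContinuousLinearMap.lsmul ℝ ℝ) (x₀ := θ) (z₀ := (0 : EucR m))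
      (g := W₁ n) (f := (φ k).normed volume) (μ := volume) zero_le_one
      ((φ k).integrable_normed) ((φ k).support_normed_eq.subset) (hW₁m n).aestronglyMeasurable
      (fun x _ => by rw [dist_zero_right]; exact hW₁ n x)
    simp only [map_zero, integral_zero, dist_zero_right] at h1
    have h2 : ∫ x, ‖(φ k).normed volume x‖ = 1 := by
      simp_rw [Real.norm_of_nonneg ((φ k).nonneg_normed _)]
      exact (φ k).integral_normed
    rw [h2] at h1
    have h3 : ‖(ContinuousLinearMap.lsmul ℝ ℝ : ℝ →L[ℝ] EucR m →L[ℝ] EucR m)‖ ≤ 1 :=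
      ContinuousLinearMap.opNorm_lsmul_le
    calc ‖W₂ k θ‖ ≤ _ := h1
      _ ≤ 1 := by linarith
  have hsm : ∀ k, ContDiff ℝ ∞ (W₂ k) := fun k =>
    (φ k).hasCompactSupport_normed.contDiff_convolution_left _ (φ k).contDiff_normed hloc
  have hlim₂ : Tendsto (fun k => controlIntegral Q (W₂ k)) atTop
      (𝓝 (controlIntegral Q (W₁ n))) := by
    refine tendsto_controlIntegral hQ
      (fun k => ⟨(hsm k).continuous.aestronglyMeasurable, Eventually.of_forall (hW₂ k)⟩) ?_
    have h1 := ContDiffBump.ae_convolution_tendsto_right_of_locallyIntegrable (φ := φ) (l := atTop)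
      (K := 2) (g := W₁ n) (μ := volume) ?_ ?_ hloc
    · filter_upwards [h1] with θ h1 _ using h1
    · have := (tendsto_one_div_add_atTop_nhds_zero_nat (𝕜 := ℝ)).const_mul η
      simpa only [φ, mul_one_div, mul_zero] using this
    · refine Eventually.of_forall fun k => ?_
      change η / (k + 1) ≤ 2 * (η / (k + 1) / 2)
      linarith
  obtain ⟨k, hk⟩ := (hlim₂.eventually (Metric.ball_mem_nhds _ (half_pos hδ))).exists
  refine ⟨W₂ k, hsm k, hW₂ k, fun θ hθ => ?_, ?_⟩
  · by_contra hne
    obtain ⟨s, hs, t, ht, hst⟩ := mem_add.1 (support_convolution_subset _ hne)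
    rw [(φ k).support_normed_eq, Metric.mem_ball, dist_zero_right, Real.norm_eq_abs, abs_lt] at hs
    have ht' : t ∈ Icc η (2 * π - η) := support_indicator_subset ht
    have hr : (φ k).rOut ≤ η := div_le_self hη.le (by linarith [k.cast_nonneg (α := ℝ)])
    exact hθ ⟨by linarith [hs.1, ht'.1], by linarith [hs.2, ht'.2]⟩
  · calc dist (controlIntegral Q (W₂ k)) (controlIntegral Q U)
        ≤ dist (controlIntegral Q (W₂ k)) (controlIntegral Q (W₁ n)) +
          dist (controlIntegral Q (W₁ n)) (controlIntegral Q U) := dist_triangle _ _ _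
      _ < δ / 2 + δ / 2 := add_lt_add hk hn
      _ = δ := add_halves δ

end ControlIntegral

/-! ### Embedded systems and their averages -/

/-- The coefficients of a Kepler control system on a set `K`, seen through an embedding of `K` in a
vector space `V`: the angle is lifted to `ℝ` and the control vector fields take values in `V`. The
coefficients are bounded and Lipschitz with the constant `bound`, and the frequency is bounded below
by `lower`. -/
structure OscillatingCoeffs (m : ℕ) (V : Type*) [NormedAddCommGroup V] [NormedSpace ℝ V]
    {M : Type*} [MetricSpace M] (K : Set M) where
  freq : ℝ → M → ℝ
  angle : ℝ → M → EucR m →L[ℝ] ℝ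
  field : ℝ → M → EucR m →L[ℝ] V
  freq_periodic : ∀ x, Function.Periodic (fun θ => freq θ x) (2 * π)
  field_periodic : ∀ x, Function.Periodic (fun θ => field θ x) (2 * π)
  lower : ℝ
  bound : ℝ
  lower_pos : 0 < lower
  bound_pos : 0 < bound
  lower_le_freq : ∀ θ, ∀ x ∈ K, lower ≤ freq θ x
  freq_le : ∀ θ, ∀ x ∈ K, freq θ x ≤ bound
  norm_angle_le : ∀ θ, ∀ x ∈ K, ‖angle θ x‖ ≤ bound
  norm_field_le : ∀ θ, ∀ x ∈ K, ‖field θ x‖ ≤ bound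
  dist_freq_le : ∀ θ θ', ∀ x ∈ K, ∀ y ∈ K,
    dist (freq θ x) (freq θ' y) ≤ bound * (dist θ θ' + dist x y)
  dist_angle_le : ∀ θ θ', ∀ x ∈ K, ∀ y ∈ K,
    dist (angle θ x) (angle θ' y) ≤ bound * (dist θ θ' + dist x y)
  dist_field_le : ∀ θ θ', ∀ x ∈ K, ∀ y ∈ K,
    dist (field θ x) (field θ' y) ≤ bound * (dist θ θ' + dist x y)

namespace OscillatingCoeffs

variable {m : ℕ} {V : Type*} [NormedAddCommGroup V] [NormedSpace ℝ V]
  {M : Type*} [MetricSpace M] {K : Set M} (c : OscillatingCoeffs m V K)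

/-- The duration of a turn of the unperturbed angle at `x`. -/
def period (x : M) : ℝ := ∫ θ in (0 : ℝ)..(2 * π), (c.freq θ x)⁻¹

/-- The kernel whose integrals against controls are the averaged velocities at `x`. -/
def kernel (x : M) (θ : ℝ) : EucR m →L[ℝ] V := (c.period x)⁻¹ • (c.freq θ x)⁻¹ • c.field θ x

variable {c} {x y : M}

lemma freq_pos (hx : x ∈ K) (θ : ℝ) : 0 < c.freq θ x :=
  c.lower_pos.trans_le (c.lower_le_freq θ x hx)

lemma continuous_of_dist_le {W : Type*} [PseudoMetricSpace W] {f : ℝ → W} {C : ℝ}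
    (h : ∀ θ θ', dist (f θ) (f θ') ≤ C * (dist θ θ' + 0)) : Continuous f :=
  (LipschitzWith.of_dist_le_mul (K := C.toNNReal) fun θ θ' => (h θ θ').trans (by
    rw [add_zero]; gcongr; exact Real.le_coe_toNNReal C)).continuous

lemma continuous_freq (hx : x ∈ K) : Continuous fun θ => c.freq θ x :=
  continuous_of_dist_le fun θ θ' => by simpa using c.dist_freq_le θ θ' x hx x hx

lemma continuous_field (hx : x ∈ K) : Continuous fun θ => c.field θ x :=
  continuous_of_dist_le fun θ θ' => by simpa using c.dist_field_le θ θ' x hx x hx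

lemma continuous_inv_freq (hx : x ∈ K) : Continuous fun θ => (c.freq θ x)⁻¹ :=
  (continuous_freq hx).inv₀ fun θ => (freq_pos (c := c) hx θ).ne'

lemma inv_freq_le (hx : x ∈ K) (θ : ℝ) : (c.freq θ x)⁻¹ ≤ c.lower⁻¹ :=
  inv_anti₀ c.lower_pos (c.lower_le_freq θ x hx)

lemma continuous_kernel (hx : x ∈ K) : Continuous (c.kernel x) :=
  ((continuous_inv_freq (c := c) hx).smul (continuous_field (c := c) hx)).const_smul (c.period x)⁻¹

lemma le_period (hx : x ∈ K) : 2 * π * c.bound⁻¹ ≤ c.period x := by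
  have h : ∫ _ in (0 : ℝ)..(2 * π), c.bound⁻¹ ≤ c.period x :=
    intervalIntegral.integral_mono_on Real.two_pi_pos.le intervalIntegrable_const
      ((continuous_inv_freq hx).intervalIntegrable _ _)
      fun θ _ => inv_anti₀ (freq_pos (c := c) hx θ) (c.freq_le θ x hx)
  rwa [intervalIntegral.integral_const, sub_zero, smul_eq_mul] at h

lemma period_le (hx : x ∈ K) : c.period x ≤ 2 * π * c.lower⁻¹ := by
  have h : c.period x ≤ ∫ _ in (0 : ℝ)..(2 * π), c.lower⁻¹ :=
    intervalIntegral.integral_mono_on Real.two_pi_pos.le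
      ((continuous_inv_freq hx).intervalIntegrable _ _) intervalIntegrable_const
      fun θ _ => inv_freq_le (c := c) hx θ
  rwa [intervalIntegral.integral_const, sub_zero, smul_eq_mul] at h

lemma period_pos (hx : x ∈ K) : 0 < c.period x :=
  (mul_pos Real.two_pi_pos (inv_pos.2 c.bound_pos)).trans_le (le_period (c := c) hx)

lemma inv_period_le (hx : x ∈ K) : (c.period x)⁻¹ ≤ c.bound := by
  have h1 : c.bound⁻¹ ≤ c.period x := by
    refine le_trans ?_ (le_period (c := c) hx)
    have : (1 : ℝ) ≤ 2 * π := by linarith [Real.two_le_pi]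
    have h2 := inv_pos.2 c.bound_pos
    nlinarith
  rw [← inv_inv c.bound]
  exact inv_anti₀ (inv_pos.2 c.bound_pos) h1

lemma abs_inv_freq_sub_le (hx : x ∈ K) (hy : y ∈ K) (θ : ℝ) :
    |(c.freq θ x)⁻¹ - (c.freq θ y)⁻¹| ≤ c.lower⁻¹ * c.lower⁻¹ * c.bound * dist x y := by
  have h := c.dist_freq_le θ θ x hx y hy
  rw [dist_self, zero_add, Real.dist_eq] at h
  rw [inv_sub_inv (freq_pos (c := c) hx θ).ne' (freq_pos (c := c) hy θ).ne', abs_div, abs_sub_comm,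
    abs_of_pos (mul_pos (freq_pos (c := c) hx θ) (freq_pos (c := c) hy θ)), div_eq_mul_inv, mul_inv]
  have h1 := inv_freq_le (c := c) hx θ
  have h2 := inv_freq_le (c := c) hy θ
  have h3 := (inv_pos.2 (freq_pos (c := c) hx θ)).le
  have h4 := (inv_pos.2 (freq_pos (c := c) hy θ)).le
  have h5 := c.bound_pos
  have h6 := c.lower_pos
  calc _ ≤ c.bound * dist x y * (c.lower⁻¹ * c.lower⁻¹) := by gcongr
    _ = _ := by ring

lemma abs_inv_period_sub_le (hx : x ∈ K) (hy : y ∈ K) :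
    |(c.period x)⁻¹ - (c.period y)⁻¹| ≤
      c.bound * c.bound * (2 * π * (c.lower⁻¹ * c.lower⁻¹ * c.bound)) * dist x y := by
  have h : |c.period x - c.period y| ≤ 2 * π * (c.lower⁻¹ * c.lower⁻¹ * c.bound * dist x y) := by
    have h1 : c.period x - c.period y =
        ∫ θ in (0 : ℝ)..(2 * π), ((c.freq θ x)⁻¹ - (c.freq θ y)⁻¹) :=
      (intervalIntegral.integral_sub ((continuous_inv_freq hx).intervalIntegrable _ _)
        ((continuous_inv_freq hy).intervalIntegrable _ _)).symm
    rw [h1, ← Real.norm_eq_abs]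
    refine (intervalIntegral.norm_integral_le_of_norm_le_const
      fun θ _ => abs_inv_freq_sub_le (c := c) hx hy θ).trans_eq ?_
    rw [sub_zero, abs_of_pos Real.two_pi_pos, mul_comm]
  rw [inv_sub_inv (period_pos (c := c) hx).ne' (period_pos (c := c) hy).ne', abs_div, abs_sub_comm,
    abs_of_pos (mul_pos (period_pos (c := c) hx) (period_pos (c := c) hy)), div_eq_mul_inv, mul_inv]
  have h1 := inv_period_le (c := c) hx
  have h2 := inv_period_le (c := c) hy
  have h3 := (inv_pos.2 (period_pos (c := c) hx)).le
  have h4 := (inv_pos.2 (period_pos (c := c) hy)).le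
  have h5 := c.bound_pos
  have h6 := c.lower_pos
  calc _ ≤ 2 * π * (c.lower⁻¹ * c.lower⁻¹ * c.bound * dist x y) * (c.bound * c.bound) := by gcongr
    _ = _ := by ring

lemma norm_kernel_le (hx : x ∈ K) (θ : ℝ) : ‖c.kernel x θ‖ ≤ c.bound * c.lower⁻¹ * c.bound := by
  have h3 := (inv_pos.2 (freq_pos (c := c) hx θ)).le
  have h4 := (inv_pos.2 (period_pos (c := c) hx)).le
  rw [kernel, norm_smul, norm_smul, Real.norm_of_nonneg h3, Real.norm_of_nonneg h4, ← mul_assoc]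
  have := c.bound_pos
  have := c.lower_pos
  gcongr
  · exact inv_period_le (c := c) hx
  · exact c.lower_le_freq θ x hx
  · exact c.norm_field_le θ x hx

variable (c) in
/-- The averaged velocities at a point depend in a Lipschitz way on this point. -/
lemma exists_norm_kernel_sub_le : ∃ C : ℝ, 0 ≤ C ∧ ∀ x ∈ K, ∀ y ∈ K, ∀ θ,
    ‖c.kernel x θ - c.kernel y θ‖ ≤ C * dist x y := by
  have hb := c.bound_pos
  have hl := c.lower_pos
  refine ⟨c.bound * c.bound * (2 * π * (c.lower⁻¹ * c.lower⁻¹ * c.bound)) * (c.lower⁻¹ * c.bound) +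
    c.bound * (c.lower⁻¹ * c.lower⁻¹ * c.bound * c.bound + c.lower⁻¹ * c.bound), by positivity,
    fun x hx y hy θ => ?_⟩
  have h1 := abs_inv_period_sub_le (c := c) hx hy
  have h2 := abs_inv_freq_sub_le (c := c) hx hy θ
  have h3 := c.dist_field_le θ θ x hx y hy
  rw [dist_self, zero_add, dist_eq_norm] at h3
  have h5 : ‖(c.freq θ x)⁻¹ • c.field θ x‖ ≤ c.lower⁻¹ * c.bound := by
    rw [norm_smul, Real.norm_of_nonneg (inv_pos.2 (freq_pos (c := c) hx θ)).le]
    gcongr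
    · exact c.lower_le_freq θ x hx
    · exact c.norm_field_le θ x hx
  have hdec : c.kernel x θ - c.kernel y θ =
      ((c.period x)⁻¹ - (c.period y)⁻¹) • ((c.freq θ x)⁻¹ • c.field θ x) +
      (c.period y)⁻¹ • (((c.freq θ x)⁻¹ - (c.freq θ y)⁻¹) • c.field θ x +
        (c.freq θ y)⁻¹ • (c.field θ x - c.field θ y)) := by
    simp only [kernel, smul_sub, sub_smul, smul_add]
    abel
  rw [hdec]
  refine (norm_add_le _ _).trans ?_
  rw [norm_smul, norm_smul (c.period y)⁻¹, Real.norm_eq_abs,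
    Real.norm_of_nonneg (inv_pos.2 (period_pos (c := c) hy)).le]
  have h6 : ‖((c.freq θ x)⁻¹ - (c.freq θ y)⁻¹) • c.field θ x +
        (c.freq θ y)⁻¹ • (c.field θ x - c.field θ y)‖ ≤
      c.lower⁻¹ * c.lower⁻¹ * c.bound * dist x y * c.bound + c.lower⁻¹ * (c.bound * dist x y) := by
    refine (norm_add_le _ _).trans ?_
    rw [norm_smul, norm_smul, Real.norm_eq_abs,
      Real.norm_of_nonneg (inv_pos.2 (freq_pos (c := c) hy θ)).le]
    gcongr
    · exact c.norm_field_le θ x hx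
    · exact c.lower_le_freq θ y hy
  calc _ ≤ c.bound * c.bound * (2 * π * (c.lower⁻¹ * c.lower⁻¹ * c.bound)) * dist x y *
        (c.lower⁻¹ * c.bound) +
      c.bound * (c.lower⁻¹ * c.lower⁻¹ * c.bound * dist x y * c.bound +
        c.lower⁻¹ * (c.bound * dist x y)) := by
        gcongr
        exact inv_period_le (c := c) hy
    _ = _ := by ring

/-- A solution with values in `K` of the control system with control `ε u`, seen in `V` through the
map `F`. -/
structure IsEmbeddedSolution (c : OscillatingCoeffs m V K) (F : M → V) (ε S : ℝ)
    (u : ℝ → EucR m) (Θ : ℝ → ℝ) (x : ℝ → M) : Prop where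
  mem : ∀ t ∈ Icc 0 S, x t ∈ K
  ac_embed : AbsolutelyContinuousOnInterval (F ∘ x) 0 S
  ac_angle : AbsolutelyContinuousOnInterval Θ 0 S
  hasDerivAt_embed : ∀ᵐ t ∂(volume.restrict (Icc 0 S)),
    HasDerivAt (F ∘ x) (ε • c.field (Θ t) (x t) (u t)) t
  hasDerivAt_angle : ∀ᵐ t ∂(volume.restrict (Icc 0 S)),
    HasDerivAt Θ (c.freq (Θ t) (x t) + ε * c.angle (Θ t) (x t) (u t)) t
  norm_le : ∀ᵐ t ∂(volume.restrict (Icc 0 S)), ‖u t‖ ≤ 1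

lemma IsEmbeddedSolution.dist_embed_le {F : M → V} {ε S : ℝ} {u : ℝ → EucR m} {Θ : ℝ → ℝ}
    {z : ℝ → M} (h : c.IsEmbeddedSolution F ε S u Θ z) (hε : 0 < ε) {s t : ℝ}
    (hs : s ∈ Icc 0 S) (ht : t ∈ Icc 0 S) :
    dist (F (z s)) (F (z t)) ≤ ε * c.bound * dist s t := by
  refine h.ac_embed.dist_le_of_norm_deriv_le
    (X' := fun t => ε • c.field (Θ t) (z t) (u t)) ?_ hs ht
  filter_upwards [h.hasDerivAt_embed, h.norm_le, ae_restrict_mem measurableSet_Icc] with t h1 h2 h3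
  refine ⟨h1, ?_⟩
  rw [norm_smul, Real.norm_of_nonneg hε.le]
  have h4 := c.norm_field_le (Θ t) _ (h.mem t h3)
  have h5 := c.bound_pos
  gcongr
  calc ‖c.field (Θ t) (z t) (u t)‖ ≤ ‖c.field (Θ t) (z t)‖ * ‖u t‖ :=
        ContinuousLinearMap.le_opNorm _ _
    _ ≤ c.bound * 1 := by gcongr
    _ = c.bound := mul_one _

/-- A continuous periodic function with zero mean has a bounded primitive. -/
lemma exists_norm_primitive_le {ψ : ℝ → ℝ} (hψ : Continuous ψ) {P : ℝ} (hP : 0 < P)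
    (hper : Function.Periodic ψ P) (h0 : ∫ θ in (0 : ℝ)..P, ψ θ = 0) :
    ∃ B, ∀ θ, |∫ s in (0 : ℝ)..θ, ψ s| ≤ B := by
  have hint : ∀ a b, IntervalIntegrable ψ volume a b := fun a b => hψ.intervalIntegrable a b
  have hprim : Function.Periodic (fun θ => ∫ s in (0 : ℝ)..θ, ψ s) P := by
    intro θ
    beta_reduce
    rw [← intervalIntegral.integral_add_adjacent_intervals (hint 0 θ) (hint θ (θ + P)),
      hper.intervalIntegral_add_eq θ 0, zero_add, h0, add_zero]
  obtain ⟨B, hB⟩ := isCompact_Icc.exists_bound_of_continuousOn (s := Icc (0 : ℝ) P)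
    (intervalIntegral.continuous_primitive hint 0).continuousOn
  refine ⟨B, fun θ => ?_⟩
  obtain ⟨θ', hθ', h⟩ := hprim.exists_mem_Ico₀ hP θ
  rw [h]
  exact hB θ' (Ico_subset_Icc_self hθ')

/-- The averaging estimate, in the direction `ℓ`: the growth of `ℓ` along a solution that stays
close to `p` is at most that of the average system at `p`, up to a small relative error and an
oscillation of order `ε`. -/
lemma exists_clm_sub_le (c : OscillatingCoeffs m V K) {p : M} (hp : p ∈ K) (ℓ : V →L[ℝ] ℝ) :
    ∃ C B : ℝ, 0 ≤ C ∧ ∀ {F : M → V} {ε S : ℝ} {u : ℝ → EucR m} {Θ : ℝ → ℝ} {z : ℝ → M}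
      (_ : c.IsEmbeddedSolution F ε S u Θ z) (_ : 0 < ε) {a b r : ℝ} (_ : 0 ≤ a) (_ : a ≤ b)
      (_ : b ≤ S) (_ : 0 ≤ r) (_ : ∀ t ∈ Icc a b, dist (z t) p ≤ r),
      ℓ (F (z b) - F (z a)) ≤
        ε * (b - a) * ((∫ θ in (0 : ℝ)..(2 * π), ‖ℓ.comp (c.kernel p θ)‖) + C * (r + ε)) +
          ε * B := by
  set μ := ∫ θ in (0 : ℝ)..(2 * π), ‖ℓ.comp (c.kernel p θ)‖ with hμ
  set h : ℝ → ℝ := fun θ => ‖ℓ.comp (c.field θ p)‖ with hh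
  have hhc : Continuous h :=
    ((ContinuousLinearMap.compL ℝ (EucR m) V ℝ ℓ).continuous.comp (continuous_field hp)).norm
  have hhle : ∀ θ, h θ ≤ ‖ℓ‖ * c.bound := fun θ => by
    refine (ℓ.opNorm_comp_le _).trans ?_
    gcongr
    exact c.norm_field_le θ p hp
  set ψ : ℝ → ℝ := fun θ => (h θ - μ) * (c.freq θ p)⁻¹ with hψ
  have hψc : Continuous ψ := (hhc.sub continuous_const).mul (continuous_inv_freq hp)
  have hψper : Function.Periodic ψ (2 * π) := by
    intro θ
    have h1 := c.field_periodic p θ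
    have h2 := c.freq_periodic p θ
    beta_reduce at h1 h2
    simp only [hψ, hh, h1, h2]
  have hψ0 : ∫ θ in (0 : ℝ)..(2 * π), ψ θ = 0 := by
    have h1 : μ = (c.period p)⁻¹ * ∫ θ in (0 : ℝ)..(2 * π), h θ * (c.freq θ p)⁻¹ := by
      rw [hμ, ← intervalIntegral.integral_const_mul]
      refine intervalIntegral.integral_congr fun θ _ => ?_
      simp only [kernel, hh, ContinuousLinearMap.comp_smul]
      rw [norm_smul, norm_smul, Real.norm_of_nonneg (inv_pos.2 (freq_pos (c := c) hp θ)).le,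
        Real.norm_of_nonneg (inv_pos.2 (period_pos (c := c) hp)).le]
      ring
    have h2 : ∫ θ in (0 : ℝ)..(2 * π), ψ θ =
        (∫ θ in (0 : ℝ)..(2 * π), h θ * (c.freq θ p)⁻¹) - μ * c.period p := by
      rw [period, ← intervalIntegral.integral_const_mul, ← intervalIntegral.integral_sub]
      · simp only [hψ, sub_mul]
      · exact (hhc.mul (continuous_inv_freq hp)).intervalIntegrable _ _
      · exact (continuous_const.mul (continuous_inv_freq hp)).intervalIntegrable _ _
    rw [h2, h1]
    field_simp [(period_pos (c := c) hp).ne']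
    ring
  obtain ⟨B, hB⟩ := exists_norm_primitive_le hψc Real.two_pi_pos hψper hψ0
  have hb := c.bound_pos
  have hl := c.lower_pos
  have hμle : ∀ θ, |h θ - μ| ≤ ‖ℓ‖ * c.bound + |μ| := fun θ => by
    refine (abs_sub _ _).trans ?_
    rw [abs_of_nonneg (norm_nonneg _)]
    gcongr
    exact hhle θ
  have hψle : ∀ θ, |ψ θ| ≤ (‖ℓ‖ * c.bound + |μ|) * c.lower⁻¹ := fun θ => by
    rw [hψ, abs_mul, abs_of_pos (inv_pos.2 (freq_pos (c := c) hp θ))]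
    exact mul_le_mul (hμle θ) (inv_freq_le (c := c) hp θ)
      (inv_pos.2 (freq_pos (c := c) hp θ)).le (by positivity)
  set D := (‖ℓ‖ * c.bound + |μ|) * c.lower⁻¹ with hD
  have hD0 : 0 ≤ D := by positivity
  refine ⟨‖ℓ‖ * c.bound + D * c.bound, 2 * B, by positivity, ?_⟩
  intro F ε S u Θ z hz hε a b r ha hab hbS hr hzr
  set Hp : ℝ → ℝ := fun θ => ∫ s in (0 : ℝ)..θ, ψ s with hHp
  have hHd : ∀ θ, HasDerivAt Hp (ψ θ) θ := fun θ =>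
    intervalIntegral.integral_hasDerivAt_right (hψc.intervalIntegrable _ _)
      (hψc.stronglyMeasurableAtFilter _ _) hψc.continuousAt
  have hHlip : ∀ s t, dist (Hp s) (Hp t) ≤ D * dist s t := fun s t =>
    (LipschitzWith.of_dist_le_mul (K := D.toNNReal) (f := Hp) fun s t => by
      have := Convex.norm_image_sub_le_of_norm_hasDerivWithin_le (s := univ) (f := Hp)
        (C := D) (x := t) (y := s) (fun θ _ => (hHd θ).hasDerivWithinAt) (fun θ _ => hψle θ)
        convex_univ (mem_univ _) (mem_univ _)
      rw [dist_eq_norm, dist_eq_norm, Real.coe_toNNReal D hD0]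
      exact this).dist_le_mul s t |>.trans_eq (by rw [Real.coe_toNNReal D hD0])
  have hsub : Icc a b ⊆ Icc 0 S := Icc_subset_Icc ha hbS
  have hu : uIcc a b ⊆ uIcc 0 S := by
    rw [uIcc_of_le hab, uIcc_of_le (ha.trans (hab.trans hbS))]; exact hsub
  have hac : AbsolutelyContinuousOnInterval (fun t => ℓ (F (z t)) - ε * Hp (Θ t)) a b :=
    ((hz.ac_embed.mono hu).clm_comp ℓ).sub
      (((hz.ac_angle.mono hu).of_dist_le (C := D) fun s _ t _ => hHlip _ _).const_mul ε)
  have hmain := hac.sub_le_integral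
    (φ := fun _ => ε * (μ + (‖ℓ‖ * c.bound + D * c.bound) * (r + ε)))
    (f' := fun t => ℓ (ε • c.field (Θ t) (z t) (u t)) -
      ε * (ψ (Θ t) * (c.freq (Θ t) (z t) + ε * c.angle (Θ t) (z t) (u t)))) hab
    intervalIntegrable_const ?_
  · rw [intervalIntegral.integral_const, smul_eq_mul] at hmain
    have h1 := abs_le.1 (hB (Θ b))
    have h2 := abs_le.1 (hB (Θ a))
    rw [map_sub]
    have h3 : ε * (Hp (Θ b) - Hp (Θ a)) ≤ ε * (2 * B) := by
      gcongr
      simp only [hHp]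
      linarith
    linarith
  · filter_upwards [ae_restrict_of_ae_restrict_of_subset hsub hz.hasDerivAt_embed,
      ae_restrict_of_ae_restrict_of_subset hsub hz.hasDerivAt_angle,
      ae_restrict_of_ae_restrict_of_subset hsub hz.norm_le, ae_restrict_mem measurableSet_Icc]
      with t h1 h2 h3 ht
    refine ⟨(ℓ.hasFDerivAt.comp_hasDerivAt t h1).sub (((hHd _).comp t h2).const_mul ε), ?_⟩
    have hzt := hz.mem t (hsub ht)
    have hfield : ℓ (c.field (Θ t) (z t) (u t)) ≤ h (Θ t) + ‖ℓ‖ * c.bound * r := by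
      have e1 : ℓ (c.field (Θ t) p (u t)) ≤ h (Θ t) := by
        calc ℓ (c.field (Θ t) p (u t)) ≤ ‖(ℓ.comp (c.field (Θ t) p)) (u t)‖ := Real.le_norm_self _
          _ ≤ h (Θ t) * ‖u t‖ := ContinuousLinearMap.le_opNorm _ _
          _ ≤ h (Θ t) * 1 := by gcongr
          _ = h (Θ t) := mul_one _
      have e2 : ℓ ((c.field (Θ t) (z t) - c.field (Θ t) p) (u t)) ≤ ‖ℓ‖ * c.bound * r := by
        have e3 := c.dist_field_le (Θ t) (Θ t) _ hzt p hp
        rw [dist_self, zero_add, dist_eq_norm] at e3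
        calc ℓ ((c.field (Θ t) (z t) - c.field (Θ t) p) (u t))
            ≤ ‖ℓ ((c.field (Θ t) (z t) - c.field (Θ t) p) (u t))‖ := Real.le_norm_self _
          _ ≤ ‖ℓ‖ * (‖c.field (Θ t) (z t) - c.field (Θ t) p‖ * ‖u t‖) :=
            (ℓ.le_opNorm _).trans (by gcongr; exact ContinuousLinearMap.le_opNorm _ _)
          _ ≤ ‖ℓ‖ * (c.bound * r * 1) := by
            gcongr
            exact e3.trans (by gcongr; exact hzr t ht)
          _ = ‖ℓ‖ * c.bound * r := by ring
      rw [sub_apply, map_sub] at e2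
      linarith
    -- the speed of the angle is compared with its value `freq (Θ t) p` at `p`
    have hang : |c.freq (Θ t) (z t) + ε * c.angle (Θ t) (z t) (u t) - c.freq (Θ t) p| ≤
        c.bound * (r + ε) := by
      have e3 := c.dist_freq_le (Θ t) (Θ t) _ hzt p hp
      rw [dist_self, zero_add, Real.dist_eq] at e3
      have e4 : |c.angle (Θ t) (z t) (u t)| ≤ c.bound := by
        rw [← Real.norm_eq_abs]
        calc ‖c.angle (Θ t) (z t) (u t)‖ ≤ ‖c.angle (Θ t) (z t)‖ * ‖u t‖ :=
              ContinuousLinearMap.le_opNorm _ _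
          _ ≤ c.bound * 1 := by gcongr; exact c.norm_angle_le _ _ hzt
          _ = c.bound := mul_one _
      have e5 : |ε * c.angle (Θ t) (z t) (u t)| ≤ ε * c.bound := by
        rw [abs_mul, abs_of_pos hε]; gcongr
      have e6 : c.bound * dist (z t) p ≤ c.bound * r := by gcongr; exact hzr t ht
      have e7 := abs_add_le (c.freq (Θ t) (z t) - c.freq (Θ t) p) (ε * c.angle (Θ t) (z t) (u t))
      calc _ = |c.freq (Θ t) (z t) - c.freq (Θ t) p + ε * c.angle (Θ t) (z t) (u t)| := by
            congr 1; ring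
        _ ≤ _ := by linarith
    have hψeq : ψ (Θ t) * c.freq (Θ t) p = h (Θ t) - μ := by
      simp only [hψ]
      rw [mul_assoc, inv_mul_cancel₀ (freq_pos (c := c) hp _).ne', mul_one]
    have hprod : -(ψ (Θ t) * (c.freq (Θ t) (z t) + ε * c.angle (Θ t) (z t) (u t))) ≤
        -(h (Θ t) - μ) + D * (c.bound * (r + ε)) := by
      have e1 : |ψ (Θ t) * (c.freq (Θ t) (z t) + ε * c.angle (Θ t) (z t) (u t) -
          c.freq (Θ t) p)| ≤ D * (c.bound * (r + ε)) := by
        rw [abs_mul]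
        exact mul_le_mul (hψle _) hang (abs_nonneg _) hD0
      have e2 := (abs_le.1 e1).1
      rw [mul_sub, hψeq] at e2
      linarith
    have hε' : ‖ℓ‖ * c.bound * r ≤ ‖ℓ‖ * c.bound * (r + ε) := by gcongr; linarith
    rw [map_smul, smul_eq_mul, ← mul_sub]
    gcongr
    linarith

end OscillatingCoeffs

/-! ### Limits of solutions when the control tends to zero -/

/-- A form of the Arzelà–Ascoli theorem for curves with a common Lipschitz constant. -/
lemma exists_subseq_tendstoUniformlyOn {M : Type*} [MetricSpace M] {K : Set M} (hK : IsCompact K)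
    {T C : ℝ} (hT : 0 ≤ T) {f : ℕ → ℝ → M} (hf : ∀ k, ∀ t ∈ Icc 0 T, f k t ∈ K)
    (hC : ∀ k, ∀ s ∈ Icc 0 T, ∀ t ∈ Icc 0 T, dist (f k s) (f k t) ≤ C * dist s t) :
    ∃ ψ : ℕ → ℕ, StrictMono ψ ∧ ∃ y : ℝ → M,
      TendstoUniformlyOn (fun k => f (ψ k)) y atTop (Icc 0 T) := by
  have hlip : ∀ k, LipschitzWith C.toNNReal (fun t : Icc (0 : ℝ) T => f k t) := fun k =>
    LipschitzWith.of_dist_le_mul fun s t => (hC k s s.2 t t.2).trans (by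
      gcongr
      · exact Real.le_coe_toNNReal C
      · exact le_of_eq rfl)
  let g : ℕ → BoundedContinuousFunction (Icc (0 : ℝ) T) M := fun k =>
    BoundedContinuousFunction.mkOfCompact ⟨_, (hlip k).continuous⟩
  have hcomp : IsCompact (closure (range g)) := by
    refine BoundedContinuousFunction.arzela_ascoli K hK _ ?_ ?_
    · rintro _ x ⟨k, rfl⟩
      exact hf k x x.2
    · refine Metric.equicontinuous_of_continuity_modulus (fun r => C.toNNReal * r) ?_ _ ?_
      · have h : Continuous fun r : ℝ => (C.toNNReal : ℝ) * r := by fun_prop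
        exact h.tendsto' 0 0 (mul_zero _)
      · rintro s t ⟨_, k, rfl⟩
        exact (hlip k).dist_le_mul s t
  obtain ⟨g', -, ψ, hψ, hlim⟩ := hcomp.tendsto_subseq fun k => subset_closure (mem_range_self k)
  refine ⟨ψ, hψ, g' ∘ projIcc 0 T hT, ?_⟩
  rw [BoundedContinuousFunction.tendsto_iff_tendstoUniformly] at hlim
  rw [Metric.tendstoUniformlyOn_iff]
  rw [Metric.tendstoUniformly_iff] at hlim
  intro r hr
  filter_upwards [hlim r hr] with k hk t ht
  have := hk ⟨t, ht⟩
  rw [Function.comp_apply, projIcc_of_mem hT ht]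
  exact this

/-- The attainable set is characterized by its support function. -/
lemma mem_attainableSet_of_forall_clm_le {m : ℕ} {V : Type*} [NormedAddCommGroup V]
    [NormedSpace ℝ V] [CompleteSpace V] {Q : ℝ → EucR m →L[ℝ] V} (hQ : Continuous Q) {w : V}
    (h : ∀ ℓ : V →L[ℝ] ℝ, ℓ w ≤ ∫ θ in (0 : ℝ)..(2 * π), ‖ℓ.comp (Q θ)‖) :
    w ∈ attainableSet Q := by
  by_contra hw
  obtain ⟨ℓ, r, hr, hr'⟩ := geometric_hahn_banach_closed_point (convex_attainableSet hQ)
    (isClosed_attainableSet hQ) hw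
  obtain ⟨v, hv, hv'⟩ := exists_control_eq_integral_norm hQ ℓ
  have h1 := hr v hv
  have h2 := h ℓ
  linarith

namespace OscillatingCoeffs

variable {m : ℕ} {V : Type*} [NormedAddCommGroup V] [NormedSpace ℝ V]
  {M : Type*} [MetricSpace M] {K : Set M} {c : OscillatingCoeffs m V K}

section Limit

variable {F : M → V} {T : ℝ} {ε : ℕ → ℝ} {u : ℕ → ℝ → EucR m} {Θ : ℕ → ℝ → ℝ} {z : ℕ → ℝ → M}
  {y : ℝ → M}

lemma div_mem_Icc {ε T τ : ℝ} (hε : 0 < ε) (hτ : τ ∈ Icc 0 T) : τ / ε ∈ Icc 0 (T / ε) :=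
  ⟨div_nonneg hτ.1 hε.le, div_le_div_of_nonneg_right hτ.2 hε.le⟩

lemma IsEmbeddedSolution.dist_embed_rescale_le {ε S : ℝ} {u : ℝ → EucR m} {Θ : ℝ → ℝ}
    {z : ℝ → M} (h : c.IsEmbeddedSolution F ε (S / ε) u Θ z) (hε : 0 < ε) {s t : ℝ}
    (hs : s ∈ Icc 0 S) (ht : t ∈ Icc 0 S) :
    dist (F (z (s / ε))) (F (z (t / ε))) ≤ c.bound * dist s t := by
  refine (h.dist_embed_le hε (div_mem_Icc hε hs) (div_mem_Icc hε ht)).trans_eq ?_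
  rw [Real.dist_eq, Real.dist_eq, ← sub_div, abs_div, abs_of_pos hε]
  field_simp

lemma dist_embed_limit_le (hF : Continuous F) (hε : ∀ k, 0 < ε k)
    (hz : ∀ k, c.IsEmbeddedSolution F (ε k) (T / ε k) (u k) (Θ k) (z k))
    (hy : ∀ τ ∈ Icc 0 T, Tendsto (fun k => z k (τ / ε k)) atTop (𝓝 (y τ)))
    {s t : ℝ} (hs : s ∈ Icc 0 T) (ht : t ∈ Icc 0 T) :
    dist (F (y s)) (F (y t)) ≤ c.bound * dist s t :=
  le_of_tendsto' (((hF.tendsto _).comp (hy s hs)).dist ((hF.tendsto _).comp (hy t ht)))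
    fun k => (hz k).dist_embed_rescale_le (hε k) hs ht

/-- The velocities of a limit of solutions are averaged velocities. -/
lemma mem_attainableSet_of_hasDerivAt_limit [CompleteSpace V] (hK : IsClosed K) (hF : Continuous F)
    {C : ℝ} (hC : ∀ x ∈ K, ∀ y ∈ K, dist x y ≤ C * dist (F x) (F y))
    (hε : ∀ k, 0 < ε k) (hε0 : Tendsto ε atTop (𝓝 0))
    (hz : ∀ k, c.IsEmbeddedSolution F (ε k) (T / ε k) (u k) (Θ k) (z k))
    (hy : TendstoUniformlyOn (fun k τ => z k (τ / ε k)) y atTop (Icc 0 T))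
    {a : ℝ} (ha : a ∈ Ioo 0 T) {w : V} (hw : HasDerivAt (F ∘ y) w a) :
    w ∈ attainableSet (c.kernel (y a)) := by
  have hlim : ∀ τ ∈ Icc 0 T, Tendsto (fun k => z k (τ / ε k)) atTop (𝓝 (y τ)) :=
    fun τ hτ => hy.tendsto_at hτ
  have hyK : ∀ τ ∈ Icc 0 T, y τ ∈ K := fun τ hτ => hK.mem_of_tendsto (hlim τ hτ)
    (Eventually.of_forall fun k => (hz k).mem _ (div_mem_Icc (hε k) hτ))
  have haI : a ∈ Icc 0 T := Ioo_subset_Icc_self ha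
  have hp := hyK a haI
  refine mem_attainableSet_of_forall_clm_le (continuous_kernel hp) fun ℓ => ?_
  set μ := ∫ θ in (0 : ℝ)..(2 * π), ‖ℓ.comp (c.kernel (y a) θ)‖
  obtain ⟨C₁, B, hC₁, hest⟩ := exists_clm_sub_le c hp ℓ
  set L := |C| * c.bound with hL
  have hL0 : 0 ≤ L := mul_nonneg (abs_nonneg _) c.bound_pos.le
  have hlip : ∀ s ∈ Icc 0 T, ∀ t ∈ Icc 0 T, dist (y s) (y t) ≤ L * dist s t := by
    intro s hs t ht
    calc dist (y s) (y t) ≤ C * dist (F (y s)) (F (y t)) := hC _ (hyK s hs) _ (hyK t ht)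
      _ ≤ |C| * (c.bound * dist s t) := by
        gcongr
        · exact le_abs_self C
        · exact dist_embed_limit_le hF hε hz hlim hs ht
      _ = L * dist s t := by rw [hL, mul_assoc]
  -- the averaging estimate between `a` and `b`, in the limit `k → ∞`
  have hkey : ∀ b ∈ Ioo a T, ℓ (F (y b) - F (y a)) ≤
      (b - a) * (μ + C₁ * ((1 + L) * (b - a))) := by
    intro b hb
    have hab : 0 < b - a := sub_pos.2 hb.1
    have hbI : b ∈ Icc 0 T := ⟨ha.1.le.trans hb.1.le, hb.2.le⟩
    have h1 : Tendsto (fun k => ℓ (F (z k (b / ε k)) - F (z k (a / ε k)))) atTop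
        (𝓝 (ℓ (F (y b) - F (y a)))) :=
      (ℓ.continuous.tendsto _).comp
        (((hF.tendsto _).comp (hlim b hbI)).sub ((hF.tendsto _).comp (hlim a haI)))
    have h2 : Tendsto (fun k => (b - a) * (μ + C₁ * ((1 + L) * (b - a) + ε k)) + ε k * B) atTop
        (𝓝 ((b - a) * (μ + C₁ * ((1 + L) * (b - a) + 0)) + 0 * B)) :=
      ((((hε0.const_add _).const_mul _).const_add _).const_mul _).add (hε0.mul_const B)
    rw [add_zero, zero_mul, add_zero] at h2
    refine le_of_tendsto_of_tendsto h1 h2 ?_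
    filter_upwards [Metric.tendstoUniformlyOn_iff.1 hy (b - a) hab] with k hk
    have hεk := hε k
    have h3 := hest (hz k) hεk (a := a / ε k) (b := b / ε k) (r := (1 + L) * (b - a))
      (div_nonneg ha.1.le hεk.le) (div_le_div_of_nonneg_right hb.1.le hεk.le)
      (div_le_div_of_nonneg_right hb.2.le hεk.le) (by positivity) ?_
    · refine h3.trans_eq ?_
      rw [← sub_div, mul_div_cancel₀ _ hεk.ne']
    · intro t ht
      obtain ⟨τ, rfl⟩ : ∃ τ, t = τ / ε k := ⟨t * ε k, (mul_div_cancel_right₀ _ hεk.ne').symm⟩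
      have hτ : τ ∈ Icc a b :=
        ⟨(div_le_div_iff_of_pos_right hεk).1 ht.1, (div_le_div_iff_of_pos_right hεk).1 ht.2⟩
      have hτI : τ ∈ Icc 0 T := ⟨ha.1.le.trans hτ.1, hτ.2.trans hb.2.le⟩
      have h4 := hk τ hτI
      have h5 := hlip τ hτI a haI
      rw [Real.dist_eq, abs_of_nonneg (sub_nonneg.2 hτ.1)] at h5
      have h6 : L * (τ - a) ≤ L * (b - a) := by gcongr; exact hτ.2
      rw [dist_comm] at h4
      linarith [dist_triangle (z k (τ / ε k)) (y τ) (y a)]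
  have hslope : Tendsto (fun b => ℓ (slope (F ∘ y) a b)) (𝓝[>] a) (𝓝 (ℓ w)) :=
    (ℓ.continuous.tendsto _).comp ((hasDerivAt_iff_tendsto_slope.1 hw).mono_left
      (nhdsWithin_mono _ fun b hb => ne_of_gt hb))
  have hright : Tendsto (fun b => μ + C₁ * ((1 + L) * (b - a))) (𝓝[>] a) (𝓝 μ) := by
    have h : Continuous fun b => μ + C₁ * ((1 + L) * (b - a)) := by fun_prop
    simpa using (h.tendsto a).mono_left (nhdsWithin_le_nhds (s := Ioi a))
  refine le_of_tendsto_of_tendsto hslope hright ?_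
  filter_upwards [Ioo_mem_nhdsGT ha.2] with b hb
  have hab : 0 < b - a := sub_pos.2 hb.1
  rw [slope_def_module, map_smul, smul_eq_mul, inv_mul_le_iff₀ hab]
  exact hkey b hb

end Limit

end OscillatingCoeffs

/-! ### Tracking a solution of the average system -/

namespace OscillatingCoeffs

variable {m : ℕ} {V : Type*} [NormedAddCommGroup V] [NormedSpace ℝ V]
  {M : Type*} [MetricSpace M] {K : Set M} {c : OscillatingCoeffs m V K} {F : M → V} {x₀ : ℝ → M}

/-- A solution of the average inclusion with values in `K`, defined for all positive times and seen
in `V` through the map `F`. -/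
structure IsEmbeddedAverageSolution (c : OscillatingCoeffs m V K) (F : M → V) (x₀ : ℝ → M) :
    Prop where
  mem : ∀ t, 0 ≤ t → x₀ t ∈ K
  ac : ∀ S, 0 ≤ S → AbsolutelyContinuousOnInterval (F ∘ x₀) 0 S
  hasDerivAt : ∀ᵐ t ∂(volume.restrict (Ici 0)),
    ∃ w ∈ attainableSet (c.kernel (x₀ t)), HasDerivAt (F ∘ x₀) w t

lemma norm_le_of_mem_attainableSet {p : M} (hp : p ∈ K) {w : V}
    (hw : w ∈ attainableSet (c.kernel p)) :
    ‖w‖ ≤ 2 * π * (c.bound * c.lower⁻¹ * c.bound) := by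
  obtain ⟨U, hU, rfl⟩ := hw
  exact norm_controlIntegral_le (norm_kernel_le hp) hU

lemma IsEmbeddedAverageSolution.dist_le (h : c.IsEmbeddedAverageSolution F x₀) {s t : ℝ}
    (hs : 0 ≤ s) (ht : 0 ≤ t) :
    dist (F (x₀ s)) (F (x₀ t)) ≤ 2 * π * (c.bound * c.lower⁻¹ * c.bound) * dist s t := by
  refine (h.ac (max s t) (hs.trans (le_max_left _ _))).dist_le_of_norm_deriv_le
    (X' := deriv (F ∘ x₀)) ?_ ⟨hs, le_max_left _ _⟩ ⟨ht, le_max_right _ _⟩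
  filter_upwards [ae_restrict_of_ae_restrict_of_subset Icc_subset_Ici_self h.hasDerivAt,
    ae_restrict_mem measurableSet_Icc] with r hr hrI
  obtain ⟨w, hw, hd⟩ := hr
  rw [hd.deriv]
  exact ⟨hd, norm_le_of_mem_attainableSet (h.mem r hrI.1) hw⟩

/-- The mean velocity of a solution of the average inclusion is close to a velocity that is
admissible at the initial point, since the sets of admissible velocities are convex and depend in
a Lipschitz way on the point. -/
lemma IsEmbeddedAverageSolution.exists_norm_sub_smul_le (h : c.IsEmbeddedAverageSolution F x₀)
    {C : ℝ} (hC0 : 0 ≤ C) (hC : ∀ x ∈ K, ∀ y ∈ K, dist x y ≤ C * dist (F x) (F y)) :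
    ∃ L : ℝ, 0 ≤ L ∧ ∀ a b η : ℝ, 0 ≤ a → a < b → 0 < η →
      ∃ w ∈ attainableSet (c.kernel (x₀ a)),
        ‖(b - a)⁻¹ • (F (x₀ b) - F (x₀ a)) - w‖ ≤ L * (b - a) + η := by
  obtain ⟨D, hD0, hD⟩ := c.exists_norm_kernel_sub_le
  set A := 2 * π * (c.bound * c.lower⁻¹ * c.bound) with hA
  have hb := c.bound_pos
  have hl := c.lower_pos
  have hA0 : 0 ≤ A := by positivity
  refine ⟨2 * π * (D * (C * A)), by positivity, fun a b η ha hab hη => ?_⟩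
  have hba : 0 < b - a := sub_pos.2 hab
  have hδ : 0 ≤ 2 * π * (D * (C * A)) * (b - a) := by positivity
  have hsub : Icc a b ⊆ Ici 0 := fun t ht => ha.trans ht.1
  have hmem : (b - a)⁻¹ • (F (x₀ b) - F (x₀ a)) ∈
      Metric.cthickening (2 * π * (D * (C * A)) * (b - a)) (attainableSet (c.kernel (x₀ a))) := by
    refine ((h.ac b (ha.trans hab.le)).mono ?_).smul_sub_mem_of_convex (X' := deriv (F ∘ x₀)) hab
      ((convex_attainableSet (continuous_kernel (h.mem a ha))).cthickening _)
      Metric.isClosed_cthickening ?_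
    · rw [uIcc_of_le hab.le, uIcc_of_le (ha.trans hab.le)]
      exact Icc_subset_Icc_left ha
    filter_upwards [ae_restrict_of_ae_restrict_of_subset hsub h.hasDerivAt,
      ae_restrict_mem measurableSet_Icc] with t ht htI
    obtain ⟨w, ⟨U, hU, rfl⟩, hd⟩ := ht
    rw [hd.deriv]
    refine ⟨hd, Metric.mem_cthickening_of_dist_le _ _ _ _ (controlIntegral_mem_attainableSet hU) ?_⟩
    rw [dist_eq_norm]
    have ht0 : 0 ≤ t := hsub htI
    refine (norm_controlIntegral_sub_le (continuous_kernel (h.mem t ht0))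
      (continuous_kernel (h.mem a ha)) (hD _ (h.mem t ht0) _ (h.mem a ha)) hU).trans ?_
    have h1 : dist (x₀ t) (x₀ a) ≤ C * (A * (b - a)) := by
      refine (hC _ (h.mem t ht0) _ (h.mem a ha)).trans ?_
      gcongr
      refine (h.dist_le ht0 ha).trans ?_
      rw [Real.dist_eq, abs_of_nonneg (sub_nonneg.2 htI.1)]
      gcongr
      exact htI.2
    calc 2 * π * (D * dist (x₀ t) (x₀ a)) ≤ 2 * π * (D * (C * (A * (b - a)))) := by gcongr
      _ = _ := by ring
  have h2 := Metric.cthickening_subset_thickening' (δ₂ := 2 * π * (D * (C * A)) * (b - a) + η)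
    (by positivity) (by linarith) _ hmem
  obtain ⟨w, hw, hw'⟩ := Metric.mem_thickening_iff.1 h2
  rw [dist_eq_norm] at hw'
  exact ⟨w, hw, hw'.le⟩

/-- Over one turn of the frozen system at `x₀ τ`, a smooth control follows the average solution up
to a small correction `e` of the velocity. -/
lemma IsEmbeddedAverageSolution.exists_control_turn (h : c.IsEmbeddedAverageSolution F x₀)
    {C : ℝ} (hC0 : 0 ≤ C) (hC : ∀ x ∈ K, ∀ y ∈ K, dist x y ≤ C * dist (F x) (F y)) :
    ∃ L : ℝ, 0 ≤ L ∧ ∀ ε τ : ℝ, 0 < ε → 0 ≤ τ → ∃ U : ℝ → EucR m, ∃ e : V,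
      ContDiff ℝ ∞ U ∧ (∀ θ, ‖U θ‖ ≤ 1) ∧ (∀ θ ∉ Ioo 0 (2 * π), U θ = 0) ∧ ‖e‖ ≤ L * ε ∧
      F (x₀ (τ + ε * c.period (x₀ τ))) = F (x₀ τ) +
        (ε * c.period (x₀ τ)) • (controlIntegral (c.kernel (x₀ τ)) U + e) := by
  obtain ⟨L, hL0, hL⟩ := h.exists_norm_sub_smul_le hC0 hC
  have hl := c.lower_pos
  refine ⟨L * (2 * π * c.lower⁻¹) + 2, by positivity, fun ε τ hε hτ => ?_⟩
  have hp := h.mem τ hτ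
  have hper := period_pos (c := c) hp
  have hεp : 0 < ε * c.period (x₀ τ) := mul_pos hε hper
  obtain ⟨w, hw, hw'⟩ := hL τ (τ + ε * c.period (x₀ τ)) ε hτ (by linarith) hε
  rw [add_sub_cancel_left] at hw'
  obtain ⟨U, hU, hU1, hU0, hUw⟩ :=
    exists_contDiff_dist_controlIntegral_lt (continuous_kernel hp) hw hε
  refine ⟨U, (ε * c.period (x₀ τ))⁻¹ • (F (x₀ (τ + ε * c.period (x₀ τ))) - F (x₀ τ)) -
    controlIntegral (c.kernel (x₀ τ)) U, hU, hU1, hU0, ?_, ?_⟩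
  · rw [dist_comm, dist_eq_norm] at hUw
    have h1 : L * (ε * c.period (x₀ τ)) ≤ L * (ε * (2 * π * c.lower⁻¹)) := by
      gcongr
      exact period_le (c := c) hp
    have h2 := norm_sub_le_norm_sub_add_norm_sub
      ((ε * c.period (x₀ τ))⁻¹ • (F (x₀ (τ + ε * c.period (x₀ τ))) - F (x₀ τ))) w
      (controlIntegral (c.kernel (x₀ τ)) U)
    linarith
  · rw [add_sub_cancel, smul_inv_smul₀ hεp.ne']
    abel

/-- A solution with values in `K` of the control system with control `ε U(θ)`, seen in `V`
through the map `F`. -/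
structure IsClosedLoop (c : OscillatingCoeffs m V K) (F : M → V) (ε S : ℝ)
    (U : ℝ → EucR m) (Θ : ℝ → ℝ) (x : ℝ → M) : Prop where
  mem : ∀ t ∈ Icc 0 S, x t ∈ K
  hasDerivAt_embed : ∀ t ∈ Icc 0 S,
    HasDerivAt (F ∘ x) (ε • c.field (Θ t) (x t) (U (Θ t))) t
  hasDerivAt_angle : ∀ t ∈ Icc 0 S,
    HasDerivAt Θ (c.freq (Θ t) (x t) + ε * c.angle (Θ t) (x t) (U (Θ t))) t

lemma abs_angle_apply_le {θ : ℝ} {p : M} (hp : p ∈ K) {v : EucR m} (hv : ‖v‖ ≤ 1) :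
    |c.angle θ p v| ≤ c.bound := by
  rw [← Real.norm_eq_abs]
  calc ‖c.angle θ p v‖ ≤ ‖c.angle θ p‖ * ‖v‖ := ContinuousLinearMap.le_opNorm _ _
    _ ≤ c.bound * 1 := by
      have := c.bound_pos
      gcongr
      exact c.norm_angle_le _ _ hp
    _ = c.bound := mul_one _

lemma norm_field_apply_le {θ : ℝ} {p : M} (hp : p ∈ K) {v : EucR m} (hv : ‖v‖ ≤ 1) :
    ‖c.field θ p v‖ ≤ c.bound := by
  calc ‖c.field θ p v‖ ≤ ‖c.field θ p‖ * ‖v‖ := ContinuousLinearMap.le_opNorm _ _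
    _ ≤ c.bound * 1 := by
      have := c.bound_pos
      gcongr
      exact c.norm_field_le _ _ hp
    _ = c.bound := mul_one _

section Tracking

variable {ε S : ℝ} {U : ℝ → EucR m} {Θ : ℝ → ℝ} {x : ℝ → M}

lemma IsClosedLoop.monotoneOn_angle (h : c.IsClosedLoop F ε S U Θ x) (hε : 0 < ε)
    (hε' : ε * c.bound ≤ c.lower) (hU : ∀ θ, ‖U θ‖ ≤ 1) : MonotoneOn Θ (Icc 0 S) := by
  refine monotoneOn_of_deriv_nonneg (convex_Icc _ _)
    (fun t ht => (h.hasDerivAt_angle t ht).continuousAt.continuousWithinAt)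
    (fun t ht => (h.hasDerivAt_angle t (interior_subset ht)).differentiableAt
      |>.differentiableWithinAt)
    fun t ht => ?_
  rw [(h.hasDerivAt_angle t (interior_subset ht)).deriv]
  have h1 := c.lower_le_freq (Θ t) _ (h.mem t (interior_subset ht))
  have h2 := (abs_le.1 (abs_angle_apply_le (c := c) (θ := Θ t) (h.mem t (interior_subset ht))
    (hU (Θ t)))).1
  nlinarith

lemma IsClosedLoop.angle_le (h : c.IsClosedLoop F ε S U Θ x) (hε : 0 < ε) (hε1 : ε ≤ 1)
    (hU : ∀ θ, ‖U θ‖ ≤ 1) {t : ℝ} (ht : t ∈ Icc 0 S) : Θ t ≤ Θ 0 + 2 * c.bound * t := by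
  have h0 : (0 : ℝ) ∈ Icc 0 S := ⟨le_rfl, ht.1.trans ht.2⟩
  have h1 := Convex.norm_image_sub_le_of_norm_hasDerivWithin_le (C := 2 * c.bound)
    (fun t ht => (h.hasDerivAt_angle t ht).hasDerivWithinAt) (fun t ht => ?_) (convex_Icc 0 S) h0 ht
  · rw [sub_zero, Real.norm_eq_abs, Real.norm_eq_abs, abs_of_nonneg ht.1] at h1
    linarith [(abs_le.1 h1).2]
  · have h2 := abs_angle_apply_le (c := c) (θ := Θ t) (h.mem t ht) (hU (Θ t))
    have h3 := c.freq_le (Θ t) _ (h.mem t ht)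
    have h4 := freq_pos (c := c) (h.mem t ht) (Θ t)
    have h5 : |ε * c.angle (Θ t) (x t) (U (Θ t))| ≤ 1 * c.bound := by
      rw [abs_mul, abs_of_pos hε]
      gcongr
    refine (norm_add_le _ _).trans ?_
    rw [Real.norm_of_nonneg h4.le, Real.norm_eq_abs]
    linarith

end Tracking

section Turn

variable {ε : ℝ} {p : M} {W : ℝ → EucR m} {e : V} {Z : V × ℝ}

/-- The velocity, with respect to the angle, of the pair formed by the state and the slow time, for
the system frozen at `p` with control `ε v` and with the correction `e` of the velocity. -/
def turnVelocity (c : OscillatingCoeffs m V K) (ε : ℝ) (p : M) (e : V) (θ : ℝ) (v : EucR m) :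
    V × ℝ :=
  (ε * (c.freq θ p)⁻¹) • (c.field θ p v + e, 1)

/-- The curve starting from `Z` with velocity `turnVelocity`. -/
def turnCurve (c : OscillatingCoeffs m V K) (ε : ℝ) (p : M) (e : V) (W : ℝ → EucR m) (Z : V × ℝ)
    (θ : ℝ) : V × ℝ :=
  Z + (∫ s in (0 : ℝ)..θ, (c.turnVelocity ε p e s (W s)).1,
    ∫ s in (0 : ℝ)..θ, (c.turnVelocity ε p e s (W s)).2)

lemma continuous_turnVelocity (hp : p ∈ K) (hW : Continuous W) :
    Continuous fun θ => c.turnVelocity ε p e θ (W θ) :=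
  (continuous_const.mul (continuous_inv_freq hp)).smul
    ((((continuous_field hp).clm_apply hW).add continuous_const).prodMk continuous_const)

lemma hasDerivAt_turnCurve [CompleteSpace V] (hp : p ∈ K) (hW : Continuous W) (θ : ℝ) :
    HasDerivAt (c.turnCurve ε p e W Z) (c.turnVelocity ε p e θ (W θ)) θ := by
  have h := continuous_turnVelocity (c := c) (ε := ε) (e := e) hp hW
  exact ((intervalIntegral.integral_hasDerivAt_right (h.fst.intervalIntegrable _ _)
    (h.fst.stronglyMeasurableAtFilter _ _) h.fst.continuousAt).prodMk
    (intervalIntegral.integral_hasDerivAt_right (h.snd.intervalIntegrable _ _)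
      (h.snd.stronglyMeasurableAtFilter _ _) h.snd.continuousAt)).const_add Z

lemma turnCurve_zero : c.turnCurve ε p e W Z 0 = Z := by
  simp [turnCurve]

/-- After a turn, the reference curve has followed the averaged velocity of the control during the
period of the frozen system. -/
lemma turnCurve_two_pi [CompleteSpace V] (hp : p ∈ K) (hW : Continuous W) :
    c.turnCurve ε p e W Z (2 * π) = Z + ((ε * c.period p) • (controlIntegral (c.kernel p) W + e),
      ε * c.period p) := by
  have hper := (period_pos (c := c) hp).ne'
  have hi := continuous_inv_freq (c := c) hp
  have hk : Continuous fun θ => c.kernel p θ (W θ) := (continuous_kernel hp).clm_apply hW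
  rw [turnCurve]
  congr 2
  · have h1 : ∀ θ, (c.turnVelocity ε p e θ (W θ)).1 =
        (ε * c.period p) • c.kernel p θ (W θ) + (ε * (c.freq θ p)⁻¹) • e := by
      intro θ
      simp only [turnVelocity, kernel, Prod.smul_mk, smul_add, smul_apply]
      rw [smul_smul, smul_smul]
      congr 2
      field_simp
    have hi1 : Continuous fun θ => (ε * c.period p) • c.kernel p θ (W θ) := hk.const_smul _
    have hi2 : Continuous fun θ => (ε * (c.freq θ p)⁻¹) • e :=
      (continuous_const.mul hi).smul continuous_const
    simp only [h1]
    rw [intervalIntegral.integral_add (hi1.intervalIntegrable _ _) (hi2.intervalIntegrable _ _),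
      intervalIntegral.integral_smul, intervalIntegral.integral_smul_const,
      intervalIntegral.integral_const_mul, smul_add]
    rfl
  · simp only [turnVelocity, Prod.smul_mk, smul_eq_mul, mul_one,
      intervalIntegral.integral_const_mul]
    rfl

lemma norm_turnVelocity_le (hp : p ∈ K) {θ : ℝ} {v : EucR m} (hv : ‖v‖ ≤ 1) (hε : 0 < ε) {L : ℝ}
    (he : ‖e‖ ≤ L) : ‖c.turnVelocity ε p e θ v‖ ≤ ε * (c.lower⁻¹ * (c.bound + L + 1)) := by
  have hb := c.bound_pos
  have hl := c.lower_pos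
  have hL : 0 ≤ L := (norm_nonneg _).trans he
  rw [turnVelocity, norm_smul, Real.norm_of_nonneg
    (mul_pos hε (inv_pos.2 (freq_pos (c := c) hp θ))).le, mul_assoc]
  have h1 : ‖(c.field θ p v + e, (1 : ℝ))‖ ≤ c.bound + L + 1 := by
    refine norm_prod_le_iff.2 ⟨?_, ?_⟩
    · exact (norm_add_le _ _).trans (by linarith [norm_field_apply_le (c := c) (θ := θ) hp hv])
    · rw [norm_one]; linarith
  have h2 := inv_freq_le (c := c) hp θ
  have h3 := (inv_pos.2 (freq_pos (c := c) hp θ)).le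
  gcongr

lemma norm_turnCurve_sub_le (hp : p ∈ K) (hW : ContDiff ℝ ∞ W) (hW1 : ∀ θ, ‖W θ‖ ≤ 1)
    [CompleteSpace V] (hε : 0 < ε) {L : ℝ} (he : ‖e‖ ≤ L) {θ : ℝ} (hθ : θ ∈ Icc 0 (2 * π)) :
    ‖c.turnCurve ε p e W Z θ - Z‖ ≤ ε * (2 * π * (c.lower⁻¹ * (c.bound + L + 1))) := by
  have h := Convex.norm_image_sub_le_of_norm_hasDerivWithin_le
    (f := c.turnCurve ε p e W Z) (s := univ) (x := 0) (y := θ)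
    (fun s _ => (hasDerivAt_turnCurve hp hW.continuous s).hasDerivWithinAt)
    (fun s _ => norm_turnVelocity_le (c := c) hp (hW1 s) hε he) convex_univ
    (mem_univ _) (mem_univ _)
  rw [turnCurve_zero, sub_zero, Real.norm_of_nonneg hθ.1] at h
  have hb := c.bound_pos
  have hl := c.lower_pos
  have hL : 0 ≤ L := (norm_nonneg _).trans he
  calc _ ≤ ε * (c.lower⁻¹ * (c.bound + L + 1)) * θ := h
    _ ≤ ε * (c.lower⁻¹ * (c.bound + L + 1)) * (2 * π) := by gcongr; exact hθ.2
    _ = _ := by ring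

/-- The velocity of the system at `x` differs little from that of the system frozen at `p`, when
both are measured along the angle of the former. -/
lemma norm_sub_smul_turnVelocity_le {x : M} (hx : x ∈ K) (hp : p ∈ K) {θ : ℝ} {v : EucR m}
    (hv : ‖v‖ ≤ 1) (hε : 0 < ε) (hε1 : ε ≤ 1) {L : ℝ} (he : ‖e‖ ≤ L * ε) :
    ‖((ε • c.field θ x v, ε) : V × ℝ) -
        (c.freq θ x + ε * c.angle θ x v) • c.turnVelocity ε p e θ v‖ ≤
      ε * ((c.bound + c.lower⁻¹ * c.bound * c.bound + 2 * c.bound * c.lower⁻¹ * L +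
        c.lower⁻¹ * c.bound) * (dist x p + ε)) := by
  have hb := c.bound_pos
  have hl := c.lower_pos
  have hL : 0 ≤ L := by
    by_contra! hL
    have := (norm_nonneg _).trans he
    nlinarith
  have hd : 0 ≤ dist x p := dist_nonneg
  set q := (c.freq θ x + ε * c.angle θ x v) * (c.freq θ p)⁻¹ with hq
  have hang : |ε * c.angle θ x v| ≤ ε * c.bound := by
    rw [abs_mul, abs_of_pos hε]
    gcongr
    exact abs_angle_apply_le hx hv
  have hang1 : ε * c.bound ≤ 1 * c.bound := by gcongr
  have hinv := inv_freq_le (c := c) hp θ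
  have hinv0 := (inv_pos.2 (freq_pos (c := c) hp θ)).le
  have hq1 : |1 - q| ≤ c.lower⁻¹ * c.bound * (dist x p + ε) := by
    have h1 : 1 - q = (c.freq θ p)⁻¹ * (c.freq θ p - c.freq θ x - ε * c.angle θ x v) := by
      rw [hq]
      have := (freq_pos (c := c) hp θ).ne'
      field_simp
      ring
    have h2 := c.dist_freq_le θ θ p hp x hx
    rw [dist_self, zero_add, Real.dist_eq, dist_comm] at h2
    have h3 : |c.freq θ p - c.freq θ x - ε * c.angle θ x v| ≤ c.bound * (dist x p + ε) := by
      refine (abs_sub _ _).trans ?_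
      linarith
    rw [h1, abs_mul, abs_of_nonneg hinv0, mul_assoc]
    gcongr
  have hq2 : |q| ≤ 2 * c.bound * c.lower⁻¹ := by
    rw [hq, abs_mul, abs_of_nonneg hinv0]
    have h1 : |c.freq θ x + ε * c.angle θ x v| ≤ 2 * c.bound := by
      refine (abs_add_le _ _).trans ?_
      rw [abs_of_pos (freq_pos (c := c) hx θ)]
      linarith [c.freq_le θ x hx]
    gcongr
  have hdec : ((ε • c.field θ x v, ε) : V × ℝ) -
        (c.freq θ x + ε * c.angle θ x v) • c.turnVelocity ε p e θ v =
      ε • ((c.field θ x - c.field θ p) v + ((1 - q) • c.field θ p v - q • e), 1 - q) := by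
    rw [turnVelocity, smul_smul, show (c.freq θ x + ε * c.angle θ x v) * (ε * (c.freq θ p)⁻¹) =
      ε * q by rw [hq]; ring, ← smul_smul]
    ext
    · simp only [Prod.fst_sub, Prod.smul_fst, sub_apply, ← smul_sub]
      congr 1
      rw [sub_smul, one_smul, smul_add]
      abel
    · simp only [Prod.snd_sub, Prod.smul_snd, smul_eq_mul, mul_one]
      ring
  rw [hdec, norm_smul, Real.norm_of_nonneg hε.le]
  gcongr
  refine norm_prod_le_iff.2 ⟨?_, ?_⟩
  · have h1 : ‖(c.field θ x - c.field θ p) v‖ ≤ c.bound * dist x p := by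
      have h2 := c.dist_field_le θ θ x hx p hp
      rw [dist_self, zero_add, dist_eq_norm] at h2
      calc _ ≤ ‖c.field θ x - c.field θ p‖ * ‖v‖ := ContinuousLinearMap.le_opNorm _ _
        _ ≤ c.bound * dist x p * 1 := by gcongr
        _ = _ := mul_one _
    have h2 : ‖(1 - q) • c.field θ p v‖ ≤ c.lower⁻¹ * c.bound * (dist x p + ε) * c.bound := by
      rw [norm_smul, Real.norm_eq_abs]
      gcongr
      exact norm_field_apply_le hp hv
    have h3 : ‖q • e‖ ≤ 2 * c.bound * c.lower⁻¹ * (L * ε) := by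
      rw [norm_smul, Real.norm_eq_abs]
      gcongr
    calc _ ≤ ‖(c.field θ x - c.field θ p) v‖ + (‖(1 - q) • c.field θ p v‖ + ‖q • e‖) :=
          (norm_add_le _ _).trans (by gcongr; exact norm_sub_le _ _)
      _ ≤ c.bound * dist x p + (c.lower⁻¹ * c.bound * (dist x p + ε) * c.bound +
          2 * c.bound * c.lower⁻¹ * (L * ε)) := by gcongr
      _ ≤ c.bound * (dist x p + ε) + (c.lower⁻¹ * c.bound * (dist x p + ε) * c.bound +
          2 * c.bound * c.lower⁻¹ * (L * (dist x p + ε))) +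
            c.lower⁻¹ * c.bound * (dist x p + ε) := by
          have h4 : 0 ≤ c.lower⁻¹ * c.bound * (dist x p + ε) := by positivity
          have h5 : c.bound * dist x p ≤ c.bound * (dist x p + ε) := by gcongr; linarith
          have h6 : 2 * c.bound * c.lower⁻¹ * (L * ε) ≤
            2 * c.bound * c.lower⁻¹ * (L * (dist x p + ε)) := by gcongr; linarith
          linarith
      _ = _ := by ring
  · rw [Real.norm_eq_abs]
    refine hq1.trans ?_
    gcongr
    have : 0 ≤ c.bound + c.lower⁻¹ * c.bound * c.bound + 2 * c.bound * c.lower⁻¹ * L := by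
      positivity
    linarith

end Turn

end OscillatingCoeffs

namespace OscillatingCoeffs

variable {m : ℕ} {V : Type*} [NormedAddCommGroup V] [NormedSpace ℝ V] [CompleteSpace V]
  {M : Type*} [MetricSpace M] {K : Set M} {c : OscillatingCoeffs m V K} {F : M → V} {x₀ : ℝ → M}

/-- The Grönwall estimate over a turn: the distance to the reference curve grows by a factor
`exp (D ε (t - s))` up to an error of order `ε`. -/
lemma IsClosedLoop.exists_norm_sub_turnCurve_le (c : OscillatingCoeffs m V K) {F : M → V}
    {C : ℝ} (hC0 : 0 ≤ C) (hC : ∀ x ∈ K, ∀ y ∈ K, dist x y ≤ C * dist (F x) (F y))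
    {L : ℝ} (hL : 0 ≤ L) :
    ∃ D : ℝ, 0 < D ∧ ∀ {ε S : ℝ} {U W : ℝ → EucR m} {Θ : ℝ → ℝ} {x : ℝ → M}
      (_ : c.IsClosedLoop F ε S U Θ x) (_ : 0 < ε) (_ : ε ≤ 1)
      (_ : ContDiff ℝ ∞ W) (_ : ∀ θ, ‖W θ‖ ≤ 1) {p : M} (_ : p ∈ K) {e : V}
      (_ : ‖e‖ ≤ L * ε) (τ : ℝ) (j : ℕ)
      (_ : ∀ θ, θ - j * (2 * π) ∈ Icc 0 (2 * π) → U θ = W (θ - j * (2 * π)))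
      {s t B : ℝ} (_ : 0 ≤ s) (_ : s ≤ t) (_ : t ≤ S)
      (_ : ∀ r ∈ Icc s t, Θ r - j * (2 * π) ∈ Icc 0 (2 * π))
      (_ : ‖(F (x s), ε * s) - c.turnCurve ε p e W (F p, τ) (Θ s - j * (2 * π))‖ ≤
        ε * (B * Real.exp (D * ε * s) - 1)),
      ‖(F (x t), ε * t) - c.turnCurve ε p e W (F p, τ) (Θ t - j * (2 * π))‖ ≤
        ε * (B * Real.exp (D * ε * t) - 1) := by
  have hb := c.bound_pos
  have hl := c.lower_pos
  set C₁ := c.bound + c.lower⁻¹ * c.bound * c.bound + 2 * c.bound * c.lower⁻¹ * L +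
        c.lower⁻¹ * c.bound with hC₁
  set C₂ := 2 * π * (c.lower⁻¹ * (c.bound + L + 1)) with hC₂
  have hC₁0 : 0 < C₁ := by positivity
  have hC₂0 : 0 < C₂ := by positivity
  refine ⟨C₁ * (C + C * C₂ + 1), by positivity, ?_⟩
  set D := C₁ * (C + C * C₂ + 1) with hD
  have hD0 : 0 < D := by positivity
  intro ε S U W Θ x h hε hε1 hW hW1 p hp e he τ j hUW s t B hs hst htS hturn hstart
  set a : ℝ := j * (2 * π) with ha
  set R : ℝ → V × ℝ := fun r => (F (x r), ε * r) - c.turnCurve ε p e W (F p, τ) (Θ r - a) with hR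
  have hsub : Icc s t ⊆ Icc 0 S := Icc_subset_Icc hs htS
  have heL : ‖e‖ ≤ L := he.trans (mul_le_of_le_one_right hL hε1)
  have hRd : ∀ r ∈ Icc s t, HasDerivAt R ((ε • c.field (Θ r) (x r) (U (Θ r)), ε) -
      (c.freq (Θ r) (x r) + ε * c.angle (Θ r) (x r) (U (Θ r))) •
        c.turnVelocity ε p e (Θ r) (U (Θ r))) r := by
    intro r hr
    have h1 := (h.hasDerivAt_embed r (hsub hr)).prodMk ((hasDerivAt_id r).const_mul ε)
    have h2 := (hasDerivAt_turnCurve (c := c) (ε := ε) (e := e) (Z := (F p, τ)) hp hW.continuous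
      (Θ r - a)).scomp r ((h.hasDerivAt_angle r (hsub hr)).sub_const a)
    have hper : c.turnVelocity ε p e (Θ r - a) (W (Θ r - a)) =
        c.turnVelocity ε p e (Θ r) (U (Θ r)) := by
      have e1 : c.freq (Θ r - a) p = c.freq (Θ r) p := (c.freq_periodic p).sub_nat_mul_eq j
      have e2 : c.field (Θ r - a) p = c.field (Θ r) p := (c.field_periodic p).sub_nat_mul_eq j
      rw [turnVelocity, turnVelocity, e1, e2, hUW _ (hturn r hr)]
    rw [hper] at h2
    rw [mul_one] at h1
    exact h1.sub h2
  have hbound : ∀ r ∈ Icc s t, ‖(ε • c.field (Θ r) (x r) (U (Θ r)), ε) -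
      (c.freq (Θ r) (x r) + ε * c.angle (Θ r) (x r) (U (Θ r))) •
        c.turnVelocity ε p e (Θ r) (U (Θ r))‖ ≤ D * ε * ‖R r‖ + D * ε * ε := by
    intro r hr
    have hU1 : ‖U (Θ r)‖ ≤ 1 := by rw [hUW _ (hturn r hr)]; exact hW1 _
    have hxr := h.mem r (hsub hr)
    refine (norm_sub_smul_turnVelocity_le hxr hp hU1 hε hε1 he).trans ?_
    have h1 := norm_turnCurve_sub_le (c := c) (Z := (F p, τ)) hp hW hW1 hε heL (hturn r hr)
    have h2 : ‖F (x r) - F p‖ ≤ ‖R r‖ + ε * C₂ := by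
      have h3 : (F (x r) - F p, ε * r - τ) = R r +
          (c.turnCurve ε p e W (F p, τ) (Θ r - a) - (F p, τ)) := by
        rw [hR]; simp [← Prod.mk_sub_mk]
      calc ‖F (x r) - F p‖ ≤ ‖((F (x r) - F p, ε * r - τ) : V × ℝ)‖ :=
          norm_fst_le ((F (x r) - F p, ε * r - τ) : V × ℝ)
        _ ≤ ‖R r‖ + ε * C₂ := by
          rw [h3]
          exact (norm_add_le _ _).trans (by gcongr)
    have h3 := hC _ hxr _ hp
    rw [dist_eq_norm] at h3
    have h4 : dist (x r) p ≤ C * (‖R r‖ + ε * C₂) := h3.trans (by gcongr)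
    have h5 := norm_nonneg (R r)
    calc ε * (C₁ * (dist (x r) p + ε)) ≤ ε * (C₁ * (C * (‖R r‖ + ε * C₂) + ε)) := by gcongr
      _ = ε * C₁ * (C * ‖R r‖) + ε * C₁ * ((C * C₂ + 1) * ε) := by ring
      _ ≤ ε * C₁ * ((C + C * C₂ + 1) * ‖R r‖) + ε * C₁ * ((C + C * C₂ + 1) * ε) := by
        gcongr
        · have : 0 ≤ C * C₂ := by positivity
          linarith
        · linarith
      _ = _ := by rw [hD]; ring
  have hgr := norm_le_gronwallBound_of_norm_deriv_right_le
    (fun r hr => (hRd r hr).continuousAt.continuousWithinAt)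
    (fun r hr => (hRd r (Ico_subset_Icc_self hr)).hasDerivWithinAt) hstart
    (fun r hr => hbound r (Ico_subset_Icc_self hr)) t ⟨hst, le_rfl⟩
  refine hgr.trans_eq ?_
  have hDε : D * ε ≠ 0 := (mul_pos hD0 hε).ne'
  have hexp : Real.exp (D * ε * t) = Real.exp (D * ε * s) * Real.exp (D * ε * (t - s)) := by
    rw [← Real.exp_add]; ring_nf
  rw [gronwallBound_of_K_ne_0 hDε, hexp, mul_div_cancel_left₀ _ hDε]
  ring

/-- The controls of the successive turns, assembled into a function of the angle. -/
lemma sum_turn_eq {W : ℕ → ℝ → EucR m} (hW : ∀ j, ∀ θ ∉ Ioo 0 (2 * π), W j θ = 0) {J j : ℕ}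
    (hj : j < J) {θ : ℝ} (hθ : θ - j * (2 * π) ∈ Icc 0 (2 * π)) :
    ∑ i ∈ Finset.range J, W i (θ - i * (2 * π)) = W j (θ - j * (2 * π)) := by
  refine Finset.sum_eq_single_of_mem j (Finset.mem_range.2 hj) fun i _ hij => hW i _ fun hi => ?_
  have hpi := Real.two_pi_pos
  rcases lt_or_gt_of_ne hij with hlt | hlt
  · have h1 : (i : ℝ) + 1 ≤ j := by exact_mod_cast hlt
    nlinarith [hi.2, hθ.1]
  · have h1 : (j : ℝ) + 1 ≤ i := by exact_mod_cast hlt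
    nlinarith [hi.1, hθ.2]

lemma norm_sum_turn_le {W : ℕ → ℝ → EucR m} (hW : ∀ j, ∀ θ ∉ Ioo 0 (2 * π), W j θ = 0)
    (hW1 : ∀ j θ, ‖W j θ‖ ≤ 1) (J : ℕ) (θ : ℝ) :
    ‖∑ i ∈ Finset.range J, W i (θ - i * (2 * π))‖ ≤ 1 := by
  by_cases h : ∃ j < J, θ - j * (2 * π) ∈ Icc 0 (2 * π)
  · obtain ⟨j, hj, hθ⟩ := h
    rw [sum_turn_eq hW hj hθ]
    exact hW1 _ _
  · push Not at h
    rw [Finset.sum_eq_zero fun i hi => hW i _ fun hθ =>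
      h i (Finset.mem_range.1 hi) (Ioo_subset_Icc_self hθ), norm_zero]
    exact zero_le_one

/-- A solution of the average inclusion is tracked with an error of order `ε` by every closed-loop
solution of the control system, for a suitable smooth control depending on the angle. The grid
`τ j` follows the slow time of the turns of the frozen systems, and the closed-loop solution is
compared over each turn with a reference curve joining the states at the times `τ j`. -/
theorem IsEmbeddedAverageSolution.exists_tracking_control (h : c.IsEmbeddedAverageSolution F x₀)
    {C : ℝ} (hC0 : 0 ≤ C) (hC : ∀ x ∈ K, ∀ y ∈ K, dist x y ≤ C * dist (F x) (F y))
    {T θ₀ : ℝ} (hθ₀ : θ₀ ∈ Icc 0 (2 * π)) :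
    ∃ C' : ℝ, 0 ≤ C' ∧ ∀ ε : ℝ, 0 < ε → ε ≤ 1 → ε * c.bound ≤ c.lower →
      ∃ U : ℝ → EucR m, ContDiff ℝ ∞ U ∧ (∀ θ, ‖U θ‖ ≤ 1) ∧
        ∀ (S : ℝ) (Θ : ℝ → ℝ) (x : ℝ → M), S ≤ T / ε → c.IsClosedLoop F ε S U Θ x →
          Θ 0 = θ₀ → x 0 = x₀ 0 → ∀ t ∈ Icc 0 S, dist (x t) (x₀ (ε * t)) ≤ C' * ε := by
  obtain ⟨L, hL0, hL⟩ := h.exists_control_turn hC0 hC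
  obtain ⟨D, hD0, hD⟩ := IsClosedLoop.exists_norm_sub_turnCurve_le c hC0 hC hL0
  have hb := c.bound_pos
  have hl := c.lower_pos
  have hpi := Real.two_pi_pos
  set C₂ := 2 * π * (c.lower⁻¹ * (c.bound + L + 1)) with hC₂
  have hC₂0 : 0 < C₂ := by positivity
  set A := 2 * π * (c.bound * c.lower⁻¹ * c.bound) with hA
  have hA0 : 0 < A := by positivity
  -- the Grönwall bound `ε (B exp (D ε t) - 1)` has to dominate the initial distance `ε C₂`
  set B := 1 + C₂ with hB
  have hB0 : 0 < B := by positivity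
  refine ⟨C * ((1 + A) * (B * Real.exp (D * T) + C₂)), by positivity, fun ε hε hε1 hεb => ?_⟩
  have hturn := fun τ (hτ : 0 ≤ τ) => hL ε τ hε hτ
  choose! W e hWs hW1 hW0 he hmatch using hturn
  -- each `τ (j + 1)` is the slow time at which the system frozen at `x₀ (τ j)` ends its turn
  let τ : ℕ → ℝ := fun j => Nat.rec 0 (fun _ s => s + ε * c.period (x₀ s)) j
  have hτ0 : τ 0 = 0 := rfl
  have hτs : ∀ j, τ (j + 1) = τ j + ε * c.period (x₀ (τ j)) := fun _ => rfl
  have hτ : ∀ j, 0 ≤ τ j := by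
    intro j
    induction j with
    | zero => exact le_rfl
    | succ j ih =>
      rw [hτs]
      exact add_nonneg ih (mul_pos hε (period_pos (h.mem _ ih))).le
  obtain ⟨J, hJ⟩ := exists_nat_gt ((θ₀ + 2 * c.bound * (T / ε)) / (2 * π))
  rw [div_lt_iff₀ hpi] at hJ
  have hW0' : ∀ j, ∀ θ ∉ Ioo 0 (2 * π), W (τ j) θ = 0 := fun j => hW0 (τ j) (hτ j)
  have hU1 := norm_sum_turn_le (W := fun j => W (τ j)) hW0' (fun j => hW1 (τ j) (hτ j)) J
  refine ⟨fun θ => ∑ i ∈ Finset.range J, W (τ i) (θ - i * (2 * π)),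
    ContDiff.sum fun i _ => (hWs (τ i) (hτ i)).comp (contDiff_id.sub contDiff_const), hU1, ?_⟩
  intro S Θ x hST hcl hΘ0 hx0
  have hmono := hcl.monotoneOn_angle hε hεb hU1
  -- the distance to the reference curve of the turn `j`, as a function of the time
  let R : ℕ → ℝ → V × ℝ := fun j t => (F (x t), ε * t) -
    c.turnCurve ε (x₀ (τ j)) (e (τ j)) (W (τ j)) (F (x₀ (τ j)), τ j) (Θ t - j * (2 * π))
  have heL : ∀ j, ‖e (τ j)‖ ≤ L := fun j =>
    (he (τ j) (hτ j)).trans (mul_le_of_le_one_right hL0 hε1)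
  have hgr : ∀ j < J, ∀ s t, 0 ≤ s → s ≤ t → t ≤ S →
      (∀ r ∈ Icc s t, Θ r - j * (2 * π) ∈ Icc 0 (2 * π)) →
      ‖R j s‖ ≤ ε * (B * Real.exp (D * ε * s) - 1) →
      ‖R j t‖ ≤ ε * (B * Real.exp (D * ε * t) - 1) := fun j hj s t hs hst htS hr hR =>
    hD hcl hε hε1 (hWs (τ j) (hτ j)) (hW1 (τ j) (hτ j)) (h.mem _ (hτ j)) (he (τ j) (hτ j))
      (τ j) j (fun θ hθ => sum_turn_eq hW0' hj hθ) hs hst htS hr hR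
  have hR : ∀ j < J, ∀ t ∈ Icc 0 S, Θ t - j * (2 * π) ∈ Icc 0 (2 * π) →
      ‖R j t‖ ≤ ε * (B * Real.exp (D * ε * t) - 1) := by
    intro j
    induction j with
    | zero =>
      intro hj t ht htΘ
      have h0S : (0 : ℝ) ∈ Icc 0 S := ⟨le_rfl, ht.1.trans ht.2⟩
      refine hgr 0 hj 0 t le_rfl ht.1 ht.2 (fun r hr => ?_) ?_
      · have hrS : r ∈ Icc 0 S := ⟨hr.1, hr.2.trans ht.2⟩
        have h1 := hmono h0S hrS hr.1
        have h2 := hmono hrS ht hr.2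
        simp only [Nat.cast_zero, zero_mul, sub_zero] at htΘ ⊢
        exact ⟨hθ₀.1.trans (hΘ0 ▸ h1), h2.trans htΘ.2⟩
      · -- the first turn starts at the angle `θ₀`, at a distance of order `ε` of the reference
        have h1 := norm_turnCurve_sub_le (c := c) (Z := (F (x₀ (τ 0)), τ 0)) (h.mem _ (hτ 0))
          (hWs (τ 0) (hτ 0)) (hW1 (τ 0) (hτ 0)) hε (heL 0) hθ₀
        simp only [R, hx0, hΘ0, Nat.cast_zero, zero_mul, sub_zero, mul_zero, Real.exp_zero, mul_one]
        rw [norm_sub_rev, hB, add_sub_cancel_left]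
        exact h1
    | succ j ih =>
      intro hj t ht htΘ
      have h0S : (0 : ℝ) ∈ Icc 0 S := ⟨le_rfl, ht.1.trans ht.2⟩
      have hjpi : 0 ≤ (j : ℝ) * (2 * π) := by positivity
      push_cast at htΘ
      -- the time at which the turn starts
      obtain ⟨s, hs, hsΘ⟩ : ∃ s ∈ Icc 0 t, Θ s = (j + 1) * (2 * π) := by
        refine intermediate_value_Icc ht.1 (fun r hr => (hcl.hasDerivAt_angle r
          ⟨hr.1, hr.2.trans ht.2⟩).continuousAt.continuousWithinAt) ⟨?_, ?_⟩
        · rw [hΘ0]; linarith [hθ₀.2]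
        · linarith [htΘ.1]
      have hsS : s ∈ Icc 0 S := ⟨hs.1, hs.2.trans ht.2⟩
      have h1 := ih (by omega) s hsS (by
        rw [hsΘ]
        constructor <;> linarith)
      refine hgr (j + 1) hj s t hs.1 hs.2 ht.2 (fun r hr => ?_) (le_of_eq_of_le ?_ h1)
      · have hrS : r ∈ Icc 0 S := ⟨hs.1.trans hr.1, hr.2.trans ht.2⟩
        have h2 := hmono hsS hrS hr.1
        have h3 := hmono hrS ht hr.2
        push_cast
        constructor
        · linarith
        · linarith [htΘ.2]
      · have h2 : Θ s - ((j + 1 : ℕ) : ℝ) * (2 * π) = 0 := by rw [hsΘ]; push_cast; ring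
        have h3 : Θ s - (j : ℝ) * (2 * π) = 2 * π := by rw [hsΘ]; ring
        simp only [R]
        rw [h2, h3, turnCurve_zero, turnCurve_two_pi (h.mem _ (hτ j)) (hWs (τ j) (hτ j)).continuous,
          hτs j, hmatch (τ j) (hτ j), Prod.mk_add_mk]
  intro t ht
  have h0S : (0 : ℝ) ∈ Icc 0 S := ⟨le_rfl, ht.1.trans ht.2⟩
  have hΘt : 0 ≤ Θ t := hθ₀.1.trans (hΘ0 ▸ hmono h0S ht ht.1)
  obtain ⟨j, hj⟩ : ∃ j : ℕ, j = ⌊Θ t / (2 * π)⌋₊ := ⟨_, rfl⟩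
  have hj1 : j * (2 * π) ≤ Θ t := by
    rw [← le_div_iff₀ hpi, hj]
    exact Nat.floor_le (by positivity)
  have hj2 : Θ t < (j + 1) * (2 * π) := by
    rw [← div_lt_iff₀ hpi, hj]
    exact Nat.lt_floor_add_one _
  have hjJ : j < J := by
    have h1 := hcl.angle_le hε hε1 hU1 ht
    have h2 : 2 * c.bound * t ≤ 2 * c.bound * (T / ε) := by
      gcongr
      exact ht.2.trans hST
    have h3 : (j : ℝ) * (2 * π) < J * (2 * π) := by linarith
    exact_mod_cast lt_of_mul_lt_mul_right h3 hpi.le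
  have hφ : Θ t - j * (2 * π) ∈ Icc 0 (2 * π) := ⟨by linarith, by linarith⟩
  have h1 := hR j hjJ t ht hφ
  have h2 := norm_turnCurve_sub_le (c := c) (Z := (F (x₀ (τ j)), τ j)) (h.mem _ (hτ j))
    (hWs (τ j) (hτ j)) (hW1 (τ j) (hτ j)) hε (heL j) hφ
  have hexp : Real.exp (D * ε * t) ≤ Real.exp (D * T) := by
    have h3 : ε * t ≤ T := by
      rw [← le_div_iff₀' hε]
      exact ht.2.trans hST
    rw [mul_assoc]
    gcongr
  have h3 : ‖((F (x t) - F (x₀ (τ j)), ε * t - τ j) : V × ℝ)‖ ≤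
      ε * (B * Real.exp (D * T) + C₂) := by
    have h4 : ((F (x t) - F (x₀ (τ j)), ε * t - τ j) : V × ℝ) = R j t +
        (c.turnCurve ε (x₀ (τ j)) (e (τ j)) (W (τ j)) (F (x₀ (τ j)), τ j) (Θ t - j * (2 * π)) -
          (F (x₀ (τ j)), τ j)) := by
      simp only [R, sub_add_sub_cancel, Prod.mk_sub_mk]
    rw [h4]
    refine (norm_add_le _ _).trans ((add_le_add h1 h2).trans ?_)
    have h5 : B * Real.exp (D * ε * t) ≤ B * Real.exp (D * T) := by gcongr
    rw [← mul_add]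
    gcongr
    linarith
  have h4 : ‖F (x t) - F (x₀ (τ j))‖ ≤ ε * (B * Real.exp (D * T) + C₂) :=
    (norm_fst_le ((F (x t) - F (x₀ (τ j)), ε * t - τ j) : V × ℝ)).trans h3
  have h5 : |ε * t - τ j| ≤ ε * (B * Real.exp (D * T) + C₂) :=
    (norm_snd_le ((F (x t) - F (x₀ (τ j)), ε * t - τ j) : V × ℝ)).trans h3
  have hεt : 0 ≤ ε * t := mul_nonneg hε.le ht.1
  have h6 : dist (F (x₀ (τ j))) (F (x₀ (ε * t))) ≤ A * |ε * t - τ j| := by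
    rw [← Real.dist_eq, dist_comm (ε * t)]
    exact h.dist_le (hτ j) hεt
  have h7 : dist (F (x t)) (F (x₀ (ε * t))) ≤
      ε * (B * Real.exp (D * T) + C₂) + A * (ε * (B * Real.exp (D * T) + C₂)) := by
    refine (dist_triangle _ (F (x₀ (τ j))) _).trans (add_le_add ?_ (h6.trans ?_))
    · rw [dist_eq_norm]; exact h4
    · gcongr
  calc dist (x t) (x₀ (ε * t)) ≤ C * dist (F (x t)) (F (x₀ (ε * t))) :=
        hC _ (hcl.mem t ht) _ (h.mem _ hεt)
    _ ≤ C * (ε * (B * Real.exp (D * T) + C₂) + A * (ε * (B * Real.exp (D * T) + C₂))) := by gcongr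
    _ = _ := by ring

end OscillatingCoeffs

/-! ### Embedding a Kepler system -/

/-- The chain rule for a curve on the manifold. -/
lemma hasDerivAt_comp_of_hasMFDerivAt {n : ℕ} {M : Type*} [TopologicalSpace M]
    [ChartedSpace (EucR n) M] {V : Type*} [NormedAddCommGroup V] [NormedSpace ℝ V] {F : M → V}
    (hF : ContMDiff (𝓡 n) 𝓘(ℝ, V) ∞ F) {x : ℝ → M} {t : ℝ} {w : TangentSpace (𝓡 n) (x t)}
    (h : HasMFDerivAt 𝓘(ℝ, ℝ) (𝓡 n) x t ((1 : ℝ →L[ℝ] ℝ).smulRight w)) :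
    HasDerivAt (F ∘ x) (mfderiv (𝓡 n) 𝓘(ℝ, V) F (x t) w : V) t := by
  let L : EucR n →L[ℝ] V := mfderiv (𝓡 n) 𝓘(ℝ, V) F (x t)
  have h1 := (hF.mdifferentiableAt (x := x t) (by simp)).hasMFDerivAt.comp t h
  have h2 : HasFDerivAt (F ∘ x) (L.comp ((1 : ℝ →L[ℝ] ℝ).smulRight (w : EucR n))) t :=
    hasMFDerivAt_iff_hasFDerivAt.1 h1
  exact h2.hasDerivAt.congr_deriv (congrArg L (one_smul ℝ (w : EucR n)))

namespace KeplerSystem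

section Embedded

variable {n m : ℕ} {M : Type*} [TopologicalSpace M] [ChartedSpace (EucR n) M]
  [IsManifold (𝓡 n) ∞ M] {V : Type*} [NormedAddCommGroup V] [NormedSpace ℝ V]

/-- The frequency as a function of the lift of the angle to the real line. -/
def liftedFreq (S : KeplerSystem n m M) (θ : ℝ) (x : M) : ℝ := S.freq θ x

/-- The linear form `v ↦ g(θ, x) v`. -/
def angleCLM (S : KeplerSystem n m M) (θ : ℝ) (x : M) : EucR m →L[ℝ] ℝ :=
  ∑ i, S.angleCoeff i θ x • EuclideanSpace.proj i

/-- The image of the linear map `v ↦ G(θ, x) v` by the derivative of `F` at `x`. -/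
def embeddedField (S : KeplerSystem n m M) (F : M → V) (θ : ℝ) (x : M) : EucR m →L[ℝ] V :=
  ∑ i, ContinuousLinearMap.smulRight (EuclideanSpace.proj i : EucR m →L[ℝ] ℝ)
    (mfderiv (𝓡 n) 𝓘(ℝ, V) F x (S.field i θ x) : V)

/-- The coefficients `c` are those of the Kepler system `S` seen through the map `F`. -/
structure _root_.OscillatingCoeffs.Represents {M : Type*} [MetricSpace M] [ChartedSpace (EucR n) M]
    [IsManifold (𝓡 n) ∞ M] {K : Set M} (c : OscillatingCoeffs m V K) (S : KeplerSystem n m M)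
    (F : M → V) : Prop where
  freq_eq : c.freq = S.liftedFreq
  angle_eq : c.angle = S.angleCLM
  field_eq : c.field = S.embeddedField F

variable (S : KeplerSystem n m M) {F : M → V}

lemma angleCLM_apply (θ : ℝ) (x : M) (v : EucR m) : S.angleCLM θ x v = S.angleControl θ x v := by
  simp [angleCLM, angleControl, mul_comm]

lemma embeddedField_apply (θ : ℝ) (x : M) (v : EucR m) :
    S.embeddedField F θ x v = mfderiv (𝓡 n) 𝓘(ℝ, V) F x (S.fieldControl θ x v) := by
  rw [fieldControl, map_sum, embeddedField, sum_apply]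
  refine Finset.sum_congr rfl fun i _ => ?_
  rw [map_smul]
  rfl

lemma coe_add_two_pi (θ : ℝ) : ((θ + 2 * π : ℝ) : Real.Angle) = θ := by simp

lemma contMDiff_angleCLM : ContMDiff (𝓘(ℝ, ℝ).prod (𝓡 n)) 𝓘(ℝ, EucR m →L[ℝ] ℝ) ∞
    (fun p : ℝ × M => S.angleCLM p.1 p.2) :=
  contMDiff_finsetSum fun i _ => (S.smooth_angleCoeff i).smul contMDiff_const

lemma contMDiff_embeddedField (hF : ContMDiff (𝓡 n) 𝓘(ℝ, V) ∞ F) :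
    ContMDiff (𝓘(ℝ, ℝ).prod (𝓡 n)) 𝓘(ℝ, EucR m →L[ℝ] V) ∞
      (fun p : ℝ × M => S.embeddedField F p.1 p.2) := by
  refine contMDiff_finsetSum fun i _ => ?_
  have h1 : ContMDiff (𝓘(ℝ, ℝ).prod (𝓡 n)) 𝓘(ℝ, V) ∞
      (fun p : ℝ × M => (mfderiv (𝓡 n) 𝓘(ℝ, V) F p.2 (S.field i p.1 p.2) : V)) :=
    (contMDiff_snd_tangentBundle_modelSpace V 𝓘(ℝ, V)).comp
      ((hF.contMDiff_tangentMap (m := ∞) (by simp)).comp (S.smooth_field i))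
  exact (ContinuousLinearMap.smulRightL ℝ (EucR m) V
    (EuclideanSpace.proj i : EucR m →L[ℝ] ℝ)).contMDiff.comp h1

end Embedded

section Coeffs

variable {n m : ℕ} {M : Type*} [MetricSpace M] [ChartedSpace (EucR n) M] [IsManifold (𝓡 n) ∞ M]
  {V : Type*} [NormedAddCommGroup V] [NormedSpace ℝ V]

/-- A locally Lipschitz function of an angle and of a point of a compact set is bounded and
Lipschitz. -/
lemma exists_dist_le_of_locallyLipschitz_of_periodic {W : Type*} [NormedAddCommGroup W]
    {K : Set M} (hK : IsCompact K) {h : ℝ → M → W}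
    (hh : LocallyLipschitz (fun p : ℝ × M => h p.1 p.2))
    (hper : ∀ x, Function.Periodic (fun θ => h θ x) (2 * π)) :
    ∃ C : ℝ, 0 ≤ C ∧ (∀ θ, ∀ x ∈ K, ‖h θ x‖ ≤ C) ∧ ∀ θ θ', ∀ x ∈ K, ∀ y ∈ K,
      dist (h θ x) (h θ' y) ≤ C * (dist θ θ' + dist x y) := by
  have hpi := Real.two_pi_pos
  have hc : IsCompact (Icc 0 (4 * π) ×ˢ K) := isCompact_Icc.prod hK
  obtain ⟨L, hL⟩ := (hh.locallyLipschitzOn (s := Icc 0 (4 * π) ×ˢ K))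
    |>.exists_lipschitzOnWith_of_compact hc
  obtain ⟨B, hB⟩ := hc.exists_bound_of_continuousOn hh.continuous.continuousOn
  have hB' : ∀ θ, ∀ x ∈ K, ‖h θ x‖ ≤ max B 0 := by
    intro θ x hx
    obtain ⟨θ', hθ', h1⟩ := (hper x).exists_mem_Ico₀ hpi θ
    rw [h1]
    exact (hB (θ', x) ⟨⟨hθ'.1, by linarith [hθ'.2]⟩, hx⟩).trans (le_max_left _ _)
  refine ⟨L + 2 * max B 0, by positivity, fun θ x hx => (hB' θ x hx).trans ?_, ?_⟩
  · have : 0 ≤ max B 0 := le_max_right _ _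
    have : (0 : ℝ) ≤ L := L.2
    linarith
  intro θ θ' x hx y hy
  wlog hθ : θ ≤ θ' generalizing θ θ' x y
  · rw [dist_comm, dist_comm θ, dist_comm x]
    exact this θ' θ y hy x hx (le_of_not_ge hθ)
  have hBn : 0 ≤ max B 0 := le_max_right _ _
  by_cases hd : θ' ≤ 2 * π + θ
  · obtain ⟨k, hk⟩ : ∃ k : ℤ, θ - k * (2 * π) ∈ Ico 0 (2 * π) :=
      ⟨toIcoDiv hpi 0 θ, by simpa using sub_toIcoDiv_zsmul_mem_Ico hpi 0 θ⟩
    have e1 : h (θ - k * (2 * π)) x = h θ x := (hper x).sub_int_mul_eq k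
    have e2 : h (θ' - k * (2 * π)) y = h θ' y := (hper y).sub_int_mul_eq k
    have h1 := hL.dist_le_mul (θ - k * (2 * π), x) ⟨⟨hk.1, by linarith [hk.2]⟩, hx⟩
      (θ' - k * (2 * π), y) ⟨⟨by linarith [hk.1], by linarith [hk.2]⟩, hy⟩
    simp only [e1, e2, Prod.dist_eq, dist_sub_right] at h1
    refine h1.trans ?_
    gcongr
    · linarith
    · exact max_le (le_add_of_nonneg_right dist_nonneg) (le_add_of_nonneg_left dist_nonneg)
  · have h1 : dist (h θ x) (h θ' y) ≤ 2 * max B 0 := by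
      rw [dist_eq_norm]
      exact (norm_sub_le _ _).trans (by linarith [hB' θ x hx, hB' θ' y hy])
    have h2 : 1 ≤ dist θ θ' + dist x y := by
      rw [dist_comm, Real.dist_eq, abs_of_nonneg (sub_nonneg.2 hθ)]
      have : 0 ≤ dist x y := dist_nonneg
      linarith [Real.two_le_pi]
    calc dist (h θ x) (h θ' y) ≤ 2 * max B 0 * 1 := by rw [mul_one]; exact h1
      _ ≤ _ := by
        gcongr
        exact le_add_of_nonneg_left L.2

variable [RiemannianBundle (fun x : M => TangentSpace (𝓡 n) x)]
  [IsContinuousRiemannianBundle (EucR n) (fun x : M => TangentSpace (𝓡 n) x)]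
  [IsRiemannianManifold (𝓡 n) M]

/-- The coefficients of a Kepler system on a compact set, seen through a smooth map `F`. -/
lemma exists_oscillatingCoeffs (S : KeplerSystem n m M) {K : Set M} (hK : IsCompact K) {F : M → V}
    (hF : ContMDiff (𝓡 n) 𝓘(ℝ, V) ∞ F) :
    ∃ c : OscillatingCoeffs m V K, c.Represents S F := by
  obtain ⟨k, hk0, hk⟩ := S.exists_lower_bound
  have p1 : ∀ x, Function.Periodic (fun θ : ℝ => S.liftedFreq θ x) (2 * π) := fun x θ => by
    simp only [liftedFreq, coe_add_two_pi]
  have p2 : ∀ x, Function.Periodic (fun θ : ℝ => S.angleCLM θ x) (2 * π) := fun x θ => by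
    simp only [angleCLM, coe_add_two_pi]
  have p3 : ∀ x, Function.Periodic (fun θ : ℝ => S.embeddedField F θ x) (2 * π) := fun x θ => by
    simp only [embeddedField, coe_add_two_pi]
  obtain ⟨C₁, h10, h11, h12⟩ := exists_dist_le_of_locallyLipschitz_of_periodic hK
    (h := S.liftedFreq) S.smooth_freq.locallyLipschitz_real_prod p1
  obtain ⟨C₂, h20, h21, h22⟩ := exists_dist_le_of_locallyLipschitz_of_periodic hK
    (h := S.angleCLM) S.contMDiff_angleCLM.locallyLipschitz_real_prod p2
  obtain ⟨C₃, h30, h31, h32⟩ := exists_dist_le_of_locallyLipschitz_of_periodic hK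
    (h := S.embeddedField F) (S.contMDiff_embeddedField hF).locallyLipschitz_real_prod p3
  have hd : ∀ (θ θ' : ℝ) (x y : M), 0 ≤ dist θ θ' + dist x y := fun _ _ _ _ => by positivity
  refine ⟨⟨S.liftedFreq, S.angleCLM, S.embeddedField F, p1, p3, k, C₁ + C₂ + C₃ + 1, hk0,
    by positivity, fun θ x _ => hk θ x, ?_, ?_, ?_, ?_, ?_, ?_⟩, ⟨rfl, rfl, rfl⟩⟩
  · exact fun θ x hx => ((Real.le_norm_self _).trans (h11 θ x hx)).trans (by linarith)
  · exact fun θ x hx => (h21 θ x hx).trans (by linarith)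
  · exact fun θ x hx => (h31 θ x hx).trans (by linarith)
  · exact fun θ θ' x hx y hy => (h12 θ θ' x hx y hy).trans
      (mul_le_mul_of_nonneg_right (by linarith) (hd _ _ _ _))
  · exact fun θ θ' x hx y hy => (h22 θ θ' x hx y hy).trans
      (mul_le_mul_of_nonneg_right (by linarith) (hd _ _ _ _))
  · exact fun θ θ' x hx y hy => (h32 θ θ' x hx y hy).trans
      (mul_le_mul_of_nonneg_right (by linarith) (hd _ _ _ _))

end Coeffs

section Correspondence

variable {n m : ℕ} {M : Type*} [MetricSpace M] [ChartedSpace (EucR n) M] [IsManifold (𝓡 n) ∞ M]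
  {V : Type*} [NormedAddCommGroup V] [NormedSpace ℝ V]
  {S : KeplerSystem n m M} {K : Set M} {F : M → V} {c : OscillatingCoeffs m V K}

/-- The derivative of the embedding maps the averaged velocities to those of the embedded system. -/
lemma mfderiv_averageVelocity [CompleteSpace V] (hc : c.Represents S F) {x : M}
    (hx : Function.Injective (mfderiv (𝓡 n) 𝓘(ℝ, V) F x)) (U : ℝ → EucR m) :
    mfderiv (𝓡 n) 𝓘(ℝ, V) F x (S.averageVelocity x U) = controlIntegral (c.kernel x) U := by
  let L : EucR n →L[ℝ] V := mfderiv (𝓡 n) 𝓘(ℝ, V) F x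
  obtain ⟨C, -, hC⟩ := (LinearMap.injective_iff_antilipschitz (L : EucR n →ₗ[ℝ] V)).1 hx
  have h1 : L (∫ θ in (0 : ℝ)..(2 * π),
      tangentToModel ((S.freq (θ : Real.Angle) x)⁻¹ • S.fieldControl (θ : Real.Angle) x (U θ))) =
      ∫ θ in (0 : ℝ)..(2 * π), (c.freq θ x)⁻¹ • c.field θ x (U θ) := by
    rw [intervalIntegral.integral_of_le Real.two_pi_pos.le,
      intervalIntegral.integral_of_le Real.two_pi_pos.le, ← L.integral_comp_comm' hC]
    refine integral_congr_ae (Eventually.of_forall fun θ => ?_)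
    beta_reduce
    rw [hc.freq_eq, hc.field_eq, embeddedField_apply]
    exact L.map_smul _ _
  have h2 : S.averageFreq x * (2 * π)⁻¹ = (c.period x)⁻¹ := by
    have hpi := Real.two_pi_pos.ne'
    rw [averageFreq, OscillatingCoeffs.period, hc.freq_eq, mul_inv, inv_inv, mul_comm (2 * π),
      mul_inv_cancel_right₀ hpi]
    rfl
  have h3 : controlIntegral (c.kernel x) U =
      (c.period x)⁻¹ • ∫ θ in (0 : ℝ)..(2 * π), (c.freq θ x)⁻¹ • c.field θ x (U θ) := by
    rw [controlIntegral, ← intervalIntegral.integral_smul]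
    rfl
  rw [h3, ← h1, ← h2, mul_smul]
  change L _ = _
  rw [averageVelocity]
  exact (L.map_smul _ _).trans (congrArg _ (L.map_smul _ _))

/-- The derivative of the embedding maps the velocity set of the average system into that of the
embedded one. -/
lemma mfderiv_mem_attainableSet [CompleteSpace V] (hc : c.Represents S F) {x : M}
    (hx : Function.Injective (mfderiv (𝓡 n) 𝓘(ℝ, V) F x)) {w : TangentSpace (𝓡 n) x}
    (hw : w ∈ S.averageSet x) :
    mfderiv (𝓡 n) 𝓘(ℝ, V) F x w ∈ attainableSet (c.kernel x) := by
  obtain ⟨U, hU, rfl⟩ := hw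
  exact ⟨U, hU, mfderiv_averageVelocity hc hx U⟩

/-- A solution of the control system becomes, through the map `F`, a solution of the embedded
system. -/
lemma IsSolution.isEmbeddedSolution (hF : ContMDiff (𝓡 n) 𝓘(ℝ, V) ∞ F) {C : NNReal}
    (hFC : LipschitzWith C F) (hc : c.Represents S F) {ε T : ℝ}
    {u : ℝ → EucR m} {θ : ℝ → Real.Angle} {x : ℝ → M} (h : S.IsSolution ε T u θ x)
    (hxK : ∀ t ∈ Icc 0 T, x t ∈ K) (hu : ∀ᵐ t ∂(volume.restrict (Icc 0 T)), ‖u t‖ ≤ 1)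
    {Θ : ℝ → ℝ} (hΘ : ∀ t ∈ Icc 0 T, (Θ t : Real.Angle) = θ t)
    (hΘac : AbsolutelyContinuousOnInterval Θ 0 T)
    (hΘd : ∀ᵐ t ∂(volume.restrict (Icc 0 T)),
      HasDerivAt Θ (S.freq (θ t) (x t) + S.angleControl (θ t) (x t) (ε • u t)) t) :
    c.IsEmbeddedSolution F ε T u Θ x := by
  refine ⟨hxK, h.1.of_dist_le fun s _ t _ => hFC.dist_le_mul _ _, hΘac, ?_, ?_, hu⟩
  · filter_upwards [h.2.1, ae_restrict_mem measurableSet_Icc] with t ht htI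
    have h1 := hasDerivAt_comp_of_hasMFDerivAt hF ht
    rw [← hΘ t htI, ← embeddedField_apply, map_smul] at h1
    rw [hc.field_eq]
    exact h1
  · filter_upwards [hΘd, ae_restrict_mem measurableSet_Icc] with t ht htI
    rw [← hΘ t htI, ← angleCLM_apply, map_smul, smul_eq_mul] at ht
    rw [hc.freq_eq, hc.angle_eq]
    exact ht

end Correspondence

end KeplerSystem

/-! ### Compactness of the solutions and their limits -/

namespace KeplerSystem

variable {n m : ℕ} {M : Type*} [MetricSpace M] [ChartedSpace (EucR n) M] [IsManifold (𝓡 n) ∞ M]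
  [RiemannianBundle (fun x : M => TangentSpace (𝓡 n) x)]
  [IsContinuousRiemannianBundle (EucR n) (fun x : M => TangentSpace (𝓡 n) x)]
  [IsRiemannianManifold (𝓡 n) M] {S : KeplerSystem n m M}

lemma dist_le_limit_of_isEmbeddedSolution {V : Type*} [NormedAddCommGroup V] [NormedSpace ℝ V]
    {K : Set M} {F : M → V} {c : OscillatingCoeffs m V K} {C : ℝ} (hC0 : 0 ≤ C)
    (hC : ∀ x ∈ K, ∀ y ∈ K, dist x y ≤ C * dist (F x) (F y)) {T ε : ℝ} (hε : 0 < ε)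
    {u : ℝ → EucR m} {Θ : ℝ → ℝ} {z : ℝ → M} (h : c.IsEmbeddedSolution F ε (T / ε) u Θ z)
    {s t : ℝ} (hs : s ∈ Icc 0 T) (ht : t ∈ Icc 0 T) :
    dist (z (s / ε)) (z (t / ε)) ≤ C * c.bound * dist s t := by
  refine (hC _ (h.mem _ (OscillatingCoeffs.div_mem_Icc hε hs)) _
    (h.mem _ (OscillatingCoeffs.div_mem_Icc hε ht))).trans ?_
  rw [mul_assoc]
  gcongr
  exact h.dist_embed_rescale_le hε hs ht

/-- A sequence of solutions with values in a compact set, on intervals of length `T / ε`, has after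
rescaling a uniformly convergent subsequence, and its limits solve the average inclusion. -/
theorem exists_subseq_and_isAverageSolution {K : Set M} (hK : IsCompact K) {T : ℝ} (hT : 0 < T)
    {ε : ℕ → ℝ} (hε : ∀ k, 0 < ε k) (hε0 : Tendsto ε atTop (𝓝 0)) {u : ℕ → ℝ → EucR m}
    {θ : ℕ → ℝ → Real.Angle} {x : ℕ → ℝ → M}
    (h : ∀ k, IsUnitControlOn (u k) (Icc 0 (T / ε k)) ∧
        S.IsSolution (ε k) (T / ε k) (u k) (θ k) (x k) ∧ ∀ t ∈ Icc 0 (T / ε k), x k t ∈ K) :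
    (∃ ψ : ℕ → ℕ, StrictMono ψ ∧ ∃ y : ℝ → M,
      TendstoUniformlyOn (fun k τ => x (ψ k) (τ / ε (ψ k))) y atTop (Icc 0 T)) ∧
    ∀ y : ℝ → M, TendstoUniformlyOn (fun k τ => x k (τ / ε k)) y atTop (Icc 0 T) →
      S.IsAverageSolution T y := by
  obtain ⟨ι, ⟨f⟩⟩ := exists_finite_smoothBumpCovering (𝓡 n) hK
  set F := f.chartEmbedding with hF
  have hFs := f.contMDiff_chartEmbedding
  obtain ⟨A, hA⟩ := f.exists_lipschitzWith_chartEmbedding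
  obtain ⟨C, hC0, hC⟩ := f.exists_dist_le_chartEmbedding hK
  obtain ⟨c, hc⟩ := S.exists_oscillatingCoeffs hK hFs
  have hsol : ∀ k, ∃ Θ : ℝ → ℝ, c.IsEmbeddedSolution F (ε k) (T / ε k) (u k) Θ (x k) := fun k => by
    obtain ⟨Θ, h1, h2, h3⟩ := (h k).2.1.2.2
    exact ⟨Θ, (h k).2.1.isEmbeddedSolution hFs hA hc (h k).2.2 (h k).1.2 h1 h2 h3⟩
  choose Θ hΘ using hsol
  refine ⟨exists_subseq_tendstoUniformlyOn hK (C := C * c.bound) hT.le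
    (f := fun k τ => x k (τ / ε k))
    (fun k t ht => (hΘ k).mem _ (OscillatingCoeffs.div_mem_Icc (hε k) ht))
    fun k s hs t ht => dist_le_limit_of_isEmbeddedSolution hC0.le hC (hε k) (hΘ k) hs ht, ?_⟩
  intro y hy
  have hyK : ∀ τ ∈ Icc 0 T, y τ ∈ K := fun τ hτ => hK.isClosed.mem_of_tendsto (hy.tendsto_at hτ)
    (Eventually.of_forall fun k => (hΘ k).mem _ (OscillatingCoeffs.div_mem_Icc (hε k) hτ))
  have hlip : LipschitzOnWith (C * c.bound).toNNReal y (Icc 0 T) :=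
    LipschitzOnWith.of_dist_le_mul fun s hs t ht => by
      rw [Real.coe_toNNReal _ (mul_pos hC0 c.bound_pos).le]
      exact le_of_tendsto' ((hy.tendsto_at hs).dist (hy.tendsto_at ht))
        fun k => dist_le_limit_of_isEmbeddedSolution hC0.le hC (hε k) (hΘ k) hs ht
  refine ⟨LipschitzOnWith.absolutelyContinuousOnInterval (by rwa [uIcc_of_le hT.le]), ?_⟩
  have hdiff : ∀ᵐ t, t ∈ Icc 0 T → DifferentiableWithinAt ℝ (F ∘ y) (Icc 0 T) t :=
    (hA.comp_lipschitzOnWith hlip).ae_differentiableWithinAt_of_mem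
  rw [ae_restrict_iff' measurableSet_Icc]
  filter_upwards [hdiff, compl_mem_ae_iff.2 (measure_singleton (0 : ℝ)),
    compl_mem_ae_iff.2 (measure_singleton T)] with t ht ht0 htT htI
  have htI' : t ∈ Ioo 0 T := ⟨lt_of_le_of_ne htI.1 (Ne.symm ht0), lt_of_le_of_ne htI.2 htT⟩
  have hnhds : Icc 0 T ∈ 𝓝 t := Icc_mem_nhds htI'.1 htI'.2
  have hd : DifferentiableAt ℝ (F ∘ y) t := (ht htI).differentiableAt hnhds
  obtain ⟨U, hU, hDU⟩ := OscillatingCoeffs.mem_attainableSet_of_hasDerivAt_limit hK.isClosed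
    hA.continuous hC hε hε0 hΘ hy htI' hd.hasDerivAt
  have hinj := f.mfderiv_chartEmbedding_injective (hyK t htI)
  refine ⟨S.averageVelocity (y t) U, ⟨U, hU, rfl⟩, ?_⟩
  have hyd : MDifferentiableAt 𝓘(ℝ, ℝ) (𝓡 n) y t :=
    f.mdifferentiableAt_of_chartEmbedding (hyK t htI)
      (hlip.continuousOn.continuousAt hnhds) hd
  -- the velocity of `y` is determined by that of its image by the embedding
  let D : ℝ →L[ℝ] EucR n := mfderiv 𝓘(ℝ, ℝ) (𝓡 n) y t
  let w : TangentSpace (𝓡 n) (y t) := D 1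
  have hyw : mfderiv 𝓘(ℝ, ℝ) (𝓡 n) y t = (1 : ℝ →L[ℝ] ℝ).smulRight w := by
    refine ContinuousLinearMap.ext fun (r : ℝ) => ?_
    change D r = r • D 1
    rw [← map_smul, smul_eq_mul, mul_one]
  have hym := hyd.hasMFDerivAt
  rw [hyw] at hym
  have hw : w = S.averageVelocity (y t) U := by
    refine hinj ?_
    rw [mfderiv_averageVelocity hc hinj, ← hDU]
    exact ((hasDerivAt_comp_of_hasMFDerivAt hFs hym).deriv).symm
  rwa [hw] at hym

end KeplerSystem

/-! ### Uniqueness of the solutions -/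

lemma AbsolutelyContinuousOnInterval.continuousOn_metric {X : Type*} [PseudoMetricSpace X]
    {f : ℝ → X} {a b : ℝ} (h : AbsolutelyContinuousOnInterval f a b) :
    ContinuousOn f (uIcc a b) := by
  intro s hs
  have h1 : AbsolutelyContinuousOnInterval (fun t => dist (f t) (f s)) a b :=
    h.of_dist_le (C := 1) fun r _ t _ => by
      rw [one_mul]
      exact dist_dist_dist_le_left _ _ _
  have h2 := h1.continuousOn s hs
  rw [ContinuousWithinAt, dist_self] at h2
  exact tendsto_iff_dist_tendsto_zero.2 h2

lemma norm_smul_clm_apply_sub_le {E W : Type*} [NormedAddCommGroup E] [NormedSpace ℝ E]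
    [NormedAddCommGroup W] [NormedSpace ℝ W] {P Q : E →L[ℝ] W} {ε r : ℝ} (hε : 0 < ε) {v : E}
    (hv : ‖v‖ ≤ 1) (h : dist P Q ≤ r) : ‖ε • P v - ε • Q v‖ ≤ ε * r := by
  rw [← smul_sub, norm_smul, Real.norm_of_nonneg hε.le, ← sub_apply]
  gcongr
  rw [dist_eq_norm] at h
  calc ‖(P - Q) v‖ ≤ ‖P - Q‖ * ‖v‖ := ContinuousLinearMap.le_opNorm _ _
    _ ≤ r * 1 := mul_le_mul h hv (norm_nonneg _) ((norm_nonneg _).trans h)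
    _ = r := mul_one r

lemma OscillatingCoeffs.IsEmbeddedSolution.eq {m : ℕ} {V : Type*} [NormedAddCommGroup V]
    [NormedSpace ℝ V] {M : Type*} [MetricSpace M] {K : Set M} {c : OscillatingCoeffs m V K}
    {F : M → V} {C : ℝ} (hC0 : 0 ≤ C) (hC : ∀ x ∈ K, ∀ y ∈ K, dist x y ≤ C * dist (F x) (F y))
    {ε S : ℝ} (hε : 0 < ε) (hS : 0 ≤ S) {u : ℝ → EucR m} {Θ Θ' : ℝ → ℝ} {x x' : ℝ → M}
    (h : c.IsEmbeddedSolution F ε S u Θ x) (h' : c.IsEmbeddedSolution F ε S u Θ' x')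
    (hΘ : Θ 0 = Θ' 0) (hx : x 0 = x' 0) : ∀ t ∈ Icc 0 S, Θ t = Θ' t ∧ x t = x' t := by
  have hb := c.bound_pos
  let Z : ℝ → V × ℝ := fun t => (F (x t) - F (x' t), Θ t - Θ' t)
  have hac : AbsolutelyContinuousOnInterval Z 0 S := by
    have h1 : AbsolutelyContinuousOnInterval
        (fun t => ((F (x t) - F (x' t), 0) : V × ℝ)) 0 S :=
      (h.ac_embed.sub h'.ac_embed).of_dist_le (C := 1) fun s _ t _ => by
        rw [one_mul, dist_prod_same_right]
        exact le_rfl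
    have h2 : AbsolutelyContinuousOnInterval (fun t => ((0, Θ t - Θ' t) : V × ℝ)) 0 S :=
      (h.ac_angle.sub h'.ac_angle).of_dist_le (C := 1) fun s _ t _ => by
        rw [one_mul, dist_prod_same_left]
        exact le_rfl
    have h3 := h1.add h2
    convert! h3 using 1
    ext t <;> simp [Z]
  have hZ := hac.eq_zero_of_norm_deriv_le (C := ε * c.bound * (1 + C) + c.bound * (1 + C) +
      ε * c.bound * (1 + C))
    (X' := fun t => (ε • c.field (Θ t) (x t) (u t) - ε • c.field (Θ' t) (x' t) (u t),
      (c.freq (Θ t) (x t) + ε * c.angle (Θ t) (x t) (u t)) -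
        (c.freq (Θ' t) (x' t) + ε * c.angle (Θ' t) (x' t) (u t)))) hS (by simp [Z, hΘ, hx]) ?_
  · intro t ht
    have h1 := hZ t ht
    simp only [Z, Prod.mk_eq_zero, sub_eq_zero] at h1
    refine ⟨h1.2, dist_le_zero.1 ?_⟩
    have h2 := hC _ (h.mem t ht) _ (h'.mem t ht)
    rwa [h1.1, dist_self, mul_zero] at h2
  filter_upwards [h.hasDerivAt_embed, h'.hasDerivAt_embed, h.hasDerivAt_angle,
    h'.hasDerivAt_angle, h.norm_le, ae_restrict_mem measurableSet_Icc] with t h1 h2 h3 h4 hu ht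
  refine ⟨(h1.sub h2).prodMk (h3.sub h4), ?_⟩
  have hxt := h.mem t ht
  have hxt' := h'.mem t ht
  have hd : dist (Θ t) (Θ' t) + dist (x t) (x' t) ≤ (1 + C) * ‖Z t‖ := by
    have e1 : dist (Θ t) (Θ' t) ≤ ‖Z t‖ := by
      rw [Real.dist_eq]
      exact norm_snd_le (Z t)
    have e2 : dist (F (x t)) (F (x' t)) ≤ ‖Z t‖ := by
      rw [dist_eq_norm]
      exact norm_fst_le (Z t)
    have e3 : dist (x t) (x' t) ≤ C * ‖Z t‖ := (hC _ hxt _ hxt').trans (by gcongr)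
    linarith
  have hn := norm_nonneg (Z t)
  have hC1 : 0 ≤ c.bound * (1 + C) * ‖Z t‖ := by positivity
  have hC2 : 0 ≤ ε * c.bound * (1 + C) * ‖Z t‖ := by positivity
  have hle := mul_le_mul_of_nonneg_left (mul_le_mul_of_nonneg_left hd hb.le) hε.le
  refine norm_prod_le_iff.2 ⟨?_, ?_⟩
  · have e1 := norm_smul_clm_apply_sub_le hε hu (c.dist_field_le (Θ t) (Θ' t) _ hxt _ hxt')
    exact e1.trans (by linarith)
  · have e1 := norm_smul_clm_apply_sub_le hε hu (c.dist_angle_le (Θ t) (Θ' t) _ hxt _ hxt')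
    have e2 := (c.dist_freq_le (Θ t) (Θ' t) _ hxt _ hxt').trans
      (mul_le_mul_of_nonneg_left hd hb.le)
    rw [dist_eq_norm] at e2
    rw [add_sub_add_comm]
    refine (norm_add_le _ _).trans ?_
    simp only [smul_eq_mul] at e1
    linarith

namespace KeplerSystem

variable {n m : ℕ} {M : Type*} [MetricSpace M] [ChartedSpace (EucR n) M] [IsManifold (𝓡 n) ∞ M]
  {S : KeplerSystem n m M}

lemma IsSolution.mono {ε T T' : ℝ} {u : ℝ → EucR m} {θ : ℝ → Real.Angle} {x : ℝ → M}
    (h : S.IsSolution ε T u θ x) (hT' : 0 ≤ T') (hTT' : T' ≤ T) : S.IsSolution ε T' u θ x := by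
  have hsub : Icc 0 T' ⊆ Icc 0 T := Icc_subset_Icc_right hTT'
  have hsub' : uIcc 0 T' ⊆ uIcc 0 T := by
    rwa [uIcc_of_le hT', uIcc_of_le (hT'.trans hTT')]
  obtain ⟨h1, h2, Θ, h3, h4, h5⟩ := h
  exact ⟨h1.mono hsub', ae_restrict_of_ae_restrict_of_subset hsub h2, Θ,
    fun t ht => h3 t (hsub ht), h4.mono hsub', ae_restrict_of_ae_restrict_of_subset hsub h5⟩

lemma IsSolution.continuousOn {ε T : ℝ} (hT : 0 ≤ T) {u : ℝ → EucR m} {θ : ℝ → Real.Angle}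
    {x : ℝ → M} (h : S.IsSolution ε T u θ x) : ContinuousOn x (Icc 0 T) := by
  obtain ⟨h1, -⟩ := h
  have h2 := h1.continuousOn_metric
  rwa [uIcc_of_le hT] at h2

variable [RiemannianBundle (fun x : M => TangentSpace (𝓡 n) x)]
  [IsContinuousRiemannianBundle (EucR n) (fun x : M => TangentSpace (𝓡 n) x)]
  [IsRiemannianManifold (𝓡 n) M]

/-- Two solutions with the same control and the same initial condition coincide. -/
theorem IsSolution.eq {ε T : ℝ} (hε : 0 < ε) (hT : 0 ≤ T) {u : ℝ → EucR m} (hu : ∀ t, ‖u t‖ ≤ 1)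
    {θ θ' : ℝ → Real.Angle} {x x' : ℝ → M} (h : S.IsSolution ε T u θ x)
    (h' : S.IsSolution ε T u θ' x') (hθ : θ 0 = θ' 0) (hx : x 0 = x' 0) :
    ∀ t ∈ Icc 0 T, θ t = θ' t ∧ x t = x' t := by
  have h0 : (0 : ℝ) ∈ Icc 0 T := ⟨le_rfl, hT⟩
  have hcont := h.continuousOn hT
  have hcont' := h'.continuousOn hT
  have hK := (isCompact_Icc.image_of_continuousOn hcont).union
    (isCompact_Icc.image_of_continuousOn hcont')
  obtain ⟨ι, ⟨f⟩⟩ := exists_finite_smoothBumpCovering (𝓡 n) hK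
  have hFs := f.contMDiff_chartEmbedding
  obtain ⟨A, hA⟩ := f.exists_lipschitzWith_chartEmbedding
  obtain ⟨C, hC0, hC⟩ := f.exists_dist_le_chartEmbedding hK
  obtain ⟨c, hc⟩ := S.exists_oscillatingCoeffs hK hFs
  obtain ⟨Θ, h1, h2, h3⟩ := h.2.2
  obtain ⟨Θ', h1', h2', h3'⟩ := h'.2.2
  -- the lifts of the angle may differ by a multiple of `2 π`
  obtain ⟨k, hk⟩ : ∃ k : ℤ, Θ 0 - Θ' 0 = 2 * π * k := by
    rw [← Real.Angle.angle_eq_iff_two_pi_dvd_sub, h1 0 h0, h1' 0 h0, hθ]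
  have e := h.isEmbeddedSolution hFs hA hc (fun t ht => Or.inl (mem_image_of_mem _ ht))
    (Eventually.of_forall hu) h1 h2 h3
  have e' := h'.isEmbeddedSolution hFs hA hc (Θ := fun t => Θ' t + 2 * π * k)
    (fun t ht => Or.inr (mem_image_of_mem _ ht)) (Eventually.of_forall hu) ?_
    (h2'.of_dist_le (C := 1) fun s _ t _ => by rw [dist_add_right, one_mul])
    (h3'.mono fun t ht => ht.add_const _)
  · intro t ht
    obtain ⟨e1, e2⟩ := e.eq hC0.le hC hε hT e' (by linarith) hx t ht
    refine ⟨?_, e2⟩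
    rw [← h1 t ht, ← h1' t ht, Real.Angle.angle_eq_iff_two_pi_dvd_sub]
    exact ⟨k, by linarith⟩
  · intro t ht
    rw [← h1' t ht, Real.Angle.angle_eq_iff_two_pi_dvd_sub]
    exact ⟨k, by ring⟩

end KeplerSystem

/-! ### Existence of the tracking solutions -/

/-- A curve that stays in the open set `O` as long as it has not left the closed set `N`, which
contains `O`, never leaves `O`. -/
lemma forall_mem_of_isOpen_of_isClosed {X : Type*} [TopologicalSpace X] {γ : ℝ → X}
    (hγ : Continuous γ) {N O : Set X} (hN : IsClosed N) (hO : IsOpen O) (hON : O ⊆ N) {S : ℝ}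
    (h0 : γ 0 ∈ O) (h : ∀ t ∈ Icc 0 S, (∀ r ∈ Icc 0 t, γ r ∈ N) → γ t ∈ O) :
    ∀ t ∈ Icc 0 S, γ t ∈ O := by
  by_contra! hne
  have hB : IsCompact (Icc 0 S ∩ γ ⁻¹' Oᶜ) :=
    isCompact_Icc.inter_right (hO.isClosed_compl.preimage hγ)
  obtain ⟨t, ⟨ht, htO⟩, hmin⟩ := hB.exists_isLeast (by
    obtain ⟨t, ht, htO⟩ := hne
    exact ⟨t, ht, htO⟩)
  refine htO (h t ht ?_)
  have ht0 : (0 : ℝ) ≠ t := by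
    rintro rfl
    exact htO h0
  have hsub : Ico 0 t ⊆ γ ⁻¹' N := fun r hr => hON (by
    by_contra hr'
    exact absurd (hmin ⟨⟨hr.1, hr.2.le.trans ht.2⟩, hr'⟩) (not_le.2 hr.2))
  have := closure_minimal hsub (hN.preimage hγ)
  rwa [closure_Ico ht0] at this

namespace KeplerSystem

section ClosedLoop

variable {n m : ℕ} {M : Type*} [TopologicalSpace M] [ChartedSpace (EucR n) M]
  [IsManifold (𝓡 n) ∞ M]

/-- The vector field on `ℝ × M` whose integral curves are the solutions for the control
`ε U(θ)`. -/
def closedLoopField (S : KeplerSystem n m M) (ε : ℝ) (U : ℝ → EucR m) (p : ℝ × M) :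
    TangentSpace (𝓘(ℝ, ℝ).prod (𝓡 n)) p :=
  ((S.freq p.1 p.2 + S.angleControl p.1 p.2 (ε • U p.1),
    S.fieldControl p.1 p.2 (ε • U p.1)) : ℝ × EucR n)

variable {S : KeplerSystem n m M}

lemma contMDiff_closedLoopField {ε : ℝ} {U : ℝ → EucR m} (hU : ContDiff ℝ ∞ U) :
    ContMDiff (𝓘(ℝ, ℝ).prod (𝓡 n)) (𝓘(ℝ, ℝ).prod (𝓡 n)).tangent ∞ (fun p : ℝ × M =>
      (⟨p, S.closedLoopField ε U p⟩ : TangentBundle (𝓘(ℝ, ℝ).prod (𝓡 n)) (ℝ × M))) := by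
  have hunit : ContMDiff (𝓘(ℝ, ℝ).prod (𝓡 n)) (𝓘(ℝ, ℝ).prod (𝓡 n)).tangent ∞ (fun p : ℝ × M =>
      (⟨p, ((1, 0) : ℝ × EucR n)⟩ : TangentBundle (𝓘(ℝ, ℝ).prod (𝓡 n)) (ℝ × M))) := by
    have h1 : ContMDiff 𝓘(ℝ, ℝ) 𝓘(ℝ, ℝ).tangent ∞
        (fun θ : ℝ => (⟨θ, (1 : ℝ)⟩ : TangentBundle 𝓘(ℝ, ℝ) ℝ)) :=
      contMDiff_vectorSpace_iff_contDiff.2 contDiff_const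
    have h2 : ContMDiff (𝓡 n) (𝓡 n).tangent ∞
        (fun x : M => (⟨x, 0⟩ : TangentBundle (𝓡 n) M)) :=
      contMDiff_zeroSection ℝ (TangentSpace (𝓡 n) : M → Type _)
    exact contMDiff_equivTangentBundleProd_symm.comp
      ((h1.comp contMDiff_fst).prodMk (h2.comp contMDiff_snd))
  have hfield : ∀ i, ContMDiff (𝓘(ℝ, ℝ).prod (𝓡 n)) (𝓘(ℝ, ℝ).prod (𝓡 n)).tangent ∞
      (fun p : ℝ × M => (⟨p, ((0, S.field i p.1 p.2) : ℝ × EucR n)⟩ :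
        TangentBundle (𝓘(ℝ, ℝ).prod (𝓡 n)) (ℝ × M))) := by
    intro i
    have h1 : ContMDiff 𝓘(ℝ, ℝ) 𝓘(ℝ, ℝ).tangent ∞
        (fun θ : ℝ => (⟨θ, (0 : ℝ)⟩ : TangentBundle 𝓘(ℝ, ℝ) ℝ)) :=
      contMDiff_vectorSpace_iff_contDiff.2 contDiff_const
    exact contMDiff_equivTangentBundleProd_symm.comp
      ((h1.comp contMDiff_fst).prodMk (S.smooth_field i))
  have hUi : ∀ i, ContMDiff (𝓘(ℝ, ℝ).prod (𝓡 n)) 𝓘(ℝ, ℝ) ∞ (fun p : ℝ × M => ε * U p.1 i) :=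
    fun i => (contDiff_const.mul ((contDiff_euclidean.1 hU) i)).contMDiff.comp contMDiff_fst
  have hspeed : ContMDiff (𝓘(ℝ, ℝ).prod (𝓡 n)) 𝓘(ℝ, ℝ) ∞ (fun p : ℝ × M =>
      S.freq p.1 p.2 + ∑ i, ε * U p.1 i * S.angleCoeff i p.1 p.2) :=
    S.smooth_freq.add (contMDiff_finsetSum fun i _ => (hUi i).mul (S.smooth_angleCoeff i))
  have h := (ContMDiff.smul_section hspeed hunit).add_section
    (ContMDiff.sum_section (s := Finset.univ)
      fun i _ => ContMDiff.smul_section (hUi i) (hfield i))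
  convert! h using 2 with p
  congr 1
  change ((S.freq p.1 p.2 + S.angleControl p.1 p.2 (ε • U p.1),
      S.fieldControl p.1 p.2 (ε • U p.1)) : ℝ × EucR n) =
    (S.freq p.1 p.2 + ∑ i, ε * U p.1 i * S.angleCoeff i p.1 p.2) • ((1, 0) : ℝ × EucR n) +
    ∑ i, (ε * U p.1 i) • ((0, S.field i p.1 p.2) : ℝ × EucR n)
  rw [Prod.ext_iff]
  constructor
  · simp [angleControl, Prod.fst_sum]
  · rw [Prod.snd_add, Prod.snd_sum]
    simp only [fieldControl, PiLp.smul_apply, smul_eq_mul, Prod.smul_mk, smul_zero, zero_add]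
    rfl

/-- The equations satisfied by the components of an integral curve. -/
lemma hasMFDerivAt_of_closedLoopField {ε : ℝ} {U : ℝ → EucR m} {γ : ℝ → ℝ × M} {t : ℝ}
    (h : HasMFDerivAt 𝓘(ℝ, ℝ) (𝓘(ℝ, ℝ).prod (𝓡 n)) γ t
      ((1 : ℝ →L[ℝ] ℝ).smulRight (S.closedLoopField ε U (γ t)))) :
    HasMFDerivAt 𝓘(ℝ, ℝ) (𝓡 n) (fun s => (γ s).2) t ((1 : ℝ →L[ℝ] ℝ).smulRight
      (S.fieldControl (γ t).1 (γ t).2 (ε • U (γ t).1))) ∧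
    HasDerivAt (fun s => (γ s).1)
      (S.freq (γ t).1 (γ t).2 + S.angleControl (γ t).1 (γ t).2 (ε • U (γ t).1)) t := by
  constructor
  · exact (hasMFDerivAt_snd (γ t)).comp t h
  · have h1 := (hasMFDerivAt_fst (γ t)).comp t h
    have h2 : HasFDerivAt (fun s => (γ s).1) ((1 : ℝ →L[ℝ] ℝ).smulRight
      (S.freq (γ t).1 (γ t).2 + S.angleControl (γ t).1 (γ t).2 (ε • U (γ t).1))) t :=
      hasMFDerivAt_iff_hasFDerivAt.1 h1
    exact h2.hasDerivAt.congr_deriv (one_smul ℝ _)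

end ClosedLoop

section Tracking

variable {n m : ℕ} {M : Type*} [MetricSpace M] [ChartedSpace (EucR n) M] [IsManifold (𝓡 n) ∞ M]
  {V : Type*} [NormedAddCommGroup V] [NormedSpace ℝ V]
  {S : KeplerSystem n m M} {K : Set M} {F : M → V} {c : OscillatingCoeffs m V K}

/-- A solution of the average inclusion on `[0, T]`, stopped at the time `T`, solves it for all
positive times, since `0` is an admissible velocity. -/
lemma IsAverageSolution.isEmbeddedAverageSolution [CompleteSpace V]
    (hF : ContMDiff (𝓡 n) 𝓘(ℝ, V) ∞ F) {A : NNReal} (hA : LipschitzWith A F)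
    (hinj : ∀ x ∈ K, Function.Injective (mfderiv (𝓡 n) 𝓘(ℝ, V) F x)) (hc : c.Represents S F)
    {T : ℝ} (hT : 0 ≤ T) {x₀ : ℝ → M} (h : S.IsAverageSolution T x₀)
    (hK : ∀ t ∈ Icc 0 T, x₀ t ∈ K) :
    c.IsEmbeddedAverageSolution F (fun t => x₀ (projIcc 0 T hT t)) := by
  obtain ⟨hac, hd⟩ := h
  have hFd : ∀ᵐ t ∂(volume.restrict (Icc 0 T)), ∃ w ∈ attainableSet (c.kernel (x₀ t)),
      HasDerivAt (F ∘ x₀) w t := by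
    filter_upwards [hd, ae_restrict_mem measurableSet_Icc] with t ht htI
    obtain ⟨w, hw, hw'⟩ := ht
    exact ⟨_, mfderiv_mem_attainableSet hc (hinj _ (hK t htI)) hw,
      hasDerivAt_comp_of_hasMFDerivAt hF hw'⟩
  have hFac : AbsolutelyContinuousOnInterval (F ∘ x₀) 0 T :=
    hac.of_dist_le fun s _ t _ => hA.dist_le_mul _ _
  have hlip : ∀ s ∈ Icc 0 T, ∀ t ∈ Icc 0 T, dist (F (x₀ s)) (F (x₀ t)) ≤
      2 * π * (c.bound * c.lower⁻¹ * c.bound) * dist s t := fun s hs t ht =>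
    hFac.dist_le_of_norm_deriv_le (X' := deriv (F ∘ x₀)) (by
      filter_upwards [hFd, ae_restrict_mem measurableSet_Icc] with r hr hrI
      obtain ⟨w, hw, hw'⟩ := hr
      rw [hw'.deriv]
      exact ⟨hw', OscillatingCoeffs.norm_le_of_mem_attainableSet (hK r hrI) hw⟩) hs ht
  have hb := c.bound_pos
  have hl := c.lower_pos
  refine ⟨fun t _ => hK _ (projIcc 0 T hT t).2, fun R _ => ?_, ?_⟩
  · have h1 : LipschitzWith (2 * π * (c.bound * c.lower⁻¹ * c.bound)).toNNReal
        (F ∘ fun t => x₀ (projIcc 0 T hT t)) := LipschitzWith.of_dist_le_mul fun s t => by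
      rw [Real.coe_toNNReal _ (by positivity)]
      refine (hlip _ (projIcc 0 T hT s).2 _ (projIcc 0 T hT t).2).trans ?_
      gcongr
      have := (LipschitzWith.projIcc hT).dist_le_mul s t
      rwa [NNReal.coe_one, one_mul] at this
    exact h1.lipschitzOnWith.absolutelyContinuousOnInterval
  · rw [ae_restrict_iff' measurableSet_Icc] at hFd
    rw [ae_restrict_iff' measurableSet_Ici]
    filter_upwards [hFd, compl_mem_ae_iff.2 (measure_singleton (0 : ℝ)),
      compl_mem_ae_iff.2 (measure_singleton T)] with t ht ht0 htT htI
    rcases lt_or_gt_of_ne htT with hlt | hlt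
    · have htI' : t ∈ Icc 0 T := ⟨htI, hlt.le⟩
      obtain ⟨w, hw, hw'⟩ := ht htI'
      have heq : (F ∘ fun t => x₀ (projIcc 0 T hT t)) =ᶠ[𝓝 t] F ∘ x₀ := by
        filter_upwards [Icc_mem_nhds (lt_of_le_of_ne htI (Ne.symm ht0)) hlt] with s hs
        simp only [Function.comp_apply, projIcc_of_mem hT hs]
      refine ⟨w, ?_, hw'.congr_of_eventuallyEq heq⟩
      rwa [projIcc_of_mem hT htI']
    · have heq : (F ∘ fun t => x₀ (projIcc 0 T hT t)) =ᶠ[𝓝 t] fun _ => F (x₀ T) := by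
        filter_upwards [Ioi_mem_nhds hlt] with s hs
        simp only [Function.comp_apply, projIcc_of_right_le hT (le_of_lt hs)]
      exact ⟨0, zero_mem_attainableSet, (hasDerivAt_const t _).congr_of_eventuallyEq heq⟩

variable {ε R : ℝ} {U : ℝ → EucR m} {γ : ℝ → ℝ × M}

/-- The integral curves of the closed-loop field, seen through the map `F`. -/
lemma isClosedLoop_of_hasMFDerivAt (hF : ContMDiff (𝓡 n) 𝓘(ℝ, V) ∞ F) (hc : c.Represents S F)
    (hγK : ∀ t ∈ Icc 0 R, (γ t).2 ∈ K)
    (h : ∀ t ∈ Icc 0 R, HasMFDerivAt 𝓘(ℝ, ℝ) (𝓘(ℝ, ℝ).prod (𝓡 n)) γ t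
      ((1 : ℝ →L[ℝ] ℝ).smulRight (S.closedLoopField ε U (γ t)))) :
    c.IsClosedLoop F ε R U (fun t => (γ t).1) (fun t => (γ t).2) := by
  refine ⟨hγK, fun t ht => ?_, fun t ht => ?_⟩
  · have h1 := hasDerivAt_comp_of_hasMFDerivAt hF (hasMFDerivAt_of_closedLoopField (h t ht)).1
    rw [← embeddedField_apply, map_smul] at h1
    rw [hc.field_eq]
    exact h1
  · have h1 := (hasMFDerivAt_of_closedLoopField (h t ht)).2
    rw [← angleCLM_apply, map_smul, smul_eq_mul] at h1
    rw [hc.freq_eq, hc.angle_eq]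
    exact h1

/-- The closed-loop solutions solve the control system for the control `U(Θ(t))`. -/
lemma isSolution_of_hasMFDerivAt (hF : ContMDiff (𝓡 n) 𝓘(ℝ, V) ∞ F) (hc : c.Represents S F)
    {C : ℝ} (hC0 : 0 ≤ C) (hC : ∀ x ∈ K, ∀ y ∈ K, dist x y ≤ C * dist (F x) (F y))
    (hε : 0 < ε) (hR : 0 ≤ R) (hU : ∀ θ, ‖U θ‖ ≤ 1) (hγK : ∀ t ∈ Icc 0 R, (γ t).2 ∈ K)
    (h : ∀ t ∈ Icc 0 R, HasMFDerivAt 𝓘(ℝ, ℝ) (𝓘(ℝ, ℝ).prod (𝓡 n)) γ t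
      ((1 : ℝ →L[ℝ] ℝ).smulRight (S.closedLoopField ε U (γ t)))) :
    S.IsSolution ε R (fun t => U (γ t).1) (fun t => ((γ t).1 : Real.Angle))
      (fun t => (γ t).2) := by
  have hcl := isClosedLoop_of_hasMFDerivAt hF hc hγK h
  have hb := c.bound_pos
  have huI : uIcc 0 R = Icc 0 R := uIcc_of_le hR
  refine ⟨?_, ?_, fun t => (γ t).1, fun t _ => rfl, ?_, ?_⟩
  · refine (LipschitzOnWith.of_dist_le_mul (K := (C * (ε * c.bound)).toNNReal)
      fun s hs t ht => ?_).absolutelyContinuousOnInterval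
    rw [huI] at hs ht
    rw [Real.coe_toNNReal _ (by positivity), mul_assoc]
    refine (hC _ (hγK s hs) _ (hγK t ht)).trans ?_
    gcongr
    have h1 := Convex.norm_image_sub_le_of_norm_hasDerivWithin_le (C := ε * c.bound)
      (fun r hr => (hcl.hasDerivAt_embed r hr).hasDerivWithinAt) (fun r hr => by
        rw [norm_smul, Real.norm_of_nonneg hε.le]
        gcongr
        exact OscillatingCoeffs.norm_field_apply_le (hγK r hr) (hU _)) (convex_Icc 0 R) ht hs
    rw [dist_eq_norm, dist_eq_norm]
    exact h1
  · filter_upwards [ae_restrict_mem measurableSet_Icc] with t ht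
    exact (hasMFDerivAt_of_closedLoopField (h t ht)).1
  · refine (LipschitzOnWith.of_dist_le_mul (K := (c.bound + ε * c.bound).toNNReal)
      fun s hs t ht => ?_).absolutelyContinuousOnInterval
    rw [huI] at hs ht
    rw [Real.coe_toNNReal _ (by positivity), dist_eq_norm, dist_eq_norm]
    refine Convex.norm_image_sub_le_of_norm_hasDerivWithin_le
      (fun r hr => (hcl.hasDerivAt_angle r hr).hasDerivWithinAt) (fun r hr => ?_)
      (convex_Icc 0 R) ht hs
    refine (norm_add_le _ _).trans (add_le_add ?_ ?_)
    · rw [Real.norm_of_nonneg (OscillatingCoeffs.freq_pos (hγK r hr) _).le]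
      exact c.freq_le _ _ (hγK r hr)
    · rw [norm_mul, Real.norm_of_nonneg hε.le]
      gcongr
      exact OscillatingCoeffs.abs_angle_apply_le (hγK r hr) (hU _)
  · filter_upwards [ae_restrict_mem measurableSet_Icc] with t ht
    exact (hasMFDerivAt_of_closedLoopField (h t ht)).2

end Tracking

section Existence

variable {n m : ℕ} {M : Type*} [MetricSpace M] [ChartedSpace (EucR n) M] [IsManifold (𝓡 n) ∞ M]
  [RiemannianBundle (fun x : M => TangentSpace (𝓡 n) x)]
  [IsContinuousRiemannianBundle (EucR n) (fun x : M => TangentSpace (𝓡 n) x)]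
  [IsRiemannianManifold (𝓡 n) M] {S : KeplerSystem n m M}

lemma exists_angle_lift (θ : Real.Angle) : ∃ r ∈ Icc 0 (2 * π), (r : Real.Angle) = θ := by
  have h := θ.toReal_mem_Ioc
  rcases le_total 0 θ.toReal with h0 | h0
  · exact ⟨θ.toReal, ⟨h0, by linarith [h.2, Real.pi_pos]⟩, θ.coe_toReal⟩
  · refine ⟨θ.toReal + 2 * π, ⟨by linarith [h.1, Real.pi_pos], by linarith⟩, ?_⟩
    rw [coe_add_two_pi, θ.coe_toReal]

/-- The solutions of the average inclusion are tracked with an error of order `ε`. -/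
theorem IsAverageSolution.exists_isSolution_dist_le {T : ℝ} (hT : 0 < T) {x₀ : ℝ → M}
    (h : S.IsAverageSolution T x₀) (θ₀ : Real.Angle) :
    ∃ C : ℝ, 0 ≤ C ∧ ∃ ε₀ : ℝ, 0 < ε₀ ∧ ∀ ε, 0 < ε → ε < ε₀ →
      ∃ (u : ℝ → EucR m) (θ : ℝ → Real.Angle) (x : ℝ → M), Measurable u ∧ (∀ t, ‖u t‖ ≤ 1) ∧
        S.IsSolution ε (T / ε) u θ x ∧ θ 0 = θ₀ ∧ x 0 = x₀ 0 ∧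
        ∀ t ∈ Icc 0 (T / ε), dist (x t) (x₀ (ε * t)) ≤ C * ε := by
  have : LocallyCompactSpace M := Manifold.locallyCompact_of_finiteDimensional (𝓡 n)
  have hcont : ContinuousOn x₀ (Icc 0 T) := by
    obtain ⟨h1, -⟩ := h
    have h2 := h1.continuousOn_metric
    rwa [uIcc_of_le hT.le] at h2
  have hK₀ : IsCompact (x₀ '' Icc 0 T) := isCompact_Icc.image_of_continuousOn hcont
  -- a compact neighbourhood of the trajectory
  obtain ⟨K, hK, hK₀K⟩ := exists_compact_superset hK₀
  obtain ⟨δ, hδ, hδK⟩ := hK₀.exists_cthickening_subset_open isOpen_interior hK₀K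
  obtain ⟨ι, ⟨f⟩⟩ := exists_finite_smoothBumpCovering (𝓡 n) hK
  have hFs := f.contMDiff_chartEmbedding
  obtain ⟨A, hA⟩ := f.exists_lipschitzWith_chartEmbedding
  obtain ⟨C, hC0, hC⟩ := f.exists_dist_le_chartEmbedding hK
  obtain ⟨c, hc⟩ := S.exists_oscillatingCoeffs hK hFs
  have hxK : ∀ t ∈ Icc 0 T, x₀ t ∈ K := fun t ht =>
    interior_subset (hK₀K (mem_image_of_mem _ ht))
  have hav := h.isEmbeddedAverageSolution hFs hA
    (fun x hx => f.mfderiv_chartEmbedding_injective hx) hc hT.le hxK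
  obtain ⟨ϑ, hϑ, hϑθ⟩ := exists_angle_lift θ₀
  obtain ⟨C', hC'0, hC'⟩ := hav.exists_tracking_control hC0.le hC (T := T) hϑ
  have hb := c.bound_pos
  have hl := c.lower_pos
  refine ⟨C', hC'0, min 1 (min (c.lower / c.bound) (δ / (C' + 1))), by positivity,
    fun ε hε hεlt => ?_⟩
  have hε1 : ε ≤ 1 := hεlt.le.trans (min_le_left _ _)
  have hεb : ε * c.bound ≤ c.lower := by
    rw [← le_div_iff₀ hb]
    exact hεlt.le.trans ((min_le_right _ _).trans (min_le_left _ _))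
  have hεδ : C' * ε ≤ δ := by
    have h1 : ε ≤ δ / (C' + 1) := hεlt.le.trans ((min_le_right _ _).trans (min_le_right _ _))
    rw [le_div_iff₀ (by positivity)] at h1
    linarith
  obtain ⟨U, hUs, hU1, htrack⟩ := hC' ε hε hε1 hεb
  have hTε : 0 ≤ T / ε := div_nonneg hT.le hε.le
  -- a compact region that contains the solutions staying in `K`
  set b := ϑ + 2 * c.bound * (T / ε) with hbdef
  obtain ⟨χ, γ, hχ, hγ0, hγ⟩ := exists_isMIntegralCurve_smul_of_isCompact
    (S.contMDiff_closedLoopField (ε := ε) hUs) ((isCompact_Icc (a := ϑ - 1) (b := b + 1)).prod hK)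
    (ϑ, x₀ 0)
  have hγd : ∀ t, γ t ∈ Icc (ϑ - 1) (b + 1) ×ˢ K →
      HasMFDerivAt 𝓘(ℝ, ℝ) (𝓘(ℝ, ℝ).prod (𝓡 n)) γ t
        ((1 : ℝ →L[ℝ] ℝ).smulRight (S.closedLoopField ε U (γ t))) := by
    intro t ht
    have h1 := hγ t
    beta_reduce at h1
    rwa [hχ _ ht, one_smul] at h1
  have hγc : Continuous γ := continuous_iff_continuousAt.2 fun t => (hγ t).continuousAt
  have h0T : (0 : ℝ) ∈ Icc 0 T := ⟨le_rfl, hT.le⟩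
  have hest : ∀ R ∈ Icc 0 (T / ε), (∀ r ∈ Icc 0 R, γ r ∈ Icc (ϑ - 1) (b + 1) ×ˢ K) →
      γ R ∈ Ioo (ϑ - 1) (b + 1) ×ˢ interior K ∧ dist (γ R).2 (x₀ (ε * R)) ≤ C' * ε := by
    intro R hR hRN
    have hcl := isClosedLoop_of_hasMFDerivAt hFs hc (fun r hr => (hRN r hr).2)
      fun r hr => hγd r (hRN r hr)
    have hRR : R ∈ Icc 0 R := ⟨hR.1, le_rfl⟩
    have h0R : (0 : ℝ) ∈ Icc 0 R := ⟨le_rfl, hR.1⟩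
    have hεR : ε * R ∈ Icc 0 T := ⟨mul_nonneg hε.le hR.1, by
      rw [← le_div_iff₀' hε]
      exact hR.2⟩
    have h1 := htrack R _ _ hR.2 hcl (by rw [hγ0]) (by rw [hγ0, projIcc_of_mem hT.le h0T]) R hRR
    rw [projIcc_of_mem hT.le hεR] at h1
    refine ⟨⟨⟨?_, ?_⟩, hδK (Metric.mem_cthickening_of_dist_le _ _ _ _
      (mem_image_of_mem _ hεR) (h1.trans hεδ))⟩, h1⟩
    · have h2 := hcl.monotoneOn_angle hε hεb hU1 h0R hRR hR.1
      simp only [hγ0] at h2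
      linarith
    · have h2 := hcl.angle_le hε hε1 hU1 hRR
      simp only [hγ0] at h2
      have h3 : 2 * c.bound * R ≤ 2 * c.bound * (T / ε) := by
        gcongr
        exact hR.2
      linarith
  have hO : ∀ t ∈ Icc 0 (T / ε), γ t ∈ Ioo (ϑ - 1) (b + 1) ×ˢ interior K := by
    refine forall_mem_of_isOpen_of_isClosed hγc (isClosed_Icc.prod hK.isClosed)
      (isOpen_Ioo.prod isOpen_interior) (prod_mono Ioo_subset_Icc_self interior_subset) ?_
      fun t ht hN => (hest t ht hN).1
    rw [hγ0]
    refine ⟨⟨by linarith, ?_⟩, hK₀K (mem_image_of_mem _ h0T)⟩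
    have : 0 ≤ 2 * c.bound * (T / ε) := by positivity
    simp only [hbdef]
    linarith
  have hN : ∀ t ∈ Icc 0 (T / ε), γ t ∈ Icc (ϑ - 1) (b + 1) ×ˢ K := fun t ht =>
    prod_mono Ioo_subset_Icc_self interior_subset (hO t ht)
  refine ⟨fun t => U (γ t).1, fun t => ((γ t).1 : Real.Angle), fun t => (γ t).2,
    (hUs.continuous.comp hγc.fst).measurable, fun t => hU1 _,
    isSolution_of_hasMFDerivAt hFs hc hC0.le hC hε hTε hU1 (fun t ht => (hN t ht).2)
      fun t ht => hγd t (hN t ht), ?_, ?_, fun t ht => ?_⟩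
  · simp only [hγ0, hϑθ]
  · simp only [hγ0]
  · exact (hest t ht fun r hr => hN r ⟨hr.1, hr.2.trans ht.2⟩).2

end Existence

end KeplerSystem

theorem theorem4p3 {n m : ℕ} {M : Type*} [MetricSpace M] [ConnectedSpace M]
    [ChartedSpace (EucR n) M] [IsManifold (𝓡 n) ∞ M]
    [RiemannianBundle (fun x : M => TangentSpace (𝓡 n) x)]
    [IsContMDiffRiemannianBundle (𝓡 n) ∞ (EucR n) (fun x : M => TangentSpace (𝓡 n) x)]
    [IsRiemannianManifold (𝓡 n) M]
    (S : KeplerSystem n m M) (T : ℝ) (hT : 0 < T) :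
    (∀ (x₀ : ℝ → M) (θ₀ : Real.Angle), S.IsAverageSolution T x₀ →
      ∃ u : ℝ → ℝ → EucR m, (∀ ε, 0 < ε → Measurable (u ε) ∧ ∀ t, ‖u ε t‖ ≤ 1) ∧
      ∃ c : ℝ, 0 < c ∧ ∃ ε₀ : ℝ, 0 < ε₀ ∧
      ∃ (θ : ℝ → ℝ → Real.Angle) (x : ℝ → ℝ → M),
        (∀ ε, 0 < ε → ε < ε₀ →
          -- the solution with control `u ε` is defined on the whole of `[0, T / ε]`
          (S.IsSolution ε (T / ε) (u ε) (θ ε) (x ε) ∧ θ ε 0 = θ₀ ∧ x ε 0 = x₀ 0) ∧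
          -- it is the only one
          (∀ (T' : ℝ) (θ' : ℝ → Real.Angle) (x' : ℝ → M), 0 ≤ T' → T' ≤ T / ε →
            S.IsSolution ε T' (u ε) θ' x' → θ' 0 = θ₀ → x' 0 = x₀ 0 →
            ∀ t ∈ Icc 0 T', θ' t = θ ε t ∧ x' t = x ε t) ∧
          -- the error is of order `ε`
          ∀ t ∈ Icc 0 (T / ε), dist (x ε t) (x₀ (ε * t)) < c * ε) ∧
        TendstoUniformlyOn (fun ε τ => x ε (τ / ε)) x₀ (𝓝[>] 0) (Icc 0 T)) ∧
    (∀ (K : Set M), IsCompact K →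
      ∀ ε : ℕ → ℝ, Antitone ε → (∀ k, 0 < ε k) → Tendsto ε atTop (𝓝 0) →
      ∀ (u : ℕ → ℝ → EucR m) (θ : ℕ → ℝ → Real.Angle) (x : ℕ → ℝ → M),
      (∀ k, IsUnitControlOn (u k) (Icc 0 (T / ε k)) ∧
        S.IsSolution (ε k) (T / ε k) (u k) (θ k) (x k) ∧
        ∀ t ∈ Icc 0 (T / ε k), x k t ∈ K) →
      -- every subsequence has a uniformly convergent subsequence
      (∀ φ : ℕ → ℕ, StrictMono φ → ∃ ψ : ℕ → ℕ, StrictMono ψ ∧ ∃ y : ℝ → M,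
        TendstoUniformlyOn (fun k τ => x (φ (ψ k)) (τ / ε (φ (ψ k)))) y atTop (Icc 0 T)) ∧
      -- the limit of any convergent subsequence solves the average inclusion
      (∀ φ : ℕ → ℕ, StrictMono φ → ∀ y : ℝ → M,
        TendstoUniformlyOn (fun k τ => x (φ k) (τ / ε (φ k))) y atTop (Icc 0 T) →
        S.IsAverageSolution T y)) := by
  have : IsContinuousRiemannianBundle (EucR n) (fun x : M => TangentSpace (𝓡 n) x) := by
    obtain ⟨g, hg, hg'⟩ :=
      ‹IsContMDiffRiemannianBundle (𝓡 n) ∞ (EucR n) (fun x : M => TangentSpace (𝓡 n) x)›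
    exact ⟨g, hg.continuous, hg'⟩
  refine ⟨fun x₀ θ₀ h₀ => ?_, fun K hK ε _ hε hε0 u θ x h => ⟨fun φ hφ => ?_, fun φ hφ => ?_⟩⟩
  · obtain ⟨C, hC0, ε₀, hε₀, hC⟩ := h₀.exists_isSolution_dist_le hT θ₀
    have hex : ∀ ε, 0 < ε → ∃ (u : ℝ → EucR m) (θ : ℝ → Real.Angle) (x : ℝ → M),
        (Measurable u ∧ ∀ t, ‖u t‖ ≤ 1) ∧ (ε < ε₀ → S.IsSolution ε (T / ε) u θ x ∧ θ 0 = θ₀ ∧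
          x 0 = x₀ 0 ∧ ∀ t ∈ Icc 0 (T / ε), dist (x t) (x₀ (ε * t)) ≤ C * ε) := by
      intro ε hε
      by_cases hεε₀ : ε < ε₀
      · obtain ⟨u, θ, x, hu, hu1, hx⟩ := hC ε hε hεε₀
        exact ⟨u, θ, x, ⟨hu, hu1⟩, fun _ => hx⟩
      -- for `ε ≥ ε₀`, only the control is required to be admissible
      · exact ⟨0, fun _ => θ₀, x₀, ⟨measurable_zero, by simp⟩, fun h => absurd h hεε₀⟩
    have : Nonempty M := ⟨x₀ 0⟩
    choose! u θ x hu hx using hex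
    have hlt : ∀ ε, 0 < ε → ε < ε₀ → ∀ t ∈ Icc 0 (T / ε),
        dist (x ε t) (x₀ (ε * t)) < (C + 1) * ε := fun ε hε hεε₀ t ht =>
      ((hx ε hε hεε₀).2.2.2 t ht).trans_lt (by linarith)
    refine ⟨u, hu, C + 1, by positivity, ε₀, hε₀, θ, x, fun ε hε hεε₀ => ?_, ?_⟩
    · obtain ⟨hsol, hθ, hx0, -⟩ := hx ε hε hεε₀
      refine ⟨⟨hsol, hθ, hx0⟩, fun T' θ' x' hT' hT'T h' hθ' hx' => ?_, hlt ε hε hεε₀⟩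
      exact h'.eq hε hT' (hu ε hε).2 (hsol.mono hT' hT'T) (hθ'.trans hθ.symm) (hx'.trans hx0.symm)
    · rw [Metric.tendstoUniformlyOn_iff]
      intro η hη
      have hlim : Tendsto (fun ε : ℝ => (C + 1) * ε) (𝓝[>] 0) (𝓝 0) := by
        have : Tendsto (fun ε : ℝ => (C + 1) * ε) (𝓝 0) (𝓝 ((C + 1) * 0)) :=
          tendsto_id.const_mul _
        rw [mul_zero] at this
        exact this.mono_left nhdsWithin_le_nhds
      filter_upwards [hlim.eventually_lt_const hη, Ioo_mem_nhdsGT hε₀] with ε hεη hεε₀ τ hτ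
      have h := hlt ε hεε₀.1 hεε₀.2 (τ / ε) (OscillatingCoeffs.div_mem_Icc hεε₀.1 hτ)
      rw [mul_div_cancel₀ τ hεε₀.1.ne', dist_comm] at h
      exact h.trans hεη
  · exact (KeplerSystem.exists_subseq_and_isAverageSolution hK hT (fun k => hε (φ k))
      (hε0.comp hφ.tendsto_atTop) fun k => h (φ k)).1
  · exact (KeplerSystem.exists_subseq_and_isAverageSolution hK hT (fun k => hε (φ k))
      (hε0.comp hφ.tendsto_atTop) fun k => h (φ k)).2

end
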